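/- Let $q\in(0,1)$. Let $C(SU_q(3))$ be the universal $C^*$-algebra generated by elements $u_{ij}$, $i,j\in\{1,2,3\}$, such that the matrix $\mathbf u=(u_{ij})$ is unitary and $$\sum_{i_1,i_2,i_3=1}^3E_{i_1i_2i_3}\,u_{j_1i_1}u_{j_2i_2}u_{j_3i_3}=E_{j_1j_2j_3}\qquad (j_1,j_2,j_3\in\{1,2,3\}),$$ where $E_{i_1i_2i_3}=(-q)^{I(i_1,i_2,i_3)}$ if $i_1,i_2,i_3$ are pairwise distinct, with $I(i_1,i_2,i_3)$ the number of inversions, and $E_{i_1i_2i_3}=0$ otherwise. Let $C(SU_q(3)/\mathbb T^2)$ be the fixed point algebra of the gauge action $\mu$ of $\mathbb T^2$ on $C(SU_q(3))$ given by $\mu_{(z_1,z_2)}(u_{ij})=z_ju_{ij}$, where $z_3=(z_1z_2)^{-1}$. On $\ell^2(\mathbb N^k)$ ($\mathbb N\ni 0$), with orthonormal basis $|n_1,\dots,n_k\rangle$ and standard unit vectors $e_r\in\mathbb N^k$, let $a_r|n\rangle=\sqrt{1-q^{2n_r}}\,|n-e_r\rangle$ (which is $0$ if $n_r=0$), $c_r|n\rangle=q^{n_r}|n\rangle$,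 and let $$V_{12}(r)=\begin{pmatrix}a_r&-qc_r&0\\c_r&a_r^*&0\\0&0&1\end{pmatrix},\qquad V_{23}(r)=\begin{pmatrix}1&0&0\\0&a_r&-qc_r\\0&c_r&a_r^*\end{pmatrix}.$$ For $\phi,\psi\in\mathbb T$, the irreducible representations $\pi_*^{\phi,\psi}$ of $C(SU_q(3))$ on the Hilbert spaces $\mathcal H_3=\ell^2(\mathbb N^3)$, $\mathcal H_{21}=\mathcal H_{22}=\ell^2(\mathbb N^2)$, $\mathcal H_{11}=\mathcal H_{12}=\ell^2(\mathbb N)$, $\mathcal H_0=\mathbb C$ are those that send the matrix $\mathbf u$ to, respectively, $$\begin{aligned} \pi_3^{\phi,\psi}:&\ V_{23}(3)V_{12}(1)V_{23}(2)\,\mathrm{diag}(\phi,\overline{\phi\psi},\psi), & \pi_{21}^{\phi,\psi}:&\ V_{12}(1)V_{23}(2)\,\mathrm{diag}(\phi,\overline{\phi\psi},\psi),\\ \pi_{22}^{\phi,\psi}:&\ V_{23}(2)V_{12}(1)\,\mathrm{diag}(\phi,-\psi,-\overline{\phi\psi}), & \pi_{11}^{\phi,\psi}:&\ V_{12}(1)\,\mathrm{diag}(\psi,-\phi,-\overline{\phi\psi}),\\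 \pi_{12}^{\phi,\psi}:&\ V_{23}(1)\,\mathrm{diag}(-\phi,\overline{\phi\psi},-\psi), & \pi_0^{\phi,\psi}:&\ \mathrm{diag}(\phi,\psi,\overline{\phi\psi}). \end{aligned}$$ Let $\rho_*$ be the restriction of $\pi_*^{1,1}$ to $C(SU_q(3)/\mathbb T^2)$, and let $J_*=\rho_*^{-1}(\mathcal K(\mathcal H_*))$, where $\mathcal K(\mathcal H_*)$ denotes the compact operators on $\mathcal H_*$. Then: (i) The representation $\rho_3$ of $C(SU_q(3)/\mathbb T^2)$ is faithful. (ii) $J_3=\ker(\rho_{21})\cap\ker(\rho_{22})$. (iii) $J_{21}=J_{22}=\ker(\rho_{21})+\ker(\rho_{22})=\ker(\rho_{11})\cap\ker(\rho_{12})$. (iv) $J_{11}=J_{12}=\ker(\rho_{11})+\ker(\rho_{12})=\ker(\rho_0)$. -/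

import Mathlib

open scoped ENNReal

noncomputable section

namespace QuantumFlag

universe u

/-! ## The defining relations -/

/-- The number of inversions `I(i, j, k)` of the sequence `(i, j, k)`. -/
def inversions (i j k : Fin 3) : ℕ :=
  (if j < i then 1 else 0) + (if k < i then 1 else 0) + (if k < j then 1 else 0)

/-- The twisted Levi-Civita symbol `E_{ijk}`: it is `(-q)^{I(i,j,k)}` if `i, j, k` are pairwise
distinct, and `0` otherwise. -/
def twistedE (q : ℝ) (i j k : Fin 3) : ℂ :=
  if i ≠ j ∧ i ≠ k ∧ j ≠ k then (-(q : ℂ)) ^ inversions i j k else 0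

/-- The defining relations of `C(SU_q(3))`: the matrix `v` is unitary and satisfies the twisted
determinant condition. -/
structure IsSUqThree (q : ℝ) {B : Type u} [Ring B] [StarRing B] [Algebra ℂ B]
    (v : Matrix (Fin 3) (Fin 3) B) : Prop where
  unitary : v ∈ unitary (Matrix (Fin 3) (Fin 3) B)
  det : ∀ j₁ j₂ j₃, ∑ i₁, ∑ i₂, ∑ i₃, twistedE q i₁ i₂ i₃ • (v j₁ i₁ * v j₂ i₂ * v j₃ i₃)
    = twistedE q j₁ j₂ j₃ • (1 : B)

section Relations

variable {q : ℝ} {B C : Type*} [Ring B] [StarRing B] [Algebra ℂ B]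
  [Ring C] [StarRing C] [Algebra ℂ C] {v w : Matrix (Fin 3) (Fin 3) B}

theorem isSUqThree_map_iff (f : B →⋆ₐ[ℂ] C) (hf : Function.Injective f) :
    IsSUqThree q (v.map f) ↔ IsSUqThree q v := by
  have hst : star (v.map f) = (star v).map f := by
    ext i j; simp [Matrix.star_apply, map_star]
  have hinj : Function.Injective (fun M : Matrix (Fin 3) (Fin 3) B => M.map f) :=
    Matrix.map_injective hf
  have hmul : ∀ M N : Matrix (Fin 3) (Fin 3) B, M.map f * N.map f = (M * N).map f := fun M N => by
    rw [Matrix.map_mul]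
  have hone : (1 : Matrix (Fin 3) (Fin 3) C) = (1 : Matrix (Fin 3) (Fin 3) B).map f := by
    rw [Matrix.map_one] <;> simp
  have hu : v.map f ∈ unitary (Matrix (Fin 3) (Fin 3) C) ↔
      v ∈ unitary (Matrix (Fin 3) (Fin 3) B) := by
    rw [Unitary.mem_iff, Unitary.mem_iff, hst, hmul, hmul, hone, hinj.eq_iff, hinj.eq_iff]
  have hd : ∀ j₁ j₂ j₃, (∑ i₁, ∑ i₂, ∑ i₃,
        twistedE q i₁ i₂ i₃ • (v.map f j₁ i₁ * v.map f j₂ i₂ * v.map f j₃ i₃)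
        = twistedE q j₁ j₂ j₃ • (1 : C)) ↔
      (∑ i₁, ∑ i₂, ∑ i₃, twistedE q i₁ i₂ i₃ • (v j₁ i₁ * v j₂ i₂ * v j₃ i₃)
        = twistedE q j₁ j₂ j₃ • (1 : B)) := fun j₁ j₂ j₃ => by
    rw [← hf.eq_iff]
    simp only [map_sum, map_smul, map_mul, map_one, Matrix.map_apply]
  exact ⟨fun h => ⟨hu.1 h.unitary, fun a b c => (hd a b c).1 (h.det a b c)⟩,
    fun h => ⟨hu.2 h.unitary, fun a b c => (hd a b c).2 (h.det a b c)⟩⟩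

/-- Products of solutions with commuting entries are solutions. -/
theorem IsSUqThree.mul (hv : IsSUqThree q v) (hw : IsSUqThree q w)
    (h : ∀ i j k l, v i j * w k l = w k l * v i j) : IsSUqThree q (v * w) where
  unitary := mul_mem hv.unitary hw.unitary
  det j₁ j₂ j₃ := by
    have key : ∀ i : Fin 3 × Fin 3 × Fin 3,
        twistedE q i.1 i.2.1 i.2.2 • ((v * w) j₁ i.1 * (v * w) j₂ i.2.1 * (v * w) j₃ i.2.2)
        = ∑ a : Fin 3 × Fin 3 × Fin 3, (v j₁ a.1 * v j₂ a.2.1 * v j₃ a.2.2) *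
            (twistedE q i.1 i.2.1 i.2.2 • (w a.1 i.1 * w a.2.1 i.2.1 * w a.2.2 i.2.2)) := by
      intro i
      simp only [Fintype.sum_prod_type, Matrix.mul_apply, Finset.sum_mul, Finset.mul_sum,
        Finset.smul_sum]
      have swap : ∀ f : Fin 3 → Fin 3 → Fin 3 → B,
          ∑ x, ∑ y, ∑ z, f z y x = ∑ x, ∑ y, ∑ z, f x y z := fun f => by
        rw [Finset.sum_comm, Finset.sum_congr rfl fun y _ => Finset.sum_comm, Finset.sum_comm]
      refine (swap fun a b c => twistedE q i.1 i.2.1 i.2.2 •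
        (v j₁ a * w a i.1 * (v j₂ b * w b i.2.1) * (v j₃ c * w c i.2.2))).trans ?_
      refine Finset.sum_congr rfl fun a _ => Finset.sum_congr rfl fun b _ =>
        Finset.sum_congr rfl fun c _ => ?_
      rw [mul_smul_comm]
      congr 1
      have e1 := h j₂ b a i.1
      have e2 := h j₃ c b i.2.1
      have e3 := h j₃ c a i.1
      calc v j₁ a * w a i.1 * (v j₂ b * w b i.2.1) * (v j₃ c * w c i.2.2)
          = v j₁ a * (w a i.1 * v j₂ b) * (w b i.2.1 * v j₃ c) * w c i.2.2 := by noncomm_ring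
        _ = v j₁ a * v j₂ b * (w a i.1 * v j₃ c) * w b i.2.1 * w c i.2.2 := by
            rw [← e1, ← e2]; noncomm_ring
        _ = _ := by rw [← e3]; noncomm_ring
    have hsum : ∀ f : Fin 3 → Fin 3 → Fin 3 → B, ∑ i₁, ∑ i₂, ∑ i₃, f i₁ i₂ i₃
        = ∑ i : Fin 3 × Fin 3 × Fin 3, f i.1 i.2.1 i.2.2 := fun f => by
      simp only [Fintype.sum_prod_type]
    rw [hsum, Finset.sum_congr rfl fun i _ => key i, Finset.sum_comm]
    simp only [← Finset.mul_sum]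
    have hw' : ∀ a : Fin 3 × Fin 3 × Fin 3, ∑ i : Fin 3 × Fin 3 × Fin 3,
        twistedE q i.1 i.2.1 i.2.2 • (w a.1 i.1 * w a.2.1 i.2.1 * w a.2.2 i.2.2)
        = twistedE q a.1 a.2.1 a.2.2 • (1 : B) := fun a => by
      rw [← hw.det a.1 a.2.1 a.2.2, hsum]
    simp only [hw', mul_smul_comm, mul_one]
    rw [← hv.det j₁ j₂ j₃, hsum]

end Relations

/-! ## The universal C*-algebra -/

theorem exists_cstarAlgebra_of_algEquiv {S : Type u} [CStarAlgebra S] {T : Type} [Ring T]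
    [Algebra ℂ T] (e : T ≃ₐ[ℂ] S) :
    ∃ (T' : Type) (_ : CStarAlgebra T'), Nonempty (T' ≃⋆ₐ[ℂ] S) := by
  let i1 : NormedRing T := NormedRing.induced _ S e.toRingEquiv e.injective
  let i2 : NormedAlgebra ℂ T := NormedAlgebra.induced ℂ _ S e.toAlgHom
  let i3 : StarRing T :=
    { star := fun x => e.symm (star (e x))
      star_involutive := fun x => by simp
      star_mul := fun x y => by simp
      star_add := fun x y => by simp }
  have hn : ∀ x : T, ‖x‖ = ‖e x‖ := fun _ => rfl
  have hs : ∀ x : T, e (star x) = star (e x) := fun x => by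
    change e (e.symm (star (e x))) = _
    simp
  let i4 : CStarRing T := ⟨fun x => by
    rw [hn, hn, map_mul, hs]; exact (CStarRing.norm_star_mul_self).symm.le⟩
  let i5 : StarModule ℂ T := ⟨fun c x => by
    apply e.injective; simp [hs]⟩
  have i6 : CompleteSpace T := by
    have : Isometry e := Isometry.of_dist_eq fun x y => by
      rw [dist_eq_norm, dist_eq_norm, ← map_sub, hn]
    exact ((IsometryEquiv.mk e.toEquiv this).completeSpace)
  exact ⟨T, { i1, i2, i3, i4, i5, i6 with }, ⟨StarAlgEquiv.ofAlgEquiv e hs⟩⟩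

theorem exists_small_copy (S : Type u) [CStarAlgebra S] [Small.{0} S] :
    ∃ (T : Type) (_ : CStarAlgebra T), Nonempty (T ≃⋆ₐ[ℂ] S) :=
  exists_cstarAlgebra_of_algEquiv (Shrink.algEquiv.{0} ℂ S)

/-- The C*-subalgebra generated by the entries of `v`. -/
def generated {B : Type u} [CStarAlgebra B] (v : Matrix (Fin 3) (Fin 3) B) : StarSubalgebra ℂ B :=
  (StarAlgebra.adjoin ℂ (Set.range fun p : Fin 3 × Fin 3 => v p.1 p.2)).topologicalClosure

instance {B : Type u} [CStarAlgebra B] (v : Matrix (Fin 3) (Fin 3) B) :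
    IsClosed (generated v : Set B) :=
  StarSubalgebra.isClosed_topologicalClosure _

theorem mem_generated {B : Type u} [CStarAlgebra B] (v : Matrix (Fin 3) (Fin 3) B) (i j : Fin 3) :
    v i j ∈ generated v :=
  StarSubalgebra.le_topologicalClosure _ (StarAlgebra.subset_adjoin ℂ _ ⟨(i, j), rfl⟩)

/-- In a metric space, the closure of a small set is small. -/
theorem small_closure_of_small {B : Type u} [MetricSpace B] (A : Set B) (hA : Small.{0} A)
    (G : Set B) (hG : ∀ x, x ∈ G ↔ x ∈ closure A) : Small.{0} G := by
  let d : (ℕ → Shrink.{0} A) → ℕ → B := fun s n => ((equivShrink A).symm (s n) : A)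
  let D : Set (ℕ → Shrink.{0} A) := {s | ∃ x : B, Filter.Tendsto (d s) Filter.atTop (nhds x)}
  have hD : ∀ s : D, ∃ x : G, Filter.Tendsto (d s) Filter.atTop (nhds (x : B)) := by
    intro s
    obtain ⟨x, hx⟩ := s.2
    refine ⟨⟨x, (hG x).2 ?_⟩, hx⟩
    refine mem_closure_of_tendsto hx (Filter.Eventually.of_forall fun n => ?_)
    exact ((equivShrink A).symm (s.1 n)).2
  let L : D → G := fun s => Classical.choose (hD s)
  have hL : ∀ s : D, Filter.Tendsto (d s) Filter.atTop (nhds (L s : B)) :=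
    fun s => Classical.choose_spec (hD s)
  refine small_of_surjective (f := L) fun y => ?_
  obtain ⟨s, hs, hsx⟩ := mem_closure_iff_seq_limit.1 ((hG y).1 y.2)
  let t : ℕ → Shrink.{0} A := fun n => equivShrink A ⟨s n, hs n⟩
  have ht : d t = s := by funext n; simp [d, t]
  have hty : Filter.Tendsto (d t) Filter.atTop (nhds (y : B)) := ht ▸ hsx
  exact ⟨⟨t, y, hty⟩, Subtype.ext (tendsto_nhds_unique (hL _) hty)⟩

instance small_generated {B : Type u} [CStarAlgebra B] (v : Matrix (Fin 3) (Fin 3) B) :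
    Small.{0} (generated v) := by
  let X : Type := (Fin 3 × Fin 3) ⊕ (Fin 3 × Fin 3)
  let g : X → B := Sum.elim (fun p => v p.1 p.2) (fun p => star (v p.1 p.2))
  let S := Set.range fun p : Fin 3 × Fin 3 => v p.1 p.2
  have hrange : ((StarAlgebra.adjoin ℂ S : StarSubalgebra ℂ B) : Set B)
      = Set.range (FreeAlgebra.lift ℂ g) := by
    have h1 : Set.range g = S ∪ star S := by
      ext x
      simp only [Set.mem_range, Sum.exists, Set.mem_union, Set.mem_star, g, S, X, Sum.elim_inl,
        Sum.elim_inr]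
      exact or_congr Iff.rfl (exists_congr fun p => star_eq_iff_star_eq.trans eq_comm)
    have h2 : (StarAlgebra.adjoin ℂ S).toSubalgebra = (FreeAlgebra.lift ℂ g).range := by
      rw [StarAlgebra.adjoin_toSubalgebra, ← h1, Algebra.adjoin_range_eq_range_freeAlgebra_lift]
    exact congrArg (fun T : Subalgebra ℂ B => (T : Set B)) h2
  let A : Set B := Set.range (FreeAlgebra.lift ℂ g)
  have hcl : ∀ x, x ∈ generated v ↔ x ∈ closure A := fun x => by
    change x ∈ closure ((StarAlgebra.adjoin ℂ S : StarSubalgebra ℂ B) : Set B) ↔ _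
    rw [hrange]
  have hA : Small.{0} A := by
    simp only [A]; infer_instance
  exact small_closure_of_small A hA _ hcl

/-- All matrices, over nonzero C*-algebras, that satisfy the defining relations. -/
structure Model (q : ℝ) : Type 1 where
  carrier : Type
  [cstar : CStarAlgebra carrier]
  [nontriv : Nontrivial carrier]
  mat : Matrix (Fin 3) (Fin 3) carrier
  isSUq : IsSUqThree q mat

attribute [instance] Model.cstar Model.nontriv

/-- The `ℓ^∞`-product of all models. -/
abbrev ModelProd (q : ℝ) : Type 1 := lp (fun m : Model q => m.carrier) ∞

instance (q : ℝ) : CStarAlgebra (ModelProd q) where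


open scoped CStarAlgebra in
theorem IsSUqThree.norm_le_one {q : ℝ} {B : Type u} [CStarAlgebra B] [Nontrivial B]
    {v : Matrix (Fin 3) (Fin 3) B} (hv : IsSUqThree q v) (i j : Fin 3) : ‖v i j‖ ≤ 1 := by
  let _ : PartialOrder B := CStarAlgebra.spectralOrder B
  have _ : StarOrderedRing B := CStarAlgebra.spectralOrderedRing B
  have h1 : ∑ k, star (v k j) * v k j = 1 := by
    have := congrFun (congrFun (Unitary.mem_iff.1 hv.unitary).1 j) j
    simpa [Matrix.mul_apply, Matrix.star_apply] using this
  have h2 : star (v i j) * v i j ≤ 1 := by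
    rw [← h1]
    exact Finset.single_le_sum (f := fun k => star (v k j) * v k j)
      (fun k _ => star_mul_self_nonneg (v k j)) (Finset.mem_univ i)
  have h3 := CStarAlgebra.norm_le_norm_of_nonneg_of_le (star_mul_self_nonneg (v i j)) h2
  rw [CStarRing.norm_star_mul_self, norm_one] at h3
  nlinarith [norm_nonneg (v i j)]

/-- The tuple of all models, an element of the `ℓ^∞`-product. -/
def universalMatrix (q : ℝ) : Matrix (Fin 3) (Fin 3) (ModelProd q) := fun i j =>
  ⟨fun m => m.mat i j, memℓp_infty ⟨1, by rintro _ ⟨m, rfl⟩; exact m.isSUq.norm_le_one i j⟩⟩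

/-- The projection of the `ℓ^∞`-product onto one model. -/
def evalModel {q : ℝ} (m : Model q) : ModelProd q →⋆ₐ[ℂ] m.carrier where
  toFun x := x m
  map_one' := rfl
  map_mul' _ _ := rfl
  map_zero' := rfl
  map_add' _ _ := rfl
  commutes' _ := rfl
  map_star' _ := rfl

theorem isSUqThree_universalMatrix (q : ℝ) : IsSUqThree q (universalMatrix q) := by
  have hmap : ∀ m : Model q, (universalMatrix q).map (evalModel m) = m.mat := fun m => rfl
  have hext : ∀ x y : ModelProd q, (∀ m, evalModel m x = evalModel m y) → x = y :=
    fun x y h => lp.ext (funext h)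
  refine ⟨Unitary.mem_iff.2 ⟨?_, ?_⟩, fun j₁ j₂ j₃ => hext _ _ fun m => ?_⟩
  · refine Matrix.ext fun i j => hext _ _ fun m => ?_
    have h := congrFun (congrFun (Unitary.mem_iff.1 m.isSUq.unitary).1 i) j
    rw [Matrix.one_apply, Matrix.mul_apply] at h ⊢
    rw [map_sum, apply_ite (evalModel m), map_one, map_zero, ← h]
    exact Finset.sum_congr rfl fun k _ => rfl
  · refine Matrix.ext fun i j => hext _ _ fun m => ?_
    have h := congrFun (congrFun (Unitary.mem_iff.1 m.isSUq.unitary).2 i) j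
    rw [Matrix.one_apply, Matrix.mul_apply] at h ⊢
    rw [map_sum, apply_ite (evalModel m), map_one, map_zero, ← h]
    exact Finset.sum_congr rfl fun k _ => rfl
  · simp only [map_sum, map_smul, map_mul, map_one]
    exact m.isSUq.det j₁ j₂ j₃

/-- `C(SU_q(3))`, the universal C*-algebra generated by the entries of a matrix that satisfies the
defining relations. It is realised as the C*-subalgebra of the `ℓ^∞`-product of all models which is
generated by the entries of the tuple of all models. Models are taken in the universe `Type`, but
the universal property holds for C*-algebras in every universe, see `exists_lift` and `hom_ext`. -/
def CSUqThree (q : ℝ) : Type 1 := generated (universalMatrix q)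

instance (q : ℝ) : CStarAlgebra (CSUqThree q) :=
  inferInstanceAs (CStarAlgebra (generated (universalMatrix q)))

/-- The generators `u_{ij}` of `C(SU_q(3))`. -/
def gen (q : ℝ) : Matrix (Fin 3) (Fin 3) (CSUqThree q) := fun i j =>
  (⟨universalMatrix q i j, mem_generated _ i j⟩ : generated (universalMatrix q))

theorem isSUqThree_gen (q : ℝ) : IsSUqThree q (gen q) :=
  (isSUqThree_map_iff (generated (universalMatrix q)).subtype Subtype.val_injective).1
    (isSUqThree_universalMatrix q)

/-- Two *-homomorphisms on `C(SU_q(3))` that agree on the generators are equal. -/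
theorem hom_ext {q : ℝ} {B : Type u} [CStarAlgebra B] {f g : CSUqThree q →⋆ₐ[ℂ] B}
    (h : ∀ i j, f (gen q i j) = g (gen q i j)) : f = g := by
  let S := Set.range fun p : Fin 3 × Fin 3 => universalMatrix q p.1 p.2
  have hf : Continuous f := AddMonoidHomClass.continuous_of_bound f 1 fun x => by
    simpa using NonUnitalStarAlgHom.norm_apply_le f x
  have hg : Continuous g := AddMonoidHomClass.continuous_of_bound g 1 fun x => by
    simpa using NonUnitalStarAlgHom.norm_apply_le g x
  refine StarAlgHom.ext_topologicalClosure (S := StarAlgebra.adjoin ℂ S) hf hg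
    (StarAlgHom.ext_adjoin fun x hx => ?_)
  obtain ⟨p, hp⟩ := hx
  have hx' : StarSubalgebra.inclusion (StarSubalgebra.le_topologicalClosure _) x
      = (gen q p.1 p.2 : CSUqThree q) := Subtype.ext hp.symm
  exact (congrArg f hx').trans ((h p.1 p.2).trans (congrArg g hx').symm)

/-- The universal property of `C(SU_q(3))`: every matrix over a C*-algebra which satisfies the
defining relations is the image of the matrix of generators under a *-homomorphism. -/
theorem exists_lift {q : ℝ} {B : Type u} [CStarAlgebra B] (v : Matrix (Fin 3) (Fin 3) B)
    (hv : IsSUqThree q v) : ∃ f : CSUqThree q →⋆ₐ[ℂ] B, ∀ i j, f (gen q i j) = v i j := by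
  rcases subsingleton_or_nontrivial B with hB | hB
  · exact ⟨⟨⟨⟨⟨⟨fun _ => 0, Subsingleton.elim _ _⟩, fun _ _ => Subsingleton.elim _ _⟩,
      Subsingleton.elim _ _, fun _ _ => Subsingleton.elim _ _⟩,
      fun _ => Subsingleton.elim _ _⟩, fun _ => Subsingleton.elim _ _⟩,
      fun _ _ => Subsingleton.elim _ _⟩
  · obtain ⟨T, hT, ⟨e⟩⟩ := exists_small_copy (generated v)
    have hnt : Nontrivial T := e.toEquiv.nontrivial
    let j : T →⋆ₐ[ℂ] B := (generated v).subtype.comp (e : T →⋆ₐ[ℂ] generated v)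
    have hj : Function.Injective j := Subtype.val_injective.comp e.injective
    let w : Matrix (Fin 3) (Fin 3) T := fun i k => e.symm ⟨v i k, mem_generated v i k⟩
    have hjw : w.map j = v := by
      ext i k
      exact congrArg Subtype.val (e.apply_symm_apply ⟨v i k, mem_generated v i k⟩)
    have hw : IsSUqThree q w := (isSUqThree_map_iff j hj).1 (hjw.symm ▸ hv)
    let m : Model q := { carrier := T, mat := w, isSUq := hw }
    refine ⟨(j.comp (evalModel m)).comp (generated (universalMatrix q)).subtype, fun i k => ?_⟩
    exact congrFun (congrFun hjw i) k

/-- The *-homomorphism on `C(SU_q(3))` with prescribed values on the generators. -/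
def lift {q : ℝ} {B : Type u} [CStarAlgebra B] (v : Matrix (Fin 3) (Fin 3) B)
    (hv : IsSUqThree q v) : CSUqThree q →⋆ₐ[ℂ] B :=
  Classical.choose (exists_lift v hv)

theorem lift_gen {q : ℝ} {B : Type u} [CStarAlgebra B] (v : Matrix (Fin 3) (Fin 3) B)
    (hv : IsSUqThree q v) (i j : Fin 3) : lift v hv (gen q i j) = v i j :=
  Classical.choose_spec (exists_lift v hv) i j

/-! ## The gauge action and its fixed point algebra -/

/-- The diagonal matrix `diag(t₁, t₂, t₃)` with scalar entries. -/
def torusMatrix (B : Type u) [Ring B] [Algebra ℂ B] (t₁ t₂ t₃ : ℂ) : Matrix (Fin 3) (Fin 3) B :=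
  !![algebraMap ℂ B t₁, 0, 0; 0, algebraMap ℂ B t₂, 0; 0, 0, algebraMap ℂ B t₃]

theorem isSUqThree_torusMatrix (q : ℝ) (B : Type u) [CStarAlgebra B] {t₁ t₂ t₃ : ℂ}
    (h₁ : ‖t₁‖ = 1) (h₂ : ‖t₂‖ = 1) (h₃ : ‖t₃‖ = 1) (h : t₁ * t₂ * t₃ = 1) :
    IsSUqThree q (torusMatrix B t₁ t₂ t₃) := by
  have hs : ∀ t : ℂ, ‖t‖ = 1 → star (algebraMap ℂ B t) * algebraMap ℂ B t = 1 := fun t ht => by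
    rw [← algebraMap_star_comm, ← map_mul, Complex.star_def, Complex.conj_mul', ht]; simp
  have hs' : ∀ t : ℂ, ‖t‖ = 1 → algebraMap ℂ B t * star (algebraMap ℂ B t) = 1 := fun t ht => by
    rw [← algebraMap_star_comm, ← map_mul, Complex.star_def, Complex.mul_conj', ht]; simp
  refine ⟨Unitary.mem_iff.2 ⟨?_, ?_⟩, ?_⟩
  · ext i j
    fin_cases i <;> fin_cases j <;>
      simp [torusMatrix, Matrix.mul_apply, Matrix.star_apply, Fin.sum_univ_three, hs, h₁, h₂, h₃]
  · ext i j
    fin_cases i <;> fin_cases j <;>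
      simp [torusMatrix, Matrix.mul_apply, Matrix.star_apply, Fin.sum_univ_three, hs', h₁, h₂, h₃]
  · have e1 : t₁ * t₃ * t₂ = 1 := by rw [← h]; ring
    have e2 : t₂ * t₁ * t₃ = 1 := by rw [← h]; ring
    have e3 : t₂ * t₃ * t₁ = 1 := by rw [← h]; ring
    have e4 : t₃ * t₁ * t₂ = 1 := by rw [← h]; ring
    have e5 : t₃ * t₂ * t₁ = 1 := by rw [← h]; ring
    intro a b c
    fin_cases a <;> fin_cases b <;> fin_cases c <;>
      simp [torusMatrix, Fin.sum_univ_three, twistedE, ← map_mul, h, e1, e2, e3, e4, e5]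

theorem torus_inv_mul (z₁ z₂ : Circle) : (z₁ : ℂ) * z₂ * ((z₁ * z₂)⁻¹ : Circle) = 1 := by
  rw [← Circle.coe_mul, ← Circle.coe_mul, mul_inv_cancel, Circle.coe_one]

/-- The matrix `(u_{i1} z₁, u_{i2} z₂, u_{i3} (z₁z₂)⁻¹)ᵢ`. -/
def gaugeMatrix (q : ℝ) (z₁ z₂ : Circle) : Matrix (Fin 3) (Fin 3) (CSUqThree q) :=
  gen q * torusMatrix (CSUqThree q) z₁ z₂ ((z₁ * z₂)⁻¹ : Circle)

theorem IsSUqThree.mul_torus {q : ℝ} {B : Type u} [CStarAlgebra B]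
    {v : Matrix (Fin 3) (Fin 3) B} (hv : IsSUqThree q v) {t₁ t₂ t₃ : ℂ}
    (h₁ : ‖t₁‖ = 1) (h₂ : ‖t₂‖ = 1) (h₃ : ‖t₃‖ = 1) (h : t₁ * t₂ * t₃ = 1) :
    IsSUqThree q (v * torusMatrix B t₁ t₂ t₃) := by
  refine hv.mul (isSUqThree_torusMatrix q B h₁ h₂ h₃ h) fun i j k l => ?_
  fin_cases k <;> fin_cases l <;> simp [torusMatrix, Algebra.commutes]

theorem isSUqThree_gaugeMatrix (q : ℝ) (z₁ z₂ : Circle) : IsSUqThree q (gaugeMatrix q z₁ z₂) :=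
  (isSUqThree_gen q).mul_torus (Circle.norm_coe _) (Circle.norm_coe _)
    (Circle.norm_coe _) (torus_inv_mul z₁ z₂)

/-- The gauge action `μ` of `𝕋²` on `C(SU_q(3))`, determined by `μ_z(u_{ij}) = z_j u_{ij}` with
`z₃ = (z₁z₂)⁻¹`. -/
def gauge (q : ℝ) (z₁ z₂ : Circle) : CSUqThree q →⋆ₐ[ℂ] CSUqThree q :=
  lift (gaugeMatrix q z₁ z₂) (isSUqThree_gaugeMatrix q z₁ z₂)

theorem gauge_gen (q : ℝ) (z₁ z₂ : Circle) (i j : Fin 3) :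
    gauge q z₁ z₂ (gen q i j) = (![z₁, z₂, (z₁ * z₂)⁻¹] j : ℂ) • gen q i j := by
  have h : ∀ (t : ℂ) (x : CSUqThree q), x * algebraMap ℂ _ t = t • x := fun t x => by
    rw [Algebra.smul_def, Algebra.commutes]
  rw [gauge, lift_gen, gaugeMatrix, Matrix.mul_apply, Fin.sum_univ_three]
  fin_cases j <;> simp only [torusMatrix] <;> simp [h, -map_mul, -map_inv₀]

/-- `C(SU_q(3)/𝕋²)`, the fixed point algebra of the gauge action. -/
def flagAlgebra (q : ℝ) : StarSubalgebra ℂ (CSUqThree q) where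
  carrier := {x | ∀ z₁ z₂ : Circle, gauge q z₁ z₂ x = x}
  mul_mem' hx hy z₁ z₂ := by rw [map_mul, hx, hy]
  add_mem' hx hy z₁ z₂ := by rw [map_add, hx, hy]
  algebraMap_mem' r z₁ z₂ := AlgHomClass.commutes _ r
  star_mem' hx z₁ z₂ := by rw [map_star, hx]

/-! ## The elementary representations -/

/-- `(a, c)` satisfies the relations of the generators of `C(SU_q(2))`, with `c` self-adjoint. -/
structure IsSUqTwoPair (q : ℝ) {B : Type u} [Ring B] [StarRing B] [Algebra ℂ B] (a c : B) :
    Prop where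
  star_c : star c = c
  mul_star : a * star a + ((q : ℂ) ^ 2) • (c * c) = 1
  star_mul : star a * a + c * c = 1
  comm : a * c = (q : ℂ) • (c * a)

/-- The embedding of the quantum `SU(2)` matrix in the rows and columns 1, 2. -/
def block₁₂ (q : ℝ) {B : Type u} [Ring B] [StarRing B] [Algebra ℂ B] (a c : B) :
    Matrix (Fin 3) (Fin 3) B :=
  !![a, -((q : ℂ) • c), 0; c, star a, 0; 0, 0, 1]

/-- The embedding of the quantum `SU(2)` matrix in the rows and columns 2, 3. -/
def block₂₃ (q : ℝ) {B : Type u} [Ring B] [StarRing B] [Algebra ℂ B] (a c : B) :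
    Matrix (Fin 3) (Fin 3) B :=
  !![1, 0, 0; 0, a, -((q : ℂ) • c); 0, c, star a]

section Blocks

variable {q : ℝ} {B : Type u} [Ring B] [StarRing B] [Algebra ℂ B] [StarModule ℂ B] {a c : B}

theorem IsSUqTwoPair.star_comm (h : IsSUqTwoPair q a c) :
    c * star a = (q : ℂ) • (star a * c) := by
  have := congrArg star h.comm
  simpa [h.star_c] using this

theorem IsSUqTwoPair.isSUqThree_block₁₂ (h : IsSUqTwoPair q a c) :
    IsSUqThree q (block₁₂ q a c) := by
  have h1 := h.star_c
  have h2 : a * star a = 1 - ((q : ℂ) ^ 2) • (c * c) := eq_sub_of_add_eq h.mul_star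
  have h3 : star a * a = 1 - c * c := eq_sub_of_add_eq h.star_mul
  have h4 := h.comm
  have h5 := h.star_comm
  refine ⟨Unitary.mem_iff.2 ⟨?_, ?_⟩, ?_⟩
  · ext i j
    fin_cases i <;> fin_cases j <;>
      simp [block₁₂, Matrix.mul_apply, Matrix.star_apply, Fin.sum_univ_three, h1, h2, h3, h4, h5,
        -Complex.coe_smul, smul_smul, sq]
  · ext i j
    fin_cases i <;> fin_cases j <;>
      simp [block₁₂, Matrix.mul_apply, Matrix.star_apply, Fin.sum_univ_three, h1, h2, h3, h4, h5,
        -Complex.coe_smul, smul_smul, sq]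
  · unfold twistedE block₁₂
    generalize (q : ℂ) = k at *
    intro i₁ i₂ i₃
    fin_cases i₁ <;> fin_cases i₂ <;> fin_cases i₃ <;>
      simp [Fin.sum_univ_three, inversions, h2, h3, h4, h5] <;> module

theorem IsSUqTwoPair.isSUqThree_block₂₃ (h : IsSUqTwoPair q a c) :
    IsSUqThree q (block₂₃ q a c) := by
  have h1 := h.star_c
  have h2 : a * star a = 1 - ((q : ℂ) ^ 2) • (c * c) := eq_sub_of_add_eq h.mul_star
  have h3 : star a * a = 1 - c * c := eq_sub_of_add_eq h.star_mul
  have h4 := h.comm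
  have h5 := h.star_comm
  refine ⟨Unitary.mem_iff.2 ⟨?_, ?_⟩, ?_⟩
  · ext i j
    fin_cases i <;> fin_cases j <;>
      simp [block₂₃, Matrix.mul_apply, Matrix.star_apply, Fin.sum_univ_three, h1, h2, h3, h4, h5,
        -Complex.coe_smul, smul_smul, sq]
  · ext i j
    fin_cases i <;> fin_cases j <;>
      simp [block₂₃, Matrix.mul_apply, Matrix.star_apply, Fin.sum_univ_three, h1, h2, h3, h4, h5,
        -Complex.coe_smul, smul_smul, sq]
  · unfold twistedE block₂₃
    generalize (q : ℂ) = k at *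
    intro i₁ i₂ i₃
    fin_cases i₁ <;> fin_cases i₂ <;> fin_cases i₃ <;>
      simp [Fin.sum_univ_three, inversions, h2, h3, h4, h5] <;> module

end Blocks

/-! ## Weighted shifts -/

/-- The Hilbert space `ℓ²(ℕᵏ)`. -/
abbrev Hil (k : ℕ) : Type := lp (fun _ : Fin k → ℕ => ℂ) 2

section Shift

variable {ι : Type}

/-- Data of a weighted partial shift `f ↦ (n ↦ w n * f (σ n))`, where `σ` is injective on the
support of the weight `w`. -/
structure ShiftData (ι : Type) where
  w : ι → ℝ
  σ : ι → ι
  abs_le : ∀ n, |w n| ≤ 1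
  inj : ∀ m n, w m ≠ 0 → w n ≠ 0 → σ m = σ n → m = n

theorem ShiftData.summable (S : ShiftData ι) (f : lp (fun _ : ι => ℂ) 2) :
    Summable (fun n => ‖(S.w n : ℂ) * f (S.σ n)‖ ^ 2) ∧
      ∑' n, ‖(S.w n : ℂ) * f (S.σ n)‖ ^ 2 ≤ ‖f‖ ^ 2 := by
  have hf : HasSum (fun n => ‖f n‖ ^ 2) (‖f‖ ^ 2) := by
    simpa using lp.hasSum_norm (p := 2) (by norm_num) f
  let T : Set ι := {n | S.w n ≠ 0}
  have hinj : Function.Injective (fun n : T => S.σ n) := fun m n h =>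
    Subtype.ext (S.inj m n m.2 n.2 h)
  have hs : Summable (fun n : T => ‖f (S.σ n)‖ ^ 2) := hf.summable.comp_injective hinj
  have hle : ∀ n, ‖(S.w n : ℂ) * f (S.σ n)‖ ^ 2 ≤ T.indicator (fun n => ‖f (S.σ n)‖ ^ 2) n := by
    intro n
    by_cases hn : n ∈ T
    · rw [Set.indicator_of_mem hn, norm_mul, mul_pow]
      have : ‖(S.w n : ℂ)‖ ^ 2 ≤ 1 := by
        rw [Complex.norm_real, Real.norm_eq_abs]
        exact pow_le_one₀ (abs_nonneg _) (S.abs_le n)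
      exact mul_le_of_le_one_left (by positivity) this
    · have : S.w n = 0 := by simpa [T] using hn
      simp [this, Set.indicator_of_notMem hn]
  have hs' : Summable (T.indicator fun n => ‖f (S.σ n)‖ ^ 2) := by
    rwa [← summable_subtype_iff_indicator]
  have h0 := Summable.of_nonneg_of_le (fun n => by positivity) hle hs'
  refine ⟨h0, (h0.tsum_le_tsum hle hs').trans ?_⟩
  rw [← tsum_subtype, ← hf.tsum_eq]
  exact hs.tsum_le_tsum_of_inj _ hinj (fun _ _ => by positivity) (fun _ => le_rfl) hf.summable

/-- The bounded operator `f ↦ (n ↦ w n * f (σ n))` on `ℓ²`. -/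
def ShiftData.op (S : ShiftData ι) :
    lp (fun _ : ι => ℂ) 2 →L[ℂ] lp (fun _ : ι => ℂ) 2 :=
  LinearMap.mkContinuous
    { toFun := fun f => ⟨fun n => (S.w n : ℂ) * f (S.σ n), by
        refine (memℓp_gen_iff (by norm_num)).2 ?_
        simpa using (S.summable f).1⟩
      map_add' := fun f g => by ext n; exact mul_add _ _ _
      map_smul' := fun c f => by ext n; simp; ring }
    1 fun f => by
      rw [one_mul]
      refine le_of_sq_le_sq ?_ (norm_nonneg _)
      have := lp.norm_rpow_eq_tsum (p := 2) (by norm_num)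
        (⟨fun n => (S.w n : ℂ) * f (S.σ n), by
          refine (memℓp_gen_iff (by norm_num)).2 ?_
          simpa using (S.summable f).1⟩ : lp (fun _ : ι => ℂ) 2)
      simp at this
      simp
      rw [this]
      simpa using (S.summable f).2

@[simp]
theorem ShiftData.op_apply (S : ShiftData ι) (f : lp (fun _ : ι => ℂ) 2) (n : ι) :
    S.op f n = (S.w n : ℂ) * f (S.σ n) := rfl

theorem ShiftData.star_op (S T : ShiftData ι)
    (h₁ : ∀ n, S.w n ≠ 0 → T.σ (S.σ n) = n ∧ T.w (S.σ n) = S.w n)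
    (h₂ : ∀ n, T.w n ≠ 0 → S.σ (T.σ n) = n ∧ S.w (T.σ n) = T.w n) :
    star S.op = T.op := by
  rw [ContinuousLinearMap.star_eq_adjoint]
  refine ((ContinuousLinearMap.eq_adjoint_iff _ _).2 fun f g => ?_).symm
  rw [lp.inner_eq_tsum, lp.inner_eq_tsum]
  refine tsum_eq_tsum_of_ne_zero_bij (fun n => S.σ n) ?_ ?_ ?_
  · rintro ⟨m, hm⟩ ⟨n, hn⟩ h
    have hm' : S.w m ≠ 0 := fun h0 => hm (by simp [h0])
    have hn' : S.w n ≠ 0 := fun h0 => hn (by simp [h0])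
    exact Subtype.ext (S.inj m n hm' hn' h)
  · intro n hn
    have hn' : T.w n ≠ 0 := fun h0 => hn (by simp [h0])
    refine ⟨⟨T.σ n, ?_⟩, (h₂ n hn').1⟩
    have h0 : ¬g n = 0 ∧ ¬T.w n = 0 ∧ ¬f (T.σ n) = 0 := by simpa using hn
    simpa [(h₂ n hn').1, (h₂ n hn').2] using ⟨⟨h0.2.1, h0.1⟩, h0.2.2⟩
  · rintro ⟨n, hn⟩
    have hn' : S.w n ≠ 0 := fun h0 => hn (by simp [h0])
    simp [h₁ n hn']
    ring

end Shift

section Ladder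

variable (q : Set.Ioo (0 : ℝ) 1) {k : ℕ} (j : Fin k)

theorem pow_le_one_aux (n : ℕ) : 0 ≤ 1 - (q : ℝ) ^ n :=
  sub_nonneg.2 (pow_le_one₀ q.2.1.le q.2.2.le)

theorem abs_sqrt_le_aux (n : ℕ) : |√(1 - (q : ℝ) ^ n)| ≤ 1 := by
  rw [abs_of_nonneg (Real.sqrt_nonneg _)]
  exact Real.sqrt_le_one.2 (by linarith [pow_pos q.2.1 n])

/-- Weights and shift of `|n⟩ ↦ q^{n_j} |n⟩`. -/
def diagData : ShiftData (Fin k → ℕ) where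
  w n := (q : ℝ) ^ n j
  σ := id
  abs_le n := by
    rw [abs_of_nonneg (pow_nonneg q.2.1.le _)]
    exact pow_le_one₀ q.2.1.le q.2.2.le
  inj _ _ _ _ h := h

/-- Weights and shift of `|n⟩ ↦ √(1 - q^{2n_j}) |n - e_j⟩`. In terms of coefficients, this is
`(a f)(n) = √(1 - q^{2(n_j+1)}) f(n + e_j)`. -/
def lowerData : ShiftData (Fin k → ℕ) where
  w n := √(1 - (q : ℝ) ^ (2 * (n j + 1)))
  σ n := Function.update n j (n j + 1)
  abs_le n := abs_sqrt_le_aux q _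
  inj m n _ _ h := by
    funext i
    have := congrFun h i
    by_cases hi : i = j
    · subst hi; simpa using this
    · simpa [hi] using this

/-- Weights and shift of `|n⟩ ↦ √(1 - q^{2(n_j+1)}) |n + e_j⟩`. -/
def raiseData : ShiftData (Fin k → ℕ) where
  w n := √(1 - (q : ℝ) ^ (2 * n j))
  σ n := Function.update n j (n j - 1)
  abs_le n := abs_sqrt_le_aux q _
  inj m n hm hn h := by
    funext i
    have h0 := congrFun h i
    by_cases hi : i = j
    · subst hi
      have hm' : m i ≠ 0 := fun h => hm (by simp [h])
      have hn' : n i ≠ 0 := fun h => hn (by simp [h])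
      simp at h0
      omega
    · simpa [hi] using h0

/-- The operator `a_j` on `ℓ²(ℕᵏ)`, `a_j |n⟩ = √(1 - q^{2n_j}) |n - e_j⟩`. -/
def lowerOp : Hil k →L[ℂ] Hil k := (lowerData q j).op

/-- The operator `c_j` on `ℓ²(ℕᵏ)`, `c_j |n⟩ = q^{n_j} |n⟩`. -/
def diagOp : Hil k →L[ℂ] Hil k := (diagData q j).op

theorem lowerOp_apply (f : Hil k) (n : Fin k → ℕ) : lowerOp q j f n
    = (√(1 - (q : ℝ) ^ (2 * (n j + 1))) : ℝ) * f (Function.update n j (n j + 1)) := rfl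

theorem diagOp_apply (f : Hil k) (n : Fin k → ℕ) :
    diagOp q j f n = ((q : ℝ) ^ n j : ℝ) * f n := rfl

theorem star_diagOp : star (diagOp q j) = diagOp q j :=
  ShiftData.star_op _ _ (fun _ _ => ⟨rfl, rfl⟩) (fun _ _ => ⟨rfl, rfl⟩)

theorem star_lowerOp : star (lowerOp q j) = (raiseData q j).op := by
  refine ShiftData.star_op _ _ (fun n _ => ?_) (fun n hn => ?_)
  · simp [lowerData, raiseData]
  · have hn' : n j ≠ 0 := fun h => hn (by simp [raiseData, h])
    have h1 : n j - 1 + 1 = n j := by omega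
    simp [lowerData, raiseData, h1]

theorem star_lowerOp_apply (f : Hil k) (n : Fin k → ℕ) : star (lowerOp q j) f n
    = (√(1 - (q : ℝ) ^ (2 * n j)) : ℝ) * f (Function.update n j (n j - 1)) := by
  rw [star_lowerOp]; rfl

theorem hil_ext {S T : Hil k →L[ℂ] Hil k} (h : ∀ f n, S f n = T f n) : S = T :=
  ContinuousLinearMap.ext fun f => lp.ext (funext (h f))

theorem ofReal_sqrt_mul_aux (n : ℕ) (z : ℂ) :
    ((√(1 - (q : ℝ) ^ n) : ℝ) : ℂ) * (((√(1 - (q : ℝ) ^ n) : ℝ) : ℂ) * z)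
      = (1 - (q : ℂ) ^ n) * z := by
  rw [← mul_assoc, ← Complex.ofReal_mul, Real.mul_self_sqrt (pow_le_one_aux q n)]
  push_cast; ring

theorem isSUqTwoPair_ops : IsSUqTwoPair (q : ℝ) (lowerOp q j) (diagOp q j) where
  star_c := star_diagOp q j
  mul_star := hil_ext fun f n => by
    change lowerOp q j (star (lowerOp q j) f) n
      + ((q : ℝ) : ℂ) ^ 2 * diagOp q j (diagOp q j f) n = f n
    rw [lowerOp_apply, star_lowerOp_apply, diagOp_apply, diagOp_apply]
    simp only [Function.update_self, Function.update_idem, add_tsub_cancel_right,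
      Function.update_eq_self, ofReal_sqrt_mul_aux]
    push_cast; ring
  star_mul := hil_ext fun f n => by
    change star (lowerOp q j) (lowerOp q j f) n + diagOp q j (diagOp q j f) n = f n
    rw [star_lowerOp_apply, lowerOp_apply, diagOp_apply, diagOp_apply]
    rcases Nat.eq_zero_or_pos (n j) with h | h
    · simp [h]
    · have h1 : n j - 1 + 1 = n j := by omega
      simp only [Function.update_self, Function.update_idem, h1,
        Function.update_eq_self, ofReal_sqrt_mul_aux]
      push_cast; ring
  comm := hil_ext fun f n => by
    change lowerOp q j (diagOp q j f) n = ((q : ℝ) : ℂ) * diagOp q j (lowerOp q j f) n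
    rw [lowerOp_apply, diagOp_apply, diagOp_apply, lowerOp_apply]
    simp only [Function.update_self]
    push_cast; ring

variable {j} in
theorem commute_ops {i : Fin k} (h : i ≠ j) :
    lowerOp q i * lowerOp q j = lowerOp q j * lowerOp q i ∧
    lowerOp q i * diagOp q j = diagOp q j * lowerOp q i ∧
    diagOp q i * diagOp q j = diagOp q j * diagOp q i ∧
    lowerOp q i * star (lowerOp q j) = star (lowerOp q j) * lowerOp q i := by
  have hu : ∀ (n : Fin k → ℕ) a b, Function.update (Function.update n i a) j b
      = Function.update (Function.update n j b) i a := fun n a b => Function.update_comm h _ _ _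
  refine ⟨hil_ext fun f n => ?_, hil_ext fun f n => ?_, hil_ext fun f n => ?_,
    hil_ext fun f n => ?_⟩ <;>
  simp only [mul_apply_eq_comp, lowerOp_apply, diagOp_apply, star_lowerOp_apply,
    Function.update_of_ne h, Function.update_of_ne h.symm, hu] <;> ring

theorem commute_diagOp_star {i j : Fin k} (h : i ≠ j) :
    diagOp q i * star (lowerOp q j) = star (lowerOp q j) * diagOp q i := by
  have := congrArg star (commute_ops q h.symm).2.1
  simpa only [StarMul.star_mul, star_diagOp] using this

/-- `V₁₂` in the tensor factor `j`. -/
def V₁₂ : Matrix (Fin 3) (Fin 3) (Hil k →L[ℂ] Hil k) := block₁₂ q (lowerOp q j) (diagOp q j)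

/-- `V₂₃` in the tensor factor `j`. -/
def V₂₃ : Matrix (Fin 3) (Fin 3) (Hil k →L[ℂ] Hil k) := block₂₃ q (lowerOp q j) (diagOp q j)

theorem isSUqThree_V₁₂ : IsSUqThree q (V₁₂ q j) := (isSUqTwoPair_ops q j).isSUqThree_block₁₂

theorem isSUqThree_V₂₃ : IsSUqThree q (V₂₃ q j) := (isSUqTwoPair_ops q j).isSUqThree_block₂₃

theorem commute_block {B : Type u} [Ring B] [StarRing B] [Algebra ℂ B] (r : ℝ) {a c x : B}
    (ha : Commute x a) (hs : Commute x (star a)) (hc : Commute x c) (l m : Fin 3) :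
    Commute x (block₁₂ r a c l m) ∧ Commute x (block₂₃ r a c l m) := by
  have hc' : Commute x (-((r : ℂ) • c)) := (hc.smul_right _).neg_right
  constructor <;> fin_cases l <;> fin_cases m <;> simp [block₁₂, block₂₃, -Complex.coe_smul] <;>
    first | assumption | exact hc.smul_right _

theorem commute_V {i j : Fin k} (h : i ≠ j) (l m r s : Fin 3) :
    (Commute (V₁₂ q i l m) (V₁₂ q j r s) ∧ Commute (V₁₂ q i l m) (V₂₃ q j r s)) ∧
    (Commute (V₂₃ q i l m) (V₁₂ q j r s) ∧ Commute (V₂₃ q i l m) (V₂₃ q j r s)) := by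
  obtain ⟨h1, h2, h3, h4⟩ := commute_ops q h
  obtain ⟨_, h2', _, h4'⟩ := commute_ops q h.symm
  have h5 := commute_diagOp_star q h
  have h6 : Commute (star (lowerOp q i)) (diagOp q j) := (commute_diagOp_star q h.symm).symm
  have h7 : Commute (star (lowerOp q i)) (star (lowerOp q j)) := Commute.star_star h1
  have ca := commute_block (x := lowerOp q i) q h1 h4 h2 r s
  have cs := commute_block (x := star (lowerOp q i)) q h4'.symm h7 h6 r s
  have cc := commute_block (x := diagOp q i) q h2'.symm h5 h3 r s
  have e1 := commute_block q ca.1.symm cs.1.symm cc.1.symm l m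
  have e2 := commute_block q ca.2.symm cs.2.symm cc.2.symm l m
  exact ⟨⟨e1.1.symm, e2.1.symm⟩, ⟨e1.2.symm, e2.2.symm⟩⟩

end Ladder

/-! ## The irreducible representations of `C(SU_q(3))`

They are the standard ones, written as products of the elementary matrices and normalised by
the following phases (`|·|` is the absolute value of an operator):
`π₃^{φ,ψ}`: `φ̄ u₃₁ ≥ 0` and `ψ̄ u₁₃ ≥ 0`;
`π₂₁^{φ,ψ}`: `u₃₁ = 0`, `φ̄ u₂₁ ≥ 0`, `ψ̄ u₁₃ ≥ 0`;
`π₂₂^{φ,ψ}`: `u₁₃ = 0`, `φ̄ u₃₁ ≥ 0`, `ψ̄ u₁₂ ≥ 0`;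
`π₁₁^{φ,ψ}`: `u₁₃ = u₃₁ = u₂₃ = 0`, `φ̄ u₁₂ ≥ 0`, `ψ̄ u₂₁ ≥ 0`;
`π₁₂^{φ,ψ}`: `u₁₃ = u₃₁ = u₁₂ = 0`, `φψ u₃₂ ≥ 0`, `ψ̄ u₂₃ ≥ 0`;
`π₀^{φ,ψ}`: `u₁₃ = u₃₁ = u₁₂ = u₂₃ = 0`, `u₁₁ = φ`, `u₂₂ = ψ`. -/

section Representations

variable (q : Set.Ioo (0 : ℝ) 1) (φ ψ : Circle)

/-- The matrix `(π₃^{φ,ψ}(u_{ij}))`; the tensor factors of `|N, M, L⟩` are `0, 1, 2`. -/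
def mat₃ : Matrix (Fin 3) (Fin 3) (Hil 3 →L[ℂ] Hil 3) :=
  V₂₃ q 2 * V₁₂ q 0 * V₂₃ q 1 * torusMatrix _ φ ((φ * ψ)⁻¹ : Circle) ψ

/-- The matrix `(π₂₁^{φ,ψ}(u_{ij}))`; the tensor factors of `|N, M⟩` are `0, 1`. -/
def mat₂₁ : Matrix (Fin 3) (Fin 3) (Hil 2 →L[ℂ] Hil 2) :=
  V₁₂ q 0 * V₂₃ q 1 * torusMatrix _ φ ((φ * ψ)⁻¹ : Circle) ψ

/-- The matrix `(π₂₂^{φ,ψ}(u_{ij}))`; the tensor factors of `|N, M⟩` are `0, 1`. -/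
def mat₂₂ : Matrix (Fin 3) (Fin 3) (Hil 2 →L[ℂ] Hil 2) :=
  V₂₃ q 1 * V₁₂ q 0 * torusMatrix _ φ (-ψ) (-((φ * ψ)⁻¹ : Circle))

/-- The matrix `(π₁₁^{φ,ψ}(u_{ij}))`. -/
def mat₁₁ : Matrix (Fin 3) (Fin 3) (Hil 1 →L[ℂ] Hil 1) :=
  V₁₂ q 0 * torusMatrix _ ψ (-φ) (-((φ * ψ)⁻¹ : Circle))

/-- The matrix `(π₁₂^{φ,ψ}(u_{ij}))`. -/
def mat₁₂ : Matrix (Fin 3) (Fin 3) (Hil 1 →L[ℂ] Hil 1) :=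
  V₂₃ q 0 * torusMatrix _ (-φ) ((φ * ψ)⁻¹ : Circle) (-ψ)

/-- The matrix `(π₀^{φ,ψ}(u_{ij}))`. -/
def mat₀ : Matrix (Fin 3) (Fin 3) (ℂ →L[ℂ] ℂ) :=
  torusMatrix _ φ ψ ((φ * ψ)⁻¹ : Circle)

theorem phase_aux : (φ : ℂ) * ((φ * ψ)⁻¹ : Circle) * ψ = 1 := by
  rw [mul_right_comm]; exact torus_inv_mul φ ψ

theorem norm_neg_coe : ‖-(φ : ℂ)‖ = 1 := by
  rw [norm_neg]; exact Circle.norm_coe φ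

theorem isSUqThree_mat₃ : IsSUqThree q (mat₃ q φ ψ) := by
  refine IsSUqThree.mul_torus ?_ (Circle.norm_coe _) (Circle.norm_coe _) (Circle.norm_coe _) (phase_aux φ ψ)
  refine IsSUqThree.mul (((isSUqThree_V₂₃ q 2).mul (isSUqThree_V₁₂ q 0) fun i j k l =>
    (commute_V q (by decide) i j k l).2.1)) (isSUqThree_V₂₃ q 1) fun i j k l => ?_
  rw [Matrix.mul_apply]
  exact Commute.sum_left _ _ _ fun m _ =>
    (commute_V q (by decide) i m k l).2.2.mul_left (commute_V q (by decide) m j k l).1.2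

theorem isSUqThree_mat₂₁ : IsSUqThree q (mat₂₁ q φ ψ) :=
  ((isSUqThree_V₁₂ q 0).mul (isSUqThree_V₂₃ q 1) fun i j k l =>
    (commute_V q (by decide) i j k l).1.2).mul_torus (Circle.norm_coe _) (Circle.norm_coe _)
    (Circle.norm_coe _) (phase_aux φ ψ)

theorem isSUqThree_mat₂₂ : IsSUqThree q (mat₂₂ q φ ψ) :=
  ((isSUqThree_V₂₃ q 1).mul (isSUqThree_V₁₂ q 0) fun i j k l =>
    (commute_V q (by decide) i j k l).2.1).mul_torus (Circle.norm_coe _) (norm_neg_coe _) (norm_neg_coe _)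
    (by have := torus_inv_mul φ ψ; linear_combination this)

theorem isSUqThree_mat₁₁ : IsSUqThree q (mat₁₁ q φ ψ) :=
  (isSUqThree_V₁₂ q 0).mul_torus (Circle.norm_coe _) (norm_neg_coe _) (norm_neg_coe _)
    (by have := torus_inv_mul φ ψ; linear_combination this)

theorem isSUqThree_mat₁₂ : IsSUqThree q (mat₁₂ q φ ψ) :=
  (isSUqThree_V₂₃ q 0).mul_torus (norm_neg_coe _) (Circle.norm_coe _) (norm_neg_coe _)
    (by have := torus_inv_mul φ ψ; linear_combination this)

theorem isSUqThree_mat₀ : IsSUqThree q (mat₀ φ ψ) :=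
  isSUqThree_torusMatrix _ _ (Circle.norm_coe _) (Circle.norm_coe _) (Circle.norm_coe _) (torus_inv_mul φ ψ)

/-- The representation `π₃^{φ,ψ}` on `ℓ²(ℕ³)`. -/
def π₃ : CSUqThree q →⋆ₐ[ℂ] (Hil 3 →L[ℂ] Hil 3) := lift _ (isSUqThree_mat₃ q φ ψ)

/-- The representation `π₂₁^{φ,ψ}` on `ℓ²(ℕ²)`. -/
def π₂₁ : CSUqThree q →⋆ₐ[ℂ] (Hil 2 →L[ℂ] Hil 2) := lift _ (isSUqThree_mat₂₁ q φ ψ)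

/-- The representation `π₂₂^{φ,ψ}` on `ℓ²(ℕ²)`. -/
def π₂₂ : CSUqThree q →⋆ₐ[ℂ] (Hil 2 →L[ℂ] Hil 2) := lift _ (isSUqThree_mat₂₂ q φ ψ)

/-- The representation `π₁₁^{φ,ψ}` on `ℓ²(ℕ)`. -/
def π₁₁ : CSUqThree q →⋆ₐ[ℂ] (Hil 1 →L[ℂ] Hil 1) := lift _ (isSUqThree_mat₁₁ q φ ψ)

/-- The representation `π₁₂^{φ,ψ}` on `ℓ²(ℕ)`. -/
def π₁₂ : CSUqThree q →⋆ₐ[ℂ] (Hil 1 →L[ℂ] Hil 1) := lift _ (isSUqThree_mat₁₂ q φ ψ)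

/-- The representation `π₀^{φ,ψ}` on `ℂ`. -/
def π₀ : CSUqThree q →⋆ₐ[ℂ] (ℂ →L[ℂ] ℂ) := lift _ (isSUqThree_mat₀ q φ ψ)

/-! The representations `ρ_* = ρ_*^{1,1}`: the restrictions of `π_*^{1,1}` to
`C(SU_q(3)/𝕋²)`. -/

def ρ₃ : flagAlgebra q →⋆ₐ[ℂ] (Hil 3 →L[ℂ] Hil 3) := (π₃ q 1 1).comp (flagAlgebra q).subtype

def ρ₂₁ : flagAlgebra q →⋆ₐ[ℂ] (Hil 2 →L[ℂ] Hil 2) := (π₂₁ q 1 1).comp (flagAlgebra q).subtype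

def ρ₂₂ : flagAlgebra q →⋆ₐ[ℂ] (Hil 2 →L[ℂ] Hil 2) := (π₂₂ q 1 1).comp (flagAlgebra q).subtype

def ρ₁₁ : flagAlgebra q →⋆ₐ[ℂ] (Hil 1 →L[ℂ] Hil 1) := (π₁₁ q 1 1).comp (flagAlgebra q).subtype

def ρ₁₂ : flagAlgebra q →⋆ₐ[ℂ] (Hil 1 →L[ℂ] Hil 1) := (π₁₂ q 1 1).comp (flagAlgebra q).subtype

def ρ₀ : flagAlgebra q →⋆ₐ[ℂ] (ℂ →L[ℂ] ℂ) := (π₀ q 1 1).comp (flagAlgebra q).subtype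

end Representations

/-- The ideal `ρ⁻¹(𝒦(H))` of elements which `ρ` maps to compact operators. -/
def compactIdeal {A : Type u} [Ring A] [StarRing A] [Algebra ℂ A] {H : Type}
    [NormedAddCommGroup H] [InnerProductSpace ℂ H] [CompleteSpace H]
    (ρ : A →⋆ₐ[ℂ] (H →L[ℂ] H)) : Ideal A where
  carrier := {x | IsCompactOperator (ρ x)}
  add_mem' {x y} hx hy := by
    change IsCompactOperator (ρ (x + y))
    rw [map_add]; exact IsCompactOperator.add hx hy
  zero_mem' := by
    change IsCompactOperator (ρ 0)
    rw [map_zero]; exact isCompactOperator_zero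
  smul_mem' c {x} hx := by
    change IsCompactOperator (ρ (c * x))
    rw [map_mul]; exact IsCompactOperator.clm_comp hx (ρ c)

instance {A : Type u} [Ring A] [StarRing A] [Algebra ℂ A] {H : Type}
    [NormedAddCommGroup H] [InnerProductSpace ℂ H] [CompleteSpace H]
    (ρ : A →⋆ₐ[ℂ] (H →L[ℂ] H)) : (compactIdeal ρ).IsTwoSided where
  mul_mem_of_left {x} y hx := by
    change IsCompactOperator (ρ (x * y))
    rw [map_mul]; exact IsCompactOperator.comp_clm hx (ρ y)

end QuantumFlag

end

/-! Entries are indexed from 0 below: `u₀₂` is the upper right corner of the matrix of generators. A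
torus factor on the right of a representation matrix amounts to precomposition with a gauge
automorphism (`lift_mul_torus`), so on the fixed point algebra each `ρ` agrees with a model given by
a bare product of matrices `V₁₂`, `V₂₃`.

Compact above implies zero below. When the occupation number of one tensor factor tends to infinity,
`a` tends to 1 and `c` to 0 on suitably averaged vectors. The matrix in that factor becomes 1, and
the model degenerates to the one with this factor deleted. The averaged vectors tend weakly to zero,
so an element acting compactly in the larger model acts by zero in the smaller one
(`eq_zero_of_isCompactOperator`).

Zero below implies compact above, and faithfulness. Both follow from statements of one type
(`mem_of_model₂₁`, `mem_of_model₂₂` and their analogues): if a closed two-sided ideal `I` of the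
whole algebra contains certain entries, then every fixed point element `x` killed by the
corresponding model lies in `I`. Faithfulness is the case of the zero ideal, with no condition on
entries. For compactness, `I` is the ideal of elements vanishing asymptotically in one tensor
factor; an operator that vanishes asymptotically in every factor is compact.

These statements are proved by constructing a vacuum projection abstractly. Modulo the entries in
`I`, some entry `n` (the product of both corners in the top case) commutes with all entries up to
scalars. The powers of the contraction `G = ρ⁻² n* n` converge to a projection `e`. Every entry is
annihilated by `e` on one side, or commutes with `e` and sits on the graph of a fixed permutation.
The exchange relations then reduce each column-balanced word, compressed by `e`, to a multiple of
`e` (`exists_compress_eq`), so `e z e` is a multiple of `e` for all fixed points `z`. Doing this in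
the product of the quotient by `I` with the model, where the vacuum is nonzero, shows that `e z e =
0` as soon as the model kills `z`. Applied to `(x w)* (x w)` for words `w`, this gives `x A e = 0`
modulo `I`, and a gap argument upgrades `e` to `G` and hence to `n` (`mul_mul_mem_of_isVacuum`).
Modulo the ideal of all `y` with `x A y ⊆ I`, one more entry vanishes, while the smaller models
still kill `x`; induction yields `x A x ⊆ I`, and closed ideals are semiprime.

For the sums of kernels, `u₀₂ u₀₂*` (respectively `u₀₁ u₀₁*`) lies in one kernel and acts in the
other representation by a strictly positive diagonal operator. It therefore provides an approximate
unit for the compact operators, and the closed range of the direct sum of the two representations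
gives the decomposition (`mem_ker_sup_ker`). -/

noncomputable section

namespace QuantumFlag

universe u

/-! ### Closed ideals, quotients and ranges of *-homomorphisms of C*-algebras -/

section Quotient

open Filter Topology

variable {A : Type u} [CStarAlgebra A]

/-- Approximate units of a closed two-sided ideal, relative to a single element. -/
theorem exists_approx_unit (I : Ideal A) [I.IsTwoSided] {i : A} (hi : i ∈ I) {ε : ℝ} (hε : 0 < ε) :
    ∃ u ∈ I, star u = u ∧ ‖1 - u‖ ≤ 1 ∧ ‖i * (1 - u)‖ ≤ ε := by
  set a : A := star i * i with ha
  have hsa : IsSelfAdjoint a := IsSelfAdjoint.star_mul_self i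
  have hsp : ∀ x ∈ spectrum ℝ a, 0 ≤ x := spectrum_star_mul_self_nonneg
  -- With `u = a (a + δ)⁻¹`, the square of `‖i (1 - u)‖` is the supremum of `δ · δ t / (t + δ)²`
  -- over the spectrum. This is at most `δ`, whence the choice `δ = ε²`.
  set δ : ℝ := ε ^ 2 with hδ
  have hδ0 : 0 < δ := by positivity
  have hne : ∀ x ∈ spectrum ℝ a, x + δ ≠ 0 := fun x hx => by
    have := hsp x hx; positivity
  have hcont : ContinuousOn (fun t : ℝ => (t + δ)⁻¹) (spectrum ℝ a) :=
    ContinuousOn.inv₀ (by fun_prop) hne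
  have hcont1 : ContinuousOn (fun t : ℝ => t * (t + δ)⁻¹) (spectrum ℝ a) :=
    continuousOn_id.mul hcont
  have hcont2 : ContinuousOn (fun t : ℝ => δ * (t + δ)⁻¹) (spectrum ℝ a) :=
    continuousOn_const.mul hcont
  set u : A := cfc (fun t : ℝ => t * (t + δ)⁻¹) a with hu
  have hu1 : 1 - u = cfc (fun t : ℝ => δ * (t + δ)⁻¹) a := by
    rw [hu, ← cfc_const_one ℝ a, ← cfc_sub (fun _ => 1) _ a (by fun_prop) hcont1]
    refine cfc_congr fun t ht => ?_
    have := hne t ht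
    field_simp
    ring
  have husa : star u = u := (cfc_predicate _ a : IsSelfAdjoint u)
  refine ⟨u, ?_, husa, ?_, ?_⟩
  · have : u = a * cfc (fun t : ℝ => (t + δ)⁻¹) a := by
      rw [hu, cfc_mul (fun t => t) _ a (by fun_prop) hcont, cfc_id' ℝ a]
    rw [this]
    exact I.mul_mem_right _ (I.mul_mem_left _ hi)
  · rw [hu1]
    refine norm_cfc_le zero_le_one fun t ht => ?_
    have h0 := hsp t ht
    rw [Real.norm_of_nonneg (by positivity), ← div_eq_mul_inv, div_le_one (by positivity)]
    linarith
  · have h1 : star (i * (1 - u)) * (i * (1 - u)) =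
        cfc (fun t : ℝ => δ * (t + δ)⁻¹ * (t * (δ * (t + δ)⁻¹))) a := by
      have hcont3 : ContinuousOn (fun t : ℝ => t * (δ * (t + δ)⁻¹)) (spectrum ℝ a) :=
        continuousOn_id.mul hcont2
      rw [cfc_mul _ _ a hcont2 hcont3,
        cfc_mul (fun t => t) _ a (by fun_prop) hcont2, cfc_id' ℝ a, ← hu1, star_mul, star_sub,
        star_one, husa, ha]
      noncomm_ring
    have h2 : ‖i * (1 - u)‖ * ‖i * (1 - u)‖ ≤ ε * ε := by
      rw [← CStarRing.norm_star_mul_self, h1]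
      refine norm_cfc_le (by positivity) fun t ht => ?_
      have h0 := hsp t ht
      rw [Real.norm_of_nonneg (by positivity)]
      have : δ * (t + δ)⁻¹ * (t * (δ * (t + δ)⁻¹)) = δ * (δ * t / (t + δ) ^ 2) := by
        field_simp
      rw [this, show ε * ε = δ * 1 by rw [hδ]; ring]
      gcongr
      rw [div_le_one (by positivity)]
      nlinarith
    nlinarith [norm_nonneg (i * (1 - u))]

/-- An approximate unit `u` for `x` gives elements `u * star x` of the ideal that approximate `star
x`, because `star x - u * star x` is the adjoint of `x * (1 - u)`. -/
theorem star_mem_of_isClosed (I : Ideal A) [I.IsTwoSided] (hI : IsClosed (I : Set A)) {x : A}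
    (hx : x ∈ I) : star x ∈ I := by
  rw [← SetLike.mem_coe, ← hI.closure_eq, Metric.mem_closure_iff]
  intro ε hε
  obtain ⟨u, hu, hsu, -, h⟩ := exists_approx_unit I hx (half_pos hε)
  refine ⟨u * star x, I.mul_mem_right _ hu, ?_⟩
  have : star x - u * star x = star (x * (1 - u)) := by
    rw [star_mul, star_sub, star_one, hsu]; noncomm_ring
  rw [dist_eq_norm, this, norm_star]
  linarith

/-- The quotient of a C*-algebra by a closed two-sided ideal is a C*-algebra. -/
theorem exists_quotient (I : Ideal A) [I.IsTwoSided] (hI : IsClosed (I : Set A)) :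
    ∃ (B : Type u) (_ : CStarAlgebra B) (f : A →⋆ₐ[ℂ] B), Function.Surjective f ∧
      ∀ x, f x = 0 ↔ x ∈ I := by
  have _ : IsClosed (I : Set A) := hI
  let π : A →+* A ⧸ I := Ideal.Quotient.mk I
  have hπ : Function.Surjective π := Ideal.Quotient.mk_surjective
  have hlt : ∀ (x : A ⧸ I) (r : ℝ), ‖x‖ < r → ∃ m, π m = x ∧ ‖m‖ < r :=
    fun x r h => QuotientAddGroup.norm_lt_iff.1 h
  have hle : ∀ m, ‖π m‖ ≤ ‖m‖ := fun m => Submodule.Quotient.norm_mk_le I m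
  let i1 : NormedRing (A ⧸ I) :=
    { (inferInstance : Ring (A ⧸ I)), (inferInstance : NormedAddCommGroup (A ⧸ I)) with
      norm_mul_le := fun x y => by
        refine le_of_forall_pos_le_add fun ε hε => ?_
        have : Tendsto (fun t : ℝ => (‖x‖ + t) * (‖y‖ + t)) (𝓝[>] 0) (𝓝 ((‖x‖ + 0) * (‖y‖ + 0))) :=
          (Continuous.tendsto (by fun_prop) 0).mono_left nhdsWithin_le_nhds
        simp only [add_zero] at this
        obtain ⟨t, ht, ht0⟩ := ((this.eventually (gt_mem_nhds (lt_add_of_pos_right _ hε))).and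
          self_mem_nhdsWithin).exists
        obtain ⟨a, rfl, ha⟩ := hlt x (‖x‖ + t) (by simpa using ht0)
        obtain ⟨b, rfl, hb⟩ := hlt y (‖y‖ + t) (by simpa using ht0)
        rw [← map_mul]
        refine (hle _).trans ((norm_mul_le a b).trans (le_trans ?_ ht.le))
        gcongr }
  let i2 : NormedAlgebra ℂ (A ⧸ I) :=
    { (inferInstance : Algebra ℂ (A ⧸ I)) with
      norm_smul_le := fun c x => norm_smul_le c x }
  let st : A ⧸ I → A ⧸ I := Quotient.lift (fun x => π (star x)) fun x y h => by
    have h' : x - y ∈ I := (Submodule.quotientRel_def I).1 h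
    change π (star x) = π (star y)
    rw [← sub_eq_zero, ← map_sub, ← star_sub]
    exact Ideal.Quotient.eq_zero_iff_mem.2 (star_mem_of_isClosed I hI h')
  have hst : ∀ x, st (π x) = π (star x) := fun _ => rfl
  let i3 : StarRing (A ⧸ I) :=
    { star := st
      star_involutive := fun x => by
        obtain ⟨x, rfl⟩ := hπ x; rw [hst, hst, star_star]
      star_mul := fun x y => by
        obtain ⟨x, rfl⟩ := hπ x; obtain ⟨y, rfl⟩ := hπ y
        change st (π x * π y) = st (π y) * st (π x)
        rw [← map_mul, hst, hst, hst, ← map_mul, star_mul]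
      star_add := fun x y => by
        obtain ⟨x, rfl⟩ := hπ x; obtain ⟨y, rfl⟩ := hπ y
        change st (π x + π y) = st (π x) + st (π y)
        rw [← map_add, hst, hst, hst, ← map_add, star_add] }
  have hstar : ∀ x, star (π x) = π (star x) := fun _ => rfl
  let i4 : CStarRing (A ⧸ I) := ⟨fun x => by
    obtain ⟨x, rfl⟩ := hπ x
    rw [hstar, ← map_mul]
    refine le_of_forall_pos_le_add fun ε hε => ?_
    -- Take a representative `m` of the class of `star x * x` with almost minimal norm, and replace
    -- `x` by `x * (1 - u)` in the same class, where `u` almost absorbs the difference `m - star x *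
    -- x`. Then `‖x (1 - u)‖²` is at most `‖m‖` up to a small error.
    obtain ⟨m, hm, hmlt⟩ := hlt (π (star x * x)) _ (lt_add_of_pos_right _ (half_pos hε))
    have hi : m - star x * x ∈ I := by
      rw [← Ideal.Quotient.eq_zero_iff_mem, map_sub, sub_eq_zero]; exact hm
    obtain ⟨u, hu, hsu, hu1, h⟩ := exists_approx_unit I hi (half_pos hε)
    have hx : π x = π (x * (1 - u)) := by
      rw [mul_sub, mul_one, map_sub, Ideal.Quotient.eq_zero_iff_mem.2 (I.mul_mem_left x hu),
        sub_zero]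
    have hp : ‖π x‖ * ‖π x‖ ≤ ‖x * (1 - u)‖ * ‖x * (1 - u)‖ := by
      rw [hx]; exact mul_self_le_mul_self (norm_nonneg _) (hle _)
    refine hp.trans ?_
    rw [← CStarRing.norm_star_mul_self]
    have e : star (x * (1 - u)) * (x * (1 - u))
        = (1 - u) * (m * (1 - u)) - (1 - u) * ((m - star x * x) * (1 - u)) := by
      rw [star_mul, star_sub, star_one, hsu]; noncomm_ring
    rw [e]
    have e1 : ‖(1 - u) * (m * (1 - u))‖ ≤ 1 * (‖m‖ * 1) :=
      (norm_mul_le _ _).trans (mul_le_mul hu1 ((norm_mul_le _ _).trans (by gcongr))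
        (norm_nonneg _) zero_le_one)
    have e2 : ‖(1 - u) * ((m - star x * x) * (1 - u))‖ ≤ 1 * (ε / 2) :=
      (norm_mul_le _ _).trans (mul_le_mul hu1 h (norm_nonneg _) zero_le_one)
    have := norm_sub_le ((1 - u) * (m * (1 - u))) ((1 - u) * ((m - star x * x) * (1 - u)))
    linarith⟩
  have i5 : StarModule ℂ (A ⧸ I) := ⟨fun c x => by
    obtain ⟨x, rfl⟩ := hπ x
    change star (π (c • x)) = star c • π (star x)
    rw [hstar, star_smul]; rfl⟩
  have i6 : CompleteSpace (A ⧸ I) := inferInstanceAs (CompleteSpace (A ⧸ I))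
  let f : A →⋆ₐ[ℂ] A ⧸ I := { Ideal.Quotient.mkₐ ℂ I with map_star' := fun x => (hstar x).symm }
  exact ⟨A ⧸ I, { i1, i2, i3, i4, i5, i6 with }, f, hπ, fun x => Ideal.Quotient.eq_zero_iff_mem⟩

theorem mem_of_star_mul_self_mem (I : Ideal A) [I.IsTwoSided] (hI : IsClosed (I : Set A)) {x : A}
    (hx : star x * x ∈ I) : x ∈ I := by
  obtain ⟨B, _, f, -, hf⟩ := exists_quotient I hI
  rw [← hf] at hx ⊢
  rwa [map_mul, map_star, CStarRing.star_mul_self_eq_zero_iff] at hx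

theorem continuous_starAlgHom {B : Type*} [CStarAlgebra B] (f : A →⋆ₐ[ℂ] B) : Continuous f :=
  AddMonoidHomClass.continuous_of_bound f 1 fun x => by
    simpa using NonUnitalStarAlgHom.norm_apply_le f x

/-- A *-homomorphism which vanishes on the kernel of a surjection factors through it. -/
theorem exists_factor {B C : Type*} [CStarAlgebra B] [CStarAlgebra C] (p : A →⋆ₐ[ℂ] C)
    (hp : Function.Surjective p) (f : A →⋆ₐ[ℂ] B) (h : ∀ x, p x = 0 → f x = 0) :
    ∃ g : C →⋆ₐ[ℂ] B, ∀ x, g (p x) = f x := by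
  have hk : ∀ {x y}, p x = p y → f x = f y := fun {x y} hxy => by
    rw [← sub_eq_zero, ← map_sub] at hxy ⊢
    exact h _ hxy
  have hs : ∀ c, p (Function.surjInv hp c) = c := Function.surjInv_eq hp
  let s : C → A := Function.surjInv hp
  refine ⟨{ toFun := fun c => f (s c)
            map_one' := by rw [← map_one f]; exact hk (by rw [hs, map_one])
            map_mul' := fun x y => by rw [← map_mul]; exact hk (by rw [hs, map_mul, hs, hs])
            map_zero' := by rw [← map_zero f]; exact hk (by rw [hs, map_zero])
            map_add' := fun x y => by rw [← map_add]; exact hk (by rw [hs, map_add, hs, hs])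
            commutes' := fun r => by
              rw [← AlgHomClass.commutes f]; exact hk (by rw [hs, AlgHomClass.commutes])
            map_star' := fun x => by rw [← map_star]; exact hk (by rw [hs, map_star, hs]) },
    fun x => hk (hs _)⟩

/-- The range of a *-homomorphism between C*-algebras is closed. -/
theorem isClosed_range_starAlgHom {B : Type*} [CStarAlgebra B] (f : A →⋆ₐ[ℂ] B) :
    IsClosed (Set.range f) := by
  have hcl : IsClosed ((RingHom.ker f : Ideal A) : Set A) :=
    isClosed_singleton.preimage (continuous_starAlgHom f)
  obtain ⟨C, _, p, hp, hker⟩ := exists_quotient (RingHom.ker f) hcl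
  obtain ⟨g, hg⟩ := exists_factor p hp f fun x hx => (hker x).1 hx
  have hinj : Function.Injective g := (injective_iff_map_eq_zero g).2 fun c hc => by
    obtain ⟨x, rfl⟩ := hp c
    rw [hg] at hc
    exact (hker x).2 hc
  have hr : Set.range f = Set.range g := by
    rw [← hp.range_comp g]
    exact congrArg Set.range (funext fun x => (hg x).symm)
  rw [hr]
  exact (NonUnitalStarAlgHom.isometry g hinj).isClosedEmbedding.isClosed_range

end Quotient

/-! ### Algebraic consequences of the defining relations: cofactors and commutation rules -/

section Consequences

set_option linter.unusedSectionVars false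

variable {q : ℝ} {B : Type*} [Ring B] [StarRing B] [Algebra ℂ B] [StarModule ℂ B]
  {v : Matrix (Fin 3) (Fin 3) B}

theorem star_twistedE (i j k : Fin 3) : star (twistedE q i j k) = twistedE q i j k := by
  unfold twistedE
  split_ifs <;> simp

theorem IsSUqThree.sum_star_mul (hv : IsSUqThree q v) (i j : Fin 3) :
    ∑ k, star (v k i) * v k j = if i = j then 1 else 0 := by
  have := congrFun (congrFun (Unitary.mem_iff.1 hv.unitary).1 i) j
  simpa [Matrix.mul_apply, Matrix.star_apply, Matrix.one_apply] using this

theorem IsSUqThree.sum_mul_star (hv : IsSUqThree q v) (i j : Fin 3) :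
    ∑ k, v i k * star (v j k) = if i = j then 1 else 0 := by
  have := congrFun (congrFun (Unitary.mem_iff.1 hv.unitary).2 i) j
  simpa [Matrix.mul_apply, Matrix.star_apply, Matrix.one_apply] using this

/-- The row version of the cofactor formula. -/
theorem IsSUqThree.sum_star_row (hv : IsSUqThree q v) (j₂ j₃ k : Fin 3) :
    ∑ j, twistedE q j j₂ j₃ • star (v j k)
      = ∑ a, ∑ b, twistedE q k a b • (v j₂ a * v j₃ b) := by
  -- The determinant relation is contracted on the left with the adjoint matrix; unitarity removes
  -- the first of the three factors.
  calc ∑ j, twistedE q j j₂ j₃ • star (v j k)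
      = ∑ j, star (v j k) * (twistedE q j j₂ j₃ • (1 : B)) := by simp
    _ = ∑ j, ∑ i, ∑ a, ∑ b, twistedE q i a b • (star (v j k) * v j i * (v j₂ a * v j₃ b)) := by
        simp only [← hv.det, Finset.mul_sum, mul_smul_comm, mul_assoc]
    _ = ∑ i, ∑ a, ∑ b, twistedE q i a b • ((∑ j, star (v j k) * v j i) * (v j₂ a * v j₃ b)) := by
        rw [Finset.sum_comm]
        refine Finset.sum_congr rfl fun i _ => ?_
        rw [Finset.sum_comm]
        refine Finset.sum_congr rfl fun a _ => ?_
        rw [Finset.sum_comm]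
        refine Finset.sum_congr rfl fun b _ => ?_
        rw [Finset.sum_mul, Finset.smul_sum]
    _ = _ := by
        simp only [hv.sum_star_mul, ite_mul, one_mul, zero_mul, smul_ite, smul_zero]
        rw [Finset.sum_eq_single k]
        · simp
        · intro b _ hb; simp [hb.symm]
        · simp

/-- The determinant relation is imposed on rows only; its transpose is a consequence. The adjoint of
the row cofactor formula turns the contracted first factor into products of two adjoints, which
unitarity then contracts with the two remaining factors. -/
theorem IsSUqThree.col_det (hv : IsSUqThree q v) (i₁ i₂ i₃ : Fin 3) :
    ∑ j₁, ∑ j₂, ∑ j₃, twistedE q j₁ j₂ j₃ • (v j₁ i₁ * v j₂ i₂ * v j₃ i₃)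
      = twistedE q i₁ i₂ i₃ • (1 : B) := by
  have h1 : ∀ j₂ j₃, ∑ j, twistedE q j j₂ j₃ • v j i₁
      = ∑ a, ∑ b, twistedE q i₁ a b • (star (v j₃ b) * star (v j₂ a)) := fun j₂ j₃ => by
    have := congrArg star (hv.sum_star_row j₂ j₃ i₁)
    simpa only [star_sum, star_smul, star_twistedE, star_star, star_mul] using this
  have h2 : ∑ j₁, ∑ j₂, ∑ j₃, twistedE q j₁ j₂ j₃ • (v j₁ i₁ * v j₂ i₂ * v j₃ i₃)
      = ∑ j₃, ∑ j₂, (∑ j₁, twistedE q j₁ j₂ j₃ • v j₁ i₁) * (v j₂ i₂ * v j₃ i₃) := by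
    simp only [Finset.sum_mul, smul_mul_assoc, mul_assoc]
    rw [Finset.sum_comm]
    rw [Finset.sum_congr rfl fun y _ => Finset.sum_comm, Finset.sum_comm]
  rw [h2]
  simp only [h1, Finset.sum_mul]
  have h3 : ∀ j₃, ∑ j₂, ∑ a, ∑ b, twistedE q i₁ a b • (star (v j₃ b) * star (v j₂ a))
        * (v j₂ i₂ * v j₃ i₃) = ∑ b, twistedE q i₁ i₂ b • (star (v j₃ b) * v j₃ i₃) := fun j₃ => by
    rw [Finset.sum_comm]
    have : ∀ a, ∑ j₂, ∑ b, twistedE q i₁ a b • (star (v j₃ b) * star (v j₂ a))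
        * (v j₂ i₂ * v j₃ i₃) = ∑ b, twistedE q i₁ a b • (star (v j₃ b) *
          (∑ j₂, star (v j₂ a) * v j₂ i₂) * v j₃ i₃) := fun a => by
      rw [Finset.sum_comm]
      simp only [Finset.mul_sum, Finset.sum_mul, Finset.smul_sum, smul_mul_assoc, mul_assoc]
    simp only [this, hv.sum_star_mul]
    rw [Finset.sum_eq_single i₂]
    · simp
    · intro b _ hb; simp [hb]
    · simp
  simp only [h3]
  rw [Finset.sum_comm]
  simp only [← Finset.smul_sum, hv.sum_star_mul]
  simp

/-- The column version of the cofactor formula. -/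
theorem IsSUqThree.sum_star_col (hv : IsSUqThree q v) (a b k : Fin 3) :
    ∑ i, twistedE q a b i • star (v k i)
      = ∑ j₁, ∑ j₂, twistedE q j₁ j₂ k • (v j₁ a * v j₂ b) := by
  calc ∑ i, twistedE q a b i • star (v k i)
      = ∑ i, (twistedE q a b i • (1 : B)) * star (v k i) := by simp
    _ = ∑ i, ∑ j₁, ∑ j₂, ∑ j, twistedE q j₁ j₂ j • (v j₁ a * v j₂ b * (v j i * star (v k i))) := by
        simp only [← hv.col_det, Finset.sum_mul, smul_mul_assoc, mul_assoc]
    _ = ∑ j₁, ∑ j₂, ∑ j, twistedE q j₁ j₂ j • (v j₁ a * v j₂ b * ∑ i, (v j i * star (v k i))) := by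
        rw [Finset.sum_comm]
        refine Finset.sum_congr rfl fun i _ => ?_
        rw [Finset.sum_comm]
        refine Finset.sum_congr rfl fun a _ => ?_
        rw [Finset.sum_comm]
        refine Finset.sum_congr rfl fun b _ => ?_
        rw [Finset.mul_sum, Finset.smul_sum]
    _ = _ := by
        simp only [hv.sum_mul_star]
        simp

/-- The smaller of the two indices other than `i`. -/
def fstOther (i : Fin 3) : Fin 3 := ![1, 0, 0] i

/-- The larger of the two indices other than `i`. -/
def sndOther (i : Fin 3) : Fin 3 := ![2, 2, 1] i

theorem exists_fstOther {a b : Fin 3} (h : a < b) : ∃ k, a = fstOther k ∧ b = sndOther k := by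
  fin_cases a <;> fin_cases b <;> simp at h
  exacts [⟨2, rfl, rfl⟩, ⟨1, rfl, rfl⟩, ⟨0, rfl, rfl⟩]

/-- Only the two orderings of the complementary pair survive. An index `k` in first place causes `k`
inversions and in last place `2 - k`, which gives the powers of `-q` here and in the next three
lemmas. -/
theorem sum_twistedE_left (k : Fin 3) (f : Fin 3 → Fin 3 → B) :
    ∑ a, ∑ b, twistedE q k a b • f a b = (-(q : ℂ)) ^ (k : ℕ) •
      (f (fstOther k) (sndOther k) - (q : ℂ) • f (sndOther k) (fstOther k)) := by
  unfold twistedE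
  generalize (q : ℂ) = t
  fin_cases k <;> simp [inversions, Fin.sum_univ_three, fstOther, sndOther] <;> module

theorem sum_twistedE_right (k : Fin 3) (f : Fin 3 → Fin 3 → B) :
    ∑ a, ∑ b, twistedE q a b k • f a b = (-(q : ℂ)) ^ (2 - k : ℕ) •
      (f (fstOther k) (sndOther k) - (q : ℂ) • f (sndOther k) (fstOther k)) := by
  unfold twistedE
  generalize (q : ℂ) = t
  fin_cases k <;> simp [inversions, Fin.sum_univ_three, fstOther, sndOther] <;> module

theorem sum_twistedE_first (k : Fin 3) (f : Fin 3 → B) :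
    ∑ j, twistedE q j (fstOther k) (sndOther k) • f j = (-(q : ℂ)) ^ (k : ℕ) • f k ∧
    ∑ j, twistedE q j (sndOther k) (fstOther k) • f j = (-(q : ℂ)) ^ (k + 1 : ℕ) • f k := by
  unfold twistedE
  generalize (q : ℂ) = t
  constructor <;> fin_cases k <;> simp [inversions, Fin.sum_univ_three, fstOther, sndOther]

theorem sum_twistedE_last (k : Fin 3) (f : Fin 3 → B) :
    ∑ j, twistedE q (fstOther k) (sndOther k) j • f j = (-(q : ℂ)) ^ (2 - k : ℕ) • f k ∧
    ∑ j, twistedE q (sndOther k) (fstOther k) j • f j = (-(q : ℂ)) ^ (3 - k : ℕ) • f k := by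
  unfold twistedE
  generalize (q : ℂ) = t
  constructor <;> fin_cases k <;> simp [inversions, Fin.sum_univ_three, fstOther, sndOther]

theorem neg_ofReal_ne_zero (hq : q ≠ 0) : -(q : ℂ) ≠ 0 := neg_ne_zero.2 (by exact_mod_cast hq)

/-- In the row cofactor formula with a repeated row the left side vanishes, and the right side is
the `q`-commutator times a power of `-q`. -/
theorem IsSUqThree.row_comm (hv : IsSUqThree q v) (hq : q ≠ 0) (j : Fin 3) {a b : Fin 3}
    (h : a < b) : v j a * v j b = (q : ℂ) • (v j b * v j a) := by
  obtain ⟨k, rfl, rfl⟩ := exists_fstOther h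
  have key := hv.sum_star_row j j k
  rw [sum_twistedE_left k fun a b => v j a * v j b] at key
  simp only [show ∀ i, twistedE q i j j = 0 from fun i => by simp [twistedE], zero_smul,
    Finset.sum_const_zero] at key
  have := (smul_eq_zero.1 key.symm).resolve_left (pow_ne_zero _ (neg_ofReal_ne_zero hq))
  exact sub_eq_zero.1 this

theorem IsSUqThree.col_comm (hv : IsSUqThree q v) (hq : q ≠ 0) (a : Fin 3) {i j : Fin 3}
    (h : i < j) : v i a * v j a = (q : ℂ) • (v j a * v i a) := by
  obtain ⟨k, rfl, rfl⟩ := exists_fstOther h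
  have key := hv.sum_star_col a a k
  rw [sum_twistedE_right k fun i j => v i a * v j a] at key
  simp only [show ∀ i, twistedE q a a i = 0 from fun i => by simp [twistedE], zero_smul,
    Finset.sum_const_zero] at key
  have := (smul_eq_zero.1 key.symm).resolve_left (pow_ne_zero _ (neg_ofReal_ne_zero hq))
  exact sub_eq_zero.1 this

/-- The entries of the adjoint matrix are quantum cofactors. -/
theorem IsSUqThree.cofactor (hv : IsSUqThree q v) (j k : Fin 3) :
    (-(q : ℂ)) ^ (j : ℕ) • star (v j k) = (-(q : ℂ)) ^ (k : ℕ) •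
      (v (fstOther j) (fstOther k) * v (sndOther j) (sndOther k)
        - (q : ℂ) • (v (fstOther j) (sndOther k) * v (sndOther j) (fstOther k))) := by
  have := hv.sum_star_row (fstOther j) (sndOther j) k
  rwa [sum_twistedE_left k fun a b => v (fstOther j) a * v (sndOther j) b,
    (sum_twistedE_first j fun j => star (v j k)).1] at this

/-- The same adjoint entry is a quantum minor in four ways, with the rows or the columns in either
order. Comparing the two row versions gives `r`, the two column versions `c`; their difference is
`(q² + 1)(y z - z y) = 0`, and then `c` alone yields the second relation. -/
theorem IsSUqThree.cross (hv : IsSUqThree q v) (hq : 0 < q) {i k a b : Fin 3} (hik : i < k)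
    (hab : a < b) : v i b * v k a = v k a * v i b ∧
      v i a * v k b = v k b * v i a + ((q : ℂ) - (q : ℂ)⁻¹) • (v i b * v k a) := by
  have hq' : (q : ℂ) ≠ 0 := by exact_mod_cast hq.ne'
  obtain ⟨j, rfl, rfl⟩ := exists_fstOther hik
  obtain ⟨l, rfl, rfl⟩ := exists_fstOther hab
  have r1 := hv.sum_star_row (fstOther j) (sndOther j) l
  have r2 := hv.sum_star_row (sndOther j) (fstOther j) l
  have c1 := hv.sum_star_col (fstOther l) (sndOther l) j
  have c2 := hv.sum_star_col (sndOther l) (fstOther l) j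
  rw [sum_twistedE_left l fun a b => v (fstOther j) a * v (sndOther j) b,
    (sum_twistedE_first j fun j => star (v j l)).1] at r1
  rw [sum_twistedE_left l fun a b => v (sndOther j) a * v (fstOther j) b,
    (sum_twistedE_first j fun j => star (v j l)).2, pow_succ', mul_smul, r1, smul_comm] at r2
  rw [sum_twistedE_right j fun i k => v i (fstOther l) * v k (sndOther l),
    (sum_twistedE_last l fun i => star (v j i)).1] at c1
  rw [sum_twistedE_right j fun i k => v i (sndOther l) * v k (fstOther l),
    (sum_twistedE_last l fun i => star (v j i)).2,
    show (3 - l : ℕ) = (2 - l : ℕ) + 1 by omega, pow_succ', mul_smul, c1, smul_comm] at c2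
  have r := smul_right_injective B (pow_ne_zero _ (neg_ofReal_ne_zero hq.ne')) r2
  have c := smul_right_injective B (pow_ne_zero _ (neg_ofReal_ne_zero hq.ne')) c2
  generalize v (fstOther j) (fstOther l) = x at *
  generalize v (fstOther j) (sndOther l) = y at *
  generalize v (sndOther j) (fstOther l) = z at *
  generalize v (sndOther j) (sndOther l) = w at *
  have h1 : (((q : ℂ) ^ 2 + 1)) • (y * z - z * y) = 0 := by
    linear_combination (norm := module) r - c
  have hne : (q : ℂ) ^ 2 + 1 ≠ 0 := by
    have : (q ^ 2 + 1 : ℝ) ≠ 0 := by positivity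
    exact_mod_cast this
  have h2 : y * z = z * y := sub_eq_zero.1 ((smul_eq_zero.1 h1).resolve_left hne)
  refine ⟨h2, smul_right_injective B hq' ?_⟩
  have h3 : (q : ℂ) • ((q : ℂ) - (q : ℂ)⁻¹) • (y * z) = ((q : ℂ) ^ 2 - 1) • (y * z) := by
    rw [smul_smul, mul_sub, mul_inv_cancel₀ hq', sq]
  change (q : ℂ) • (x * w) = (q : ℂ) • (w * x + ((q : ℂ) - (q : ℂ)⁻¹) • (y * z))
  rw [smul_add, h3]
  rw [← h2] at c
  linear_combination (norm := module) (-1 : ℂ) • c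

/-- The rows of the adjoint matrix satisfy a weighted orthogonality relation. -/
theorem IsSUqThree.weighted (hv : IsSUqThree q v) (hq : q ≠ 0) (j : Fin 3) :
    ∑ k : Fin 3, ((q : ℂ) ^ (2 * (2 - k : ℕ))) • (star (v j k) * v j k)
      = ((q : ℂ) ^ (2 * (2 - j : ℕ))) • (1 : B) := by
  have h0 := neg_ofReal_ne_zero hq
  -- In the determinant relation for the rows other than `j` followed by `j`, the first two factors
  -- assemble to the cofactors `star (v j k)`; the powers of `-q` collected on the way are the
  -- weights.
  have key := hv.det (fstOther j) (sndOther j) j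
  have e : twistedE q (fstOther j) (sndOther j) j = (-(q : ℂ)) ^ (2 - j : ℕ) := by
    unfold twistedE
    fin_cases j <;> simp [inversions, fstOther, sndOther]
  rw [e] at key
  have h1 : ∑ i₁, ∑ i₂, ∑ i₃, twistedE q i₁ i₂ i₃ • (v (fstOther j) i₁ * v (sndOther j) i₂ * v j i₃)
      = ∑ k, (∑ i₁, ∑ i₂, twistedE q i₁ i₂ k • (v (fstOther j) i₁ * v (sndOther j) i₂)) * v j k := by
    simp only [Finset.sum_mul, smul_mul_assoc]
    rw [Finset.sum_congr rfl fun y _ => Finset.sum_comm, Finset.sum_comm]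
  rw [h1] at key
  have h2 : ∀ k, ∑ i₁, ∑ i₂, twistedE q i₁ i₂ k • (v (fstOther j) i₁ * v (sndOther j) i₂)
      = ((-(q : ℂ)) ^ (2 - k : ℕ) * ((-(q : ℂ)) ^ (k : ℕ))⁻¹ * (-(q : ℂ)) ^ (j : ℕ)) •
        star (v j k) := fun k => by
    rw [sum_twistedE_right k fun a b => v (fstOther j) a * v (sndOther j) b, mul_smul, mul_smul,
      hv.cofactor j k, inv_smul_smul₀ (pow_ne_zero _ h0)]
  simp only [h2] at key
  have key2 := congrArg (fun x => (-(q : ℂ)) ^ (2 - j : ℕ) • x) key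
  simp only [Finset.smul_sum, smul_mul_assoc, smul_smul] at key2
  have e1 : ∀ k : Fin 3, (-(q : ℂ)) ^ (2 - j : ℕ) * ((-(q : ℂ)) ^ (2 - k : ℕ) *
      ((-(q : ℂ)) ^ (k : ℕ))⁻¹ * (-(q : ℂ)) ^ (j : ℕ)) = (q : ℂ) ^ (2 * (2 - k : ℕ)) := fun k => by
    have hq' : (q : ℂ) ≠ 0 := by exact_mod_cast hq
    fin_cases j <;> fin_cases k <;> simp <;> field_simp
  simp only [e1] at key2
  rw [key2, ← mul_pow, neg_mul_neg, ← sq, ← pow_mul]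

/-- Each pair of entries can be interchanged, up to a scalar factor and a term in which the entries
are closer to the antidiagonal. -/
theorem IsSUqThree.exchange (hv : IsSUqThree q v) (hq : 0 < q) (g h : Fin 3 × Fin 3) :
    ∃ c d : ℂ, v g.1 g.2 * v h.1 h.2 = c • (v h.1 h.2 * v g.1 g.2)
        + d • (v g.1 h.2 * v h.1 g.2) ∧
      (d = 0 ∨ (g.1 * h.2 + h.1 * g.2 : ℕ) < g.1 * g.2 + h.1 * h.2) := by
  have hq' : (q : ℂ) ≠ 0 := by exact_mod_cast hq.ne'
  obtain ⟨i, a⟩ := g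
  obtain ⟨k, b⟩ := h
  dsimp only
  have inv : ∀ {x y : B}, x = (q : ℂ) • y → y = (q : ℂ)⁻¹ • x := fun h => by
    rw [h, inv_smul_smul₀ hq']
  -- The rearrangement inequality: exchanging the columns of two entries in diagonal position lowers
  -- the sum of products of row and column indices.
  have meas : ∀ {i k a b : Fin 3}, i < k → a < b → (i * b + k * a : ℕ) < i * a + k * b := by
    decide
  rcases lt_trichotomy i k with hik | rfl | hik <;> rcases lt_trichotomy a b with hab | rfl | hab
  · exact ⟨1, _, by rw [one_smul]; exact (hv.cross hq hik hab).2, Or.inr (meas hik hab)⟩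
  · exact ⟨q, 0, by rw [zero_smul, add_zero]; exact hv.col_comm hq.ne' a hik, Or.inl rfl⟩
  · exact ⟨1, 0, by rw [zero_smul, add_zero, one_smul]; exact (hv.cross hq hik hab).1, Or.inl rfl⟩
  · exact ⟨q, 0, by rw [zero_smul, add_zero]; exact hv.row_comm hq.ne' i hab, Or.inl rfl⟩
  · exact ⟨1, 0, by rw [zero_smul, add_zero, one_smul], Or.inl rfl⟩
  · exact ⟨(q : ℂ)⁻¹, 0, by rw [zero_smul, add_zero]; exact inv (hv.row_comm hq.ne' i hab), Or.inl rfl⟩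
  · exact ⟨1, 0, by rw [zero_smul, add_zero, one_smul]; exact (hv.cross hq hik hab).1.symm,
      Or.inl rfl⟩
  · exact ⟨(q : ℂ)⁻¹, 0, by rw [zero_smul, add_zero]; exact inv (hv.col_comm hq.ne' a hik), Or.inl rfl⟩
  · refine ⟨1, -((q : ℂ) - (q : ℂ)⁻¹), ?_, Or.inr ?_⟩
    · obtain ⟨h1, h2⟩ := hv.cross hq hik hab
      rw [h2, ← h1, one_smul]
      module
    · have := meas hik hab
      omega

/-- An element which commutes with the entries of `v` up to the scalars `r i * s j` satisfies
similar relations with the entries of the adjoint. -/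
theorem IsSUqThree.star_scaled (hv : IsSUqThree q v) {n : B} {r s : Fin 3 → ℝ}
    (hr : ∀ i, r i ≠ 0) (hs : ∀ j, s j ≠ 0)
    (h : ∀ i j, n * v i j = ((r i * s j : ℝ) : ℂ) • (v i j * n)) (i j : Fin 3) :
    star n * v i j = ((r i * s j : ℝ) : ℂ) • (v i j * star n) := by
  have hr' : ∀ i, (r i : ℂ) ≠ 0 := fun i => by exact_mod_cast hr i
  have hs' : ∀ i, (s i : ℂ) ≠ 0 := fun i => by exact_mod_cast hs i
  -- `n` commutes with `star (v i j)` up to the inverse scalar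
  have h1 : (s j : ℂ) • (n * star (v i j)) = (r i : ℂ)⁻¹ • (star (v i j) * n) := by
    have e1 : ∀ k, (∑ l, star (v l j) * (n * v l k)) = ∑ l, star (v l j) *
        ((r l * s k : ℝ) : ℂ) • (v l k * n) := fun k => by simp only [h]
    have e2 : ∑ l, ∑ k, ((r l : ℂ)⁻¹ • (star (v l j) * (n * v l k))) * star (v i k)
        = (r i : ℂ)⁻¹ • (star (v i j) * n) := by
      have : ∀ l, ∑ k, ((r l : ℂ)⁻¹ • (star (v l j) * (n * v l k))) * star (v i k)
          = ((r l : ℂ)⁻¹ • (star (v l j) * n)) * ∑ k, v l k * star (v i k) := fun l => by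
        rw [Finset.mul_sum]
        refine Finset.sum_congr rfl fun k _ => ?_
        simp only [smul_mul_assoc, mul_assoc]
      simp only [this, hv.sum_mul_star]
      simp
    have e3 : ∑ l, ∑ k, ((r l : ℂ)⁻¹ • (star (v l j) * (n * v l k))) * star (v i k)
        = (s j : ℂ) • (n * star (v i j)) := by
      have : ∀ k, ∑ l, ((r l : ℂ)⁻¹ • (star (v l j) * (n * v l k))) * star (v i k)
          = (s k : ℂ) • ((∑ l, star (v l j) * v l k) * (n * star (v i k))) := fun k => by
        rw [Finset.sum_mul, Finset.smul_sum]
        refine Finset.sum_congr rfl fun l _ => ?_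
        rw [h]
        push_cast
        rw [mul_smul_comm, smul_smul, inv_mul_cancel_left₀ (hr' l)]
        simp only [smul_mul_assoc, mul_assoc]
      rw [Finset.sum_comm]
      simp only [this, hv.sum_star_mul]
      simp
    rw [← e3, e2]
  -- Passing to adjoints replaces `n` by `star n` and restores `v i j`; the scalars are real and
  -- hence unchanged.
  have h2 := congrArg star h1
  simp only [star_smul, star_mul, star_star, Complex.star_def, map_inv₀, Complex.conj_ofReal] at h2
  have h3 := congrArg (fun x => (r i : ℂ) • x) h2
  simp only [smul_inv_smul₀ (hr' i)] at h3
  rw [← h3, smul_smul]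
  push_cast
  rfl

end Consequences

/-! ### Words in the generators and averages over the gauge action -/

section Words

open Filter Topology

/-- The product of the entries of `v` along a list of positions. -/
def word {B : Type*} [Ring B] (v : Matrix (Fin 3) (Fin 3) B) (w : List (Fin 3 × Fin 3)) : B :=
  (w.map fun p => v p.1 p.2).prod

/-- Every column index occurs `n` times. -/
def Balanced (n : ℕ) (w : List (Fin 3 × Fin 3)) : Prop := ∀ j, (w.map Prod.snd).count j = n

section Basic

variable {B C : Type*} [Ring B] [Ring C] (v : Matrix (Fin 3) (Fin 3) B)

@[simp] theorem word_nil : word v [] = 1 := rfl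

@[simp] theorem word_cons (p : Fin 3 × Fin 3) (w : List (Fin 3 × Fin 3)) :
    word v (p :: w) = v p.1 p.2 * word v w := by simp [word]

@[simp] theorem word_append (w w' : List (Fin 3 × Fin 3)) :
    word v (w ++ w') = word v w * word v w' := by simp [word]

theorem map_word {F : Type*} [FunLike F B C] [RingHomClass F B C] (f : F)
    (w : List (Fin 3 × Fin 3)) : f (word v w) = word (v.map f) w := by
  induction w with
  | nil => simp
  | cons p w ih => simp [ih]

end Basic

variable {q : ℝ}

/-- The words in the generators span a dense subspace. -/
theorem mem_of_word_mem (hq : q ≠ 0) (S : Submodule ℂ (CSUqThree q))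
    (hS : IsClosed (S : Set (CSUqThree q))) (h : ∀ w, word (gen q) w ∈ S) (x : CSUqThree q) :
    x ∈ S := by
  let T : Subalgebra ℂ (CSUqThree q) :=
    Algebra.adjoin ℂ (Set.range fun p : Fin 3 × Fin 3 => gen q p.1 p.2)
  have hgen : ∀ i j, gen q i j ∈ T := fun i j => Algebra.subset_adjoin ⟨(i, j), rfl⟩
  -- Adjoints of generators are quantum cofactors, so the algebra generated without adjoints is
  -- already closed under the involution.
  have hstar : ∀ i j, star (gen q i j) ∈ T := fun i j => by
    have h0 := pow_ne_zero i.1 (neg_ofReal_ne_zero hq)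
    have := congrArg (fun x => ((-(q : ℂ)) ^ (i : ℕ))⁻¹ • x) ((isSUqThree_gen q).cofactor i j)
    simp only [inv_smul_smul₀ h0] at this
    rw [this]
    exact T.smul_mem (T.smul_mem (T.sub_mem (T.mul_mem (hgen _ _) (hgen _ _))
      (T.smul_mem (T.mul_mem (hgen _ _) (hgen _ _)) _)) _) _
  have hst : ∀ x ∈ T, star x ∈ T := by
    intro x hx
    induction hx using Algebra.adjoin_induction with
    | mem x hx => obtain ⟨p, rfl⟩ := hx; exact hstar _ _
    | algebraMap r => rw [← algebraMap_star_comm]; exact T.algebraMap_mem _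
    | add x y _ _ hx hy => rw [star_add]; exact T.add_mem hx hy
    | mul x y _ _ hx hy => rw [star_mul]; exact T.mul_mem hy hx
  have hTS : ∀ x ∈ T, x ∈ S := by
    intro x hx
    have hx' : x ∈ Submodule.span ℂ
        (Submonoid.closure (Set.range fun p : Fin 3 × Fin 3 => gen q p.1 p.2) :
          Set (CSUqThree q)) := by
      rwa [← Algebra.adjoin_eq_span]
    refine Submodule.span_le.2 (fun y hy => ?_) hx'
    obtain ⟨l, hl, rfl⟩ := Submonoid.exists_list_of_mem_closure hy
    have : ∀ l : List (CSUqThree q), (∀ y ∈ l, y ∈ Set.range fun p : Fin 3 × Fin 3 => gen q p.1 p.2) →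
        ∃ w, l.prod = word (gen q) w := by
      intro l
      induction l with
      | nil => exact fun _ => ⟨[], by simp⟩
      | cons a l ih =>
        intro hl
        obtain ⟨w, hw⟩ := ih fun y hy => hl y (List.mem_cons_of_mem _ hy)
        obtain ⟨p, hp⟩ := hl a List.mem_cons_self
        exact ⟨p :: w, by rw [List.prod_cons, hw, word_cons, ← hp]⟩
    obtain ⟨w, hw⟩ := this l hl
    rw [hw]; exact h w
  let ι : CSUqThree q →⋆ₐ[ℂ] ModelProd q := (generated (universalMatrix q)).subtype
  have hmem : ∀ y ∈ StarAlgebra.adjoin ℂ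
      (Set.range fun p : Fin 3 × Fin 3 => universalMatrix q p.1 p.2), ∃ t ∈ T, ι t = y := by
    intro y hy
    induction hy using StarAlgebra.adjoin_induction with
    | mem x hx => obtain ⟨p, rfl⟩ := hx; exact ⟨gen q p.1 p.2, hgen _ _, rfl⟩
    | algebraMap r => exact ⟨algebraMap ℂ _ r, T.algebraMap_mem r, AlgHomClass.commutes ι r⟩
    | add x y _ _ hx hy =>
      obtain ⟨a, ha, rfl⟩ := hx; obtain ⟨b, hb, rfl⟩ := hy
      exact ⟨a + b, T.add_mem ha hb, map_add ι a b⟩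
    | mul x y _ _ hx hy =>
      obtain ⟨a, ha, rfl⟩ := hx; obtain ⟨b, hb, rfl⟩ := hy
      exact ⟨a * b, T.mul_mem ha hb, map_mul ι a b⟩
    | star x _ hx => obtain ⟨a, ha, rfl⟩ := hx; exact ⟨star a, hst a ha, map_star ι a⟩
  rw [← SetLike.mem_coe, ← hS.closure_eq, Metric.mem_closure_iff]
  intro ε hε
  have hx : (ι x) ∈ closure ((StarAlgebra.adjoin ℂ
      (Set.range fun p : Fin 3 × Fin 3 => universalMatrix q p.1 p.2) : StarSubalgebra ℂ _) :
        Set (ModelProd q)) := by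
    have h2 : (ι x) ∈ generated (universalMatrix q) := Subtype.property (p := (· ∈ generated (universalMatrix q))) x
    exact h2
  obtain ⟨y, hy, hd⟩ := Metric.mem_closure_iff.1 hx ε hε
  obtain ⟨t, ht, rfl⟩ := hmem y hy
  exact ⟨t, hTS t ht, hd⟩

theorem gauge_word (z₁ z₂ : Circle) (w : List (Fin 3 × Fin 3)) :
    gauge q z₁ z₂ (word (gen q) w) = ((z₁ : ℂ) ^ (w.map Prod.snd).count 0 *
      (z₂ : ℂ) ^ (w.map Prod.snd).count 1 *
      (((z₁ * z₂)⁻¹ : Circle) : ℂ) ^ (w.map Prod.snd).count 2) • word (gen q) w := by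
  induction w with
  | nil => simp
  | cons p w ih =>
    obtain ⟨i, j⟩ := p
    rw [word_cons, map_mul, ih, gauge_gen, smul_mul_smul_comm]
    congr 1
    fin_cases j <;> simp [pow_succ] <;> ring

/-- The average of the gauge action over the pairs of `N`-th roots of unity. -/
def average (q : ℝ) (N : ℕ) : CSUqThree q →ₗ[ℂ] CSUqThree q :=
  ((N : ℂ)⁻¹ * (N : ℂ)⁻¹) • ∑ a ∈ Finset.range N, ∑ b ∈ Finset.range N,
    (gauge q (Circle.exp (2 * Real.pi / N) ^ a) (Circle.exp (2 * Real.pi / N) ^ b)).toAlgHom.toLinearMap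

theorem average_apply (N : ℕ) (x : CSUqThree q) : average q N x =
    ((N : ℂ)⁻¹ * (N : ℂ)⁻¹) • ∑ a ∈ Finset.range N, ∑ b ∈ Finset.range N,
      gauge q (Circle.exp (2 * Real.pi / N) ^ a) (Circle.exp (2 * Real.pi / N) ^ b) x := by
  simp [average, LinearMap.sum_apply]

theorem average_of_mem {N : ℕ} (hN : N ≠ 0) {x : CSUqThree q} (hx : x ∈ flagAlgebra q) :
    average q N x = x := by
  have hx' : ∀ z₁ z₂ : Circle, gauge q z₁ z₂ x = x := hx
  have : (N : ℂ) ≠ 0 := by exact_mod_cast hN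
  rw [average_apply]
  simp only [hx', Finset.sum_const, Finset.card_range, ← Nat.cast_smul_eq_nsmul ℂ, smul_smul]
  rw [show (N : ℂ)⁻¹ * (N : ℂ)⁻¹ * ((N : ℂ) * (N : ℂ)) = 1 by field_simp, one_smul]

theorem norm_average_le {N : ℕ} (hN : N ≠ 0) (x : CSUqThree q) : ‖average q N x‖ ≤ ‖x‖ := by
  have hN' : (N : ℝ) ≠ 0 := by exact_mod_cast hN
  rw [average_apply, norm_smul]
  have : ‖∑ a ∈ Finset.range N, ∑ b ∈ Finset.range N,
      gauge q (Circle.exp (2 * Real.pi / N) ^ a) (Circle.exp (2 * Real.pi / N) ^ b) x‖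
      ≤ N * (N * ‖x‖) := by
    refine (norm_sum_le _ _).trans ((Finset.sum_le_card_nsmul _ _ (N * ‖x‖) fun a _ => ?_).trans
      (by simp))
    refine (norm_sum_le _ _).trans ((Finset.sum_le_card_nsmul _ _ ‖x‖ fun b _ => ?_).trans
      (by simp))
    exact NonUnitalStarAlgHom.norm_apply_le _ x
  refine (mul_le_mul_of_nonneg_left this (norm_nonneg _)).trans (le_of_eq ?_)
  simp
  field_simp

theorem sum_root_eq_zero {N : ℕ} (m n : ℕ) (hm : m < N) (hn : n < N) (hmn : m ≠ n) :
    ∑ a ∈ Finset.range N, ((Circle.exp (2 * Real.pi / N) ^ a : Circle) : ℂ) ^ m *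
      (((Circle.exp (2 * Real.pi / N) ^ a)⁻¹ : Circle) : ℂ) ^ n = 0 := by
  have hN : N ≠ 0 := by omega
  set ζ : ℂ := (Circle.exp (2 * Real.pi / N) : ℂ) with hζ
  have hprim : IsPrimitiveRoot ζ N := by
    have := Complex.isPrimitiveRoot_exp N hN
    convert this using 1
    rw [hζ, Circle.coe_exp]
    congr 1
    push_cast
    ring
  have h0 : ζ ≠ 0 := hprim.ne_zero hN
  set ω : ℂ := ζ ^ m * (ζ ^ n)⁻¹ with hω
  have hω1 : ω ≠ 1 := by
    rw [hω, Ne, mul_inv_eq_one₀ (pow_ne_zero _ h0)]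
    exact fun h => hmn (hprim.pow_inj hm hn h)
  have hωN : ω ^ N = 1 := by
    rw [hω, mul_pow, inv_pow, ← pow_mul, ← pow_mul, mul_comm m, mul_comm n, pow_mul, pow_mul,
      hprim.pow_eq_one]
    simp
  have : ∀ a, ((Circle.exp (2 * Real.pi / N) ^ a : Circle) : ℂ) ^ m *
      (((Circle.exp (2 * Real.pi / N) ^ a)⁻¹ : Circle) : ℂ) ^ n = ω ^ a := fun a => by
    rw [Circle.coe_inv, Circle.coe_pow, ← hζ, hω, mul_pow, inv_pow, inv_pow, ← pow_mul, ← pow_mul,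
      ← pow_mul, ← pow_mul, mul_comm a, mul_comm a]
  simp only [this]
  have hg := mul_geom_sum ω N
  rw [hωN, sub_self] at hg
  exact (mul_eq_zero.1 hg).resolve_left (sub_ne_zero.2 hω1)

/-- The gauge group scales a word by a character whose exponents are the differences of the column
counts. The average over `N`-th roots of unity kills it unless these differences are divisible by
`N`; as all counts are below `N`, only equal counts survive. -/
theorem average_word {N : ℕ} (w : List (Fin 3 × Fin 3)) (hw : w.length < N)
    (h : ∀ n, ¬ Balanced n w) : average q N (word (gen q) w) = 0 := by
  set c : Fin 3 → ℕ := fun j => (w.map Prod.snd).count j with hc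
  have hlt : ∀ j, c j < N := fun j => (List.count_le_length.trans (by simp)).trans_lt hw
  have hne : c 0 ≠ c 2 ∨ c 1 ≠ c 2 := by
    by_contra! h'
    refine h (c 2) fun j => ?_
    fin_cases j
    exacts [h'.1, h'.2, rfl]
  have hg : ∀ z₁ z₂ : Circle, gauge q z₁ z₂ (word (gen q) w) = (((z₁ : ℂ) ^ c 0 *
      ((z₁⁻¹ : Circle) : ℂ) ^ c 2) * ((z₂ : ℂ) ^ c 1 * ((z₂⁻¹ : Circle) : ℂ) ^ c 2)) •
        word (gen q) w := fun z₁ z₂ => by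
    rw [gauge_word, mul_inv, Circle.coe_mul, mul_pow]
    congr 1
    ring
  rw [average_apply]
  simp only [hg, ← Finset.sum_smul]
  have hs : ∀ f g : ℕ → ℂ, ∑ a ∈ Finset.range N, ∑ b ∈ Finset.range N, f a * g b
      = (∑ a ∈ Finset.range N, f a) * ∑ b ∈ Finset.range N, g b := fun f g => by
    rw [Finset.sum_mul_sum]
  rw [smul_smul, hs (fun a => ((Circle.exp (2 * Real.pi / N) ^ a : Circle) : ℂ) ^ c 0 *
    (((Circle.exp (2 * Real.pi / N) ^ a)⁻¹ : Circle) : ℂ) ^ c 2)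
    (fun b => ((Circle.exp (2 * Real.pi / N) ^ b : Circle) : ℂ) ^ c 1 *
    (((Circle.exp (2 * Real.pi / N) ^ b)⁻¹ : Circle) : ℂ) ^ c 2)]
  rcases hne with h | h
  · rw [sum_root_eq_zero _ _ (hlt 0) (hlt 2) h]; simp
  · rw [sum_root_eq_zero _ _ (hlt 1) (hlt 2) h]; simp

theorem word_mem_flagAlgebra {n : ℕ} {w : List (Fin 3 × Fin 3)} (h : Balanced n w) :
    word (gen q) w ∈ flagAlgebra q := fun z₁ z₂ => by
  rw [gauge_word, h, h, h, ← mul_pow, ← mul_pow, torus_inv_mul, one_pow, one_smul]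

/-- The balanced words span a dense subspace of the fixed point algebra. -/
theorem mem_of_balanced_mem (hq : q ≠ 0) (S : Submodule ℂ (CSUqThree q))
    (hS : IsClosed (S : Set (CSUqThree q))) (h : ∀ n w, Balanced n w → word (gen q) w ∈ S)
    {x : CSUqThree q} (hx : x ∈ flagAlgebra q) : x ∈ S := by
  -- The order `N` has to exceed the length of the word, so no single average works for all words;
  -- membership in `T` only asks for sufficiently large `N`.
  let T : Submodule ℂ (CSUqThree q) :=
    { carrier := {p | ∃ N₀, ∀ N ≥ N₀, average q N p ∈ S}
      add_mem' := by
        rintro a b ⟨N₁, h₁⟩ ⟨N₂, h₂⟩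
        refine ⟨max N₁ N₂, fun N hN => ?_⟩
        rw [map_add]
        exact S.add_mem (h₁ N ((le_max_left _ _).trans hN)) (h₂ N ((le_max_right _ _).trans hN))
      zero_mem' := ⟨0, fun N _ => by rw [map_zero]; exact S.zero_mem⟩
      smul_mem' := by
        rintro c a ⟨N₁, h₁⟩
        refine ⟨N₁, fun N hN => ?_⟩
        rw [map_smul]
        exact S.smul_mem c (h₁ N hN) }
  have hw : ∀ w, word (gen q) w ∈ T := fun w => by
    refine ⟨w.length + 1, fun N hN => ?_⟩
    by_cases hb : ∃ n, Balanced n w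
    · obtain ⟨n, hn⟩ := hb
      rw [average_of_mem (by omega) (word_mem_flagAlgebra hn)]
      exact h n w hn
    · rw [average_word w (by omega) (not_exists.1 hb)]
      exact S.zero_mem
  have hd : x ∈ T.topologicalClosure :=
    mem_of_word_mem hq _ T.isClosed_topologicalClosure
      (fun w => T.le_topologicalClosure (hw w)) x
  rw [← SetLike.mem_coe, ← hS.closure_eq, Metric.mem_closure_iff]
  intro ε hε
  obtain ⟨p, ⟨N₀, hp⟩, hxp⟩ := Metric.mem_closure_iff.1 hd ε hε
  refine ⟨average q (N₀ + 1) p, hp _ (Nat.le_succ _), ?_⟩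
  rw [← average_of_mem (Nat.succ_ne_zero N₀) hx, dist_eq_norm, ← map_sub]
  exact (norm_average_le (Nat.succ_ne_zero N₀) _).trans_lt (by rwa [← dist_eq_norm])

theorem isClosed_flagAlgebra : IsClosed (flagAlgebra q : Set (CSUqThree q)) := by
  have : (flagAlgebra q : Set (CSUqThree q)) = ⋂ (z₁ : Circle) (z₂ : Circle), {x | gauge q z₁ z₂ x = x} := by
    ext x
    simp only [Set.mem_iInter]
    rfl
  rw [this]
  exact isClosed_iInter fun z₁ => isClosed_iInter fun z₂ =>
    isClosed_eq (continuous_starAlgHom _) continuous_id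

end Words

/-! ### Compression of balanced words by a triangular reduction -/

section Triangular

/-- The sum of the products of the row and column indices of the letters of a word. -/
def wordWeight (l : List (Fin 3 × Fin 3)) : ℕ := (l.map fun p => (p.1 * p.2 : ℕ)).sum

/-- The word `(w 0, 0), (w 1, 1), (w 2, 2)`. -/
def cartanWord (w : Fin 3 → Fin 3) : List (Fin 3 × Fin 3) := [(w 0, 0), (w 1, 1), (w 2, 2)]

theorem wordWeight_perm {l l' : List (Fin 3 × Fin 3)} (h : l.Perm l') :
    wordWeight l = wordWeight l' := (h.map _).sum_eq

theorem Balanced.perm {n : ℕ} {l l' : List (Fin 3 × Fin 3)} (h : l.Perm l')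
    (hb : Balanced n l) : Balanced n l' := fun j => by
  rw [← hb j]; exact ((h.map Prod.snd).count_eq j).symm

theorem balanced_flatten (w : Fin 3 → Fin 3) (n : ℕ) :
    Balanced n (List.replicate n (cartanWord w)).flatten := by
  induction n with
  | zero => intro j; simp
  | succ n ih =>
    intro j
    rw [List.replicate_succ, List.flatten_cons, List.map_append, List.count_append, ih j]
    fin_cases j <;> simp [cartanWord] <;> omega

/-- A balanced word with all letters on the graph of `w` is a permutation of a power of the
word `cartanWord w`. -/
theorem perm_flatten {w : Fin 3 → Fin 3} {n : ℕ} {l : List (Fin 3 × Fin 3)} (hb : Balanced n l)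
    (hl : ∀ p ∈ l, p.1 = w p.2) : l.Perm (List.replicate n (cartanWord w)).flatten := by
  have key : ∀ l : List (Fin 3 × Fin 3), (∀ p ∈ l, p.1 = w p.2) →
      l = (l.map Prod.snd).map fun j => (w j, j) := by
    intro l hl
    rw [List.map_map]
    conv_lhs => rw [← List.map_id l]
    exact List.map_congr_left fun p hp => Prod.ext (hl p hp) rfl
  have h2 : ∀ p ∈ (List.replicate n (cartanWord w)).flatten, p.1 = w p.2 := by
    intro p hp
    obtain ⟨l', hl', hp⟩ := List.mem_flatten.1 hp
    rw [List.eq_of_mem_replicate hl'] at hp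
    simp only [cartanWord, List.mem_cons, List.not_mem_nil, or_false] at hp
    rcases hp with rfl | rfl | rfl <;> rfl
  rw [key l hl, key _ h2]
  refine List.Perm.map _ (List.perm_iff_count.2 fun j => ?_)
  rw [hb j, balanced_flatten w n j]

variable {B : Type*} [Ring B] [Algebra ℂ B] {v : Matrix (Fin 3) (Fin 3) B} {e : B}

/-- Membership of `e * word * e` in a subspace may be checked after permuting the word, if the words
of smaller weight are known to satisfy it. -/
theorem mem_of_perm (hex : ∀ g h : Fin 3 × Fin 3, ∃ c d : ℂ, v g.1 g.2 * v h.1 h.2 =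
      c • (v h.1 h.2 * v g.1 g.2) + d • (v g.1 h.2 * v h.1 g.2) ∧
      (d = 0 ∨ (g.1 * h.2 + h.1 * g.2 : ℕ) < g.1 * g.2 + h.1 * h.2))
    (V : Submodule ℂ B) {n m : ℕ}
    (ih : ∀ l, wordWeight l < m → Balanced n l → e * word v l * e ∈ V)
    {l l' : List (Fin 3 × Fin 3)} (hp : l.Perm l') :
    ∀ a b, wordWeight (a ++ l ++ b) = m → Balanced n (a ++ l ++ b) →
      e * word v (a ++ l' ++ b) * e ∈ V → e * word v (a ++ l ++ b) * e ∈ V := by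
  induction hp with
  | nil => exact fun _ _ _ _ h => h
  | @cons x l₁ l₂ _ ih' =>
    intro a b hm hb h
    have e1 : ∀ l : List (Fin 3 × Fin 3), a ++ x :: l ++ b = (a ++ [x]) ++ l ++ b := fun l => by simp
    rw [e1] at hm hb h ⊢
    exact ih' _ _ hm hb h
  | swap h g l =>
    intro a b hm hb hmem
    -- The correction term exchanges the columns of two adjacent letters. It keeps the word balanced
    -- and lowers its weight, so the induction hypothesis covers it.
    obtain ⟨c, d, hcd, hlt⟩ := hex g h
    have e1 : e * word v (a ++ g :: h :: l ++ b) * e = c • (e * word v (a ++ h :: g :: l ++ b) * e)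
        + d • (e * word v (a ++ (g.1, h.2) :: (h.1, g.2) :: l ++ b) * e) := by
      simp only [word_append, word_cons]
      have : v g.1 g.2 * (v h.1 h.2 * word v l) = c • (v h.1 h.2 * (v g.1 g.2 * word v l))
          + d • (v g.1 h.2 * (v h.1 g.2 * word v l)) := by
        rw [← mul_assoc, hcd]
        simp only [add_mul, smul_mul_assoc, mul_assoc]
      rw [this]
      simp only [mul_add, add_mul, smul_mul_assoc, mul_smul_comm, mul_assoc]
    rw [e1]
    refine V.add_mem (V.smul_mem _ hmem) ?_
    rcases hlt with rfl | hlt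
    · rw [zero_smul]; exact V.zero_mem
    refine V.smul_mem _ (ih _ ?_ fun j => ?_)
    · rw [← hm]
      simp only [wordWeight, List.map_append, List.map_cons, List.sum_append, List.sum_cons]
      omega
    · rw [← hb j]
      simp only [List.map_append, List.map_cons, List.count_append, List.count_cons]
      omega
  | @trans l₁ l₂ l₃ h₁ h₂ ih₁ ih₂ =>
    intro a b hm hb h
    have hp : (a ++ l₁ ++ b).Perm (a ++ l₂ ++ b) := (h₁.append_left a).append_right b
    exact ih₁ a b hm hb (ih₂ a b ((wordWeight_perm hp).symm.trans hm) (hb.perm hp) h)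

/-- By strong induction on the weight, letters may be permuted freely. A letter annihilated by `e`
is moved to the right or left end, where it kills the compressed word. If there is none, all letters
lie on the graph of `w`, and balance determines such a word up to permutation. -/
theorem compress_mem (hex : ∀ g h : Fin 3 × Fin 3, ∃ c d : ℂ, v g.1 g.2 * v h.1 h.2 =
      c • (v h.1 h.2 * v g.1 g.2) + d • (v g.1 h.2 * v h.1 g.2) ∧
      (d = 0 ∨ (g.1 * h.2 + h.1 * g.2 : ℕ) < g.1 * g.2 + h.1 * h.2))
    (w : Fin 3 → Fin 3)
    (hcl : ∀ i j, v i j * e = 0 ∨ e * v i j = 0 ∨ i = w j) (n : ℕ) :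
    ∀ l, Balanced n l → e * word v l * e ∈
      Submodule.span ℂ {e * word v (List.replicate n (cartanWord w)).flatten * e} := by
  set V := Submodule.span ℂ {e * word v (List.replicate n (cartanWord w)).flatten * e}
  suffices ∀ m l, wordWeight l = m → Balanced n l → e * word v l * e ∈ V from
    fun l => this _ l rfl
  intro m
  induction m using Nat.strong_induction_on with
  | _ m ih =>
    intro l hm hb
    have hperm : ∀ l', l.Perm l' → e * word v l' * e ∈ V → e * word v l * e ∈ V := by
      intro l' hp h
      have := mem_of_perm hex V (fun l h hb => ih _ h l rfl hb) hp [] []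
      simp only [List.nil_append, List.append_nil] at this
      exact this hm hb h
    by_cases h1 : ∃ p ∈ l, v p.1 p.2 * e = 0
    · obtain ⟨p, hp, h⟩ := h1
      refine hperm _ ((List.perm_cons_erase hp).trans (List.perm_append_singleton p _).symm) ?_
      rw [word_append, word_cons, word_nil, mul_one, mul_assoc, mul_assoc, h, mul_zero, mul_zero]
      exact V.zero_mem
    by_cases h2 : ∃ p ∈ l, e * v p.1 p.2 = 0
    · obtain ⟨p, hp, h⟩ := h2
      refine hperm _ (List.perm_cons_erase hp) ?_
      rw [word_cons, ← mul_assoc, h, zero_mul, zero_mul]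
      exact V.zero_mem
    refine hperm _ (perm_flatten (w := w) hb fun p hp => ?_) (Submodule.subset_span rfl)
    rcases hcl p.1 p.2 with h | h | h
    exacts [(h1 ⟨p, hp, h⟩).elim, (h2 ⟨p, hp, h⟩).elim, h]

/-- If `e` is an idempotent such that each entry of `v` is annihilated by `e` on one side, or
commutes with `e` and lies on the graph of `w`, then `e` compresses the balanced words to scalars. -/
theorem exists_compress_eq (hex : ∀ g h : Fin 3 × Fin 3, ∃ c d : ℂ, v g.1 g.2 * v h.1 h.2 =
      c • (v h.1 h.2 * v g.1 g.2) + d • (v g.1 h.2 * v h.1 g.2) ∧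
      (d = 0 ∨ (g.1 * h.2 + h.1 * g.2 : ℕ) < g.1 * g.2 + h.1 * h.2))
    {q : ℝ} (hdet : ∑ i₁, ∑ i₂, ∑ i₃, twistedE q i₁ i₂ i₃ • (v 0 i₁ * v 1 i₂ * v 2 i₃) = 1)
    (w : Fin 3 → Fin 3) (he : e * e = e) (hcomm : ∀ j, Commute (v (w j) j) e)
    (hcl : ∀ i j, v i j * e = 0 ∨ e * v i j = 0 ∨ i = w j)
    {n : ℕ} {l : List (Fin 3 × Fin 3)} (hl : Balanced n l) : ∃ c : ℂ, e * word v l * e = c • e := by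
  set t : B := word v (cartanWord w) with ht
  have hV1 : ∀ l, Balanced 1 l → e * word v l * e ∈ Submodule.span ℂ {e * t * e} := by
    have := compress_mem hex w hcl 1
    simpa using this
  -- The determinant relation writes `e = e * 1 * e` as a combination of compressed balanced words
  -- of length three. Hence `e * t * e` is a nonzero multiple of `e`, unless `e = 0`.
  have h1 : e ∈ Submodule.span ℂ {e * t * e} := by
    suffices e * 1 * e ∈ Submodule.span ℂ {e * t * e} by rwa [mul_one, he] at this
    rw [← hdet]
    simp only [Finset.mul_sum, Finset.sum_mul]
    refine Submodule.sum_mem _ fun a _ => Submodule.sum_mem _ fun b _ =>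
      Submodule.sum_mem _ fun c _ => ?_
    by_cases hd : a ≠ b ∧ a ≠ c ∧ b ≠ c
    · rw [mul_smul_comm, smul_mul_assoc]
      refine Submodule.smul_mem _ _ ?_
      have := hV1 [(0, a), (1, b), (2, c)] fun j => by
        revert a b c j; decide
      simpa [mul_assoc] using this
    · rw [twistedE, if_neg hd, zero_smul, mul_zero, zero_mul]
      exact Submodule.zero_mem _
  obtain ⟨k, hk⟩ := Submodule.mem_span_singleton.1 h1
  by_cases he0 : e = 0
  · exact ⟨0, by simp [he0]⟩
  have hk0 : k ≠ 0 := by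
    rintro rfl
    rw [zero_smul] at hk
    exact he0 hk.symm
  have hte : e * t * e = k⁻¹ • e := by
    conv_rhs => rw [← hk]
    rw [inv_smul_smul₀ hk0]
  have hpow : ∀ n : ℕ, ∃ c : ℂ, e * word v (List.replicate n (cartanWord w)).flatten * e = c • e := by
    have hc : Commute t e := by
      simp only [ht, cartanWord, word_cons, word_nil, mul_one]
      exact (hcomm 0).mul_left ((hcomm 1).mul_left (hcomm 2))
    have hte' : t * e = k⁻¹ • e := by
      rw [← hte, ← hc.eq, mul_assoc, he]
    intro n
    induction n with
    | zero => exact ⟨1, by simp [he]⟩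
    | succ n ih =>
      obtain ⟨c, hc'⟩ := ih
      refine ⟨k⁻¹ * c, ?_⟩
      rw [List.replicate_succ, List.flatten_cons, word_append, ← ht, ← mul_assoc, ← hc.eq,
        mul_assoc, mul_assoc, ← mul_assoc e, hc', mul_smul_comm, hte', smul_smul, mul_comm]
  obtain ⟨c, hc⟩ := Submodule.mem_span_singleton.1 (compress_mem hex w hcl n l hl)
  obtain ⟨d, hd⟩ := hpow n
  exact ⟨c * d, by rw [← hc, hd, smul_smul]⟩

end Triangular

/-! ### Contractions whose powers converge to a vacuum projection -/

section Vacuum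

open Filter Topology

variable {B : Type u} [CStarAlgebra B]

/-- The left ideal of those `z` for which `z * G ^ n` decays faster than `‖G‖ ^ n`, with rate `s`. -/
def decayIdeal (G : B) (s : ℝ) : Ideal B where
  carrier := {z | ∃ C, ∀ n : ℕ, ‖z * G ^ n‖ ≤ C * (s * ‖G‖) ^ n}
  add_mem' := by
    rintro a b ⟨C, hC⟩ ⟨D, hD⟩
    refine ⟨C + D, fun n => ?_⟩
    rw [add_mul, add_mul]
    exact (norm_add_le _ _).trans (add_le_add (hC n) (hD n))
  zero_mem' := ⟨0, fun n => by simp⟩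
  smul_mem' := by
    rintro c a ⟨C, hC⟩
    refine ⟨‖c‖ * C, fun n => ?_⟩
    rw [smul_eq_mul, mul_assoc, mul_assoc]
    exact (norm_mul_le _ _).trans (mul_le_mul_of_nonneg_left (hC n) (norm_nonneg _))

/-- Moving `l` through `G ^ n` produces `κ ^ n`. The bound retains the factor `‖G‖ ^ n` instead of
estimating it by 1; the comparison in `IsVacuum.eq_zero` depends on this. -/
theorem mem_decayIdeal {G l : B} {s κ : ℝ} (h : l * G = (κ : ℂ) • (G * l)) (hκ : |κ| ≤ s) :
    l ∈ decayIdeal G s := by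
  have hs : 0 ≤ s := (abs_nonneg _).trans hκ
  have h1 : ∀ n : ℕ, l * G ^ n = ((κ : ℂ) ^ n) • (G ^ n * l) := by
    intro n
    induction n with
    | zero => simp
    | succ n ih =>
      rw [pow_succ, ← mul_assoc, ih, smul_mul_assoc, mul_assoc, h, mul_smul_comm, smul_smul,
        ← pow_succ, ← mul_assoc]
  refine ⟨‖(1 : B)‖ * ‖l‖, fun n => ?_⟩
  have h2 : ‖G ^ n‖ ≤ ‖(1 : B)‖ * ‖G‖ ^ n := by
    rcases Nat.eq_zero_or_pos n with rfl | hn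
    · simp
    rcases subsingleton_or_nontrivial B with hB | hB
    · rw [Subsingleton.elim (G ^ n) 0, norm_zero]; positivity
    · rw [norm_one, one_mul]; exact norm_pow_le' G hn
  rw [h1, norm_smul, norm_pow, Complex.norm_real, Real.norm_eq_abs, mul_pow]
  calc |κ| ^ n * ‖G ^ n * l‖ ≤ s ^ n * (‖(1 : B)‖ * ‖G‖ ^ n * ‖l‖) := by
        gcongr
        exact (norm_mul_le _ _).trans (by gcongr)
    _ = _ := by ring

/-- `G` is a contraction whose powers converge to a projection onto the vectors annihilated by a
part of the entries of `v`; the remaining entries act as raising operators, or commute with `G` and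
lie on the graph of `w`. -/
structure IsVacuum (v : Matrix (Fin 3) (Fin 3) B) (G : B) (s : ℝ) (w : Fin 3 → Fin 3) : Prop where
  star_eq : star G = G
  norm_le : ‖G‖ ≤ 1
  nonneg : 0 ≤ s
  lt_one : s < 1
  one_sub_mem : 1 - G ∈ decayIdeal G s
  entry : ∀ i j, v i j ∈ decayIdeal G s ∨ star (v i j) ∈ decayIdeal G s ∨ i = w j
  comm : ∀ j, Commute (v (w j) j) G

variable {v : Matrix (Fin 3) (Fin 3) B} {G : B} {s : ℝ} {w : Fin 3 → Fin 3}

theorem IsVacuum.tendsto_mul (h : IsVacuum v G s w) {z : B} (hz : z ∈ decayIdeal G s) :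
    Tendsto (fun n => z * G ^ n) atTop (𝓝 0) := by
  obtain ⟨C, hC⟩ := hz
  refine squeeze_zero_norm hC ?_
  have : Tendsto (fun n : ℕ => (s * ‖G‖) ^ n) atTop (𝓝 0) :=
    tendsto_pow_atTop_nhds_zero_of_lt_one (mul_nonneg h.nonneg (norm_nonneg _))
      ((mul_le_of_le_one_right h.nonneg h.norm_le).trans_lt h.lt_one)
  simpa using this.const_mul C

/-- Consecutive powers differ by `(1 - G) * G ^ n`, which decays geometrically, so the powers form a
Cauchy sequence. The limit is fixed by `G` and is therefore idempotent. -/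
theorem IsVacuum.exists_tendsto (h : IsVacuum v G s w) :
    ∃ e, Tendsto (fun n => G ^ n) atTop (𝓝 e) ∧ star e = e ∧ e * e = e ∧
      (∀ z ∈ decayIdeal G s, z * e = 0) ∧ ∀ j, Commute (v (w j) j) e := by
  obtain ⟨C, hC⟩ := h.one_sub_mem
  have hr : s * ‖G‖ < 1 := (mul_le_of_le_one_right h.nonneg h.norm_le).trans_lt h.lt_one
  have hcau : CauchySeq fun n => G ^ n := by
    refine cauchySeq_of_le_geometric (s * ‖G‖) C hr fun n => ?_
    rw [dist_eq_norm, pow_succ']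
    have := hC n
    rwa [sub_mul, one_mul] at this
  obtain ⟨e, he⟩ := cauchySeq_tendsto_of_complete hcau
  have hz : ∀ z ∈ decayIdeal G s, z * e = 0 := fun z hz =>
    tendsto_nhds_unique (he.const_mul z) (h.tendsto_mul hz)
  have hGe : G * e = e := by
    have := hz _ h.one_sub_mem
    rw [sub_mul, one_mul, sub_eq_zero] at this
    exact this.symm
  have hGn : ∀ n : ℕ, G ^ n * e = e := fun n => by
    induction n with
    | zero => simp
    | succ n ih => rw [pow_succ, mul_assoc, hGe, ih]
  refine ⟨e, he, ?_, ?_, hz, fun j => ?_⟩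
  · refine tendsto_nhds_unique ((continuous_star.tendsto e).comp he) ?_
    simpa only [Function.comp_def, star_pow, h.star_eq] using he
  · refine tendsto_nhds_unique (he.mul_const e) ?_
    simp only [hGn]
    exact tendsto_const_nhds
  · refine tendsto_nhds_unique (he.const_mul _) ?_
    simp only [((h.comm j).pow_right _).eq]
    exact he.mul_const _

/-- A contraction as above whose powers tend to zero vanishes. -/
theorem IsVacuum.eq_zero (h : IsVacuum v G s w) (h0 : Tendsto (fun n => G ^ n) atTop (𝓝 0)) :
    G = 0 := by
  by_contra hG
  have hG0 : 0 < ‖G‖ := norm_pos_iff.2 hG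
  have hsa : IsSelfAdjoint G := h.star_eq
  have hsub : Tendsto (fun k : ℕ => 2 ^ k) atTop atTop :=
    tendsto_pow_atTop_atTop_of_one_lt (by norm_num : (1 : ℕ) < 2)
  -- For self-adjoint `G` one has `‖G ^ (2 ^ k)‖ = ‖G‖ ^ (2 ^ k)`, so norm one is incompatible with
  -- powers tending to zero. For this reason only exponents `2 ^ k` are used below.
  have hlt : ‖G‖ < 1 := by
    refine h.norm_le.lt_of_ne fun h1 => ?_
    have := (h0.norm.comp hsub)
    simp only [Function.comp_def, hsa.norm_pow_two_pow, h1, one_pow, norm_zero] at this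
    exact one_ne_zero (tendsto_nhds_unique tendsto_const_nhds this)
  obtain ⟨C, hC⟩ := h.one_sub_mem
  obtain ⟨u, hu⟩ := isUnit_one_sub_of_norm_lt_one hlt
  -- As `1 - G` is invertible, the decay of `(1 - G) * G ^ n` passes to `G ^ n` itself. Dividing by
  -- `‖G‖ ^ (2 ^ k)` leaves a lower bound for a sequence that tends to zero.
  have hle : ∀ k : ℕ, 1 ≤ ‖(↑u⁻¹ : B)‖ * C * s ^ 2 ^ k := fun k => by
    have e1 : G ^ 2 ^ k = ↑u⁻¹ * ((1 - G) * G ^ 2 ^ k) := by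
      rw [← hu, ← mul_assoc, Units.inv_mul, one_mul]
    have e2 : ‖G‖ ^ 2 ^ k ≤ ‖(↑u⁻¹ : B)‖ * (C * (s * ‖G‖) ^ 2 ^ k) := by
      rw [← hsa.norm_pow_two_pow]
      conv_lhs => rw [e1]
      exact (norm_mul_le _ _).trans (mul_le_mul_of_nonneg_left (hC _) (norm_nonneg _))
    rw [mul_pow, ← mul_assoc, ← mul_assoc] at e2
    exact le_of_mul_le_mul_right (by rwa [one_mul]) (pow_pos hG0 _)
  have ht : Tendsto (fun k : ℕ => ‖(↑u⁻¹ : B)‖ * C * s ^ 2 ^ k) atTop (𝓝 0) := by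
    simpa using ((tendsto_pow_atTop_nhds_zero_of_lt_one h.nonneg h.lt_one).comp hsub).const_mul
      (‖(↑u⁻¹ : B)‖ * C)
  exact absurd (ge_of_tendsto' ht hle) (by norm_num)

end Vacuum

/-! ### Annihilator ideals modulo a closed ideal, and semiprimeness -/

section Annihilators

set_option linter.unusedSectionVars false

variable {A : Type u} [CStarAlgebra A] (I : Ideal A) [I.IsTwoSided]

/-- The ideal of all `y` with `x A y ⊆ I`. -/
def rightAnn (x : A) : Ideal A where
  carrier := {y | ∀ b, x * b * y ∈ I}
  add_mem' ha hb b := by rw [mul_add]; exact I.add_mem (ha b) (hb b)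
  zero_mem' b := by rw [mul_zero]; exact I.zero_mem
  smul_mem' c y hy b := by
    have := hy (b * c)
    rwa [← mul_assoc, mul_assoc] at this

instance (x : A) : (rightAnn I x).IsTwoSided where
  mul_mem_of_left {y} c hy b := by
    rw [← mul_assoc]; exact I.mul_mem_right _ (hy b)

/-- The ideal of all `y` with `y A x ⊆ I`. -/
def leftAnn (x : A) : Ideal A where
  carrier := {y | ∀ b, y * b * x ∈ I}
  add_mem' ha hb b := by rw [add_mul, add_mul]; exact I.add_mem (ha b) (hb b)
  zero_mem' b := by rw [zero_mul, zero_mul]; exact I.zero_mem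
  smul_mem' c y hy b := by
    rw [smul_eq_mul, mul_assoc c, mul_assoc c]; exact I.mul_mem_left _ (hy b)

instance (x : A) : (leftAnn I x).IsTwoSided where
  mul_mem_of_left {y} c hy b := by
    have := hy (c * b)
    rwa [← mul_assoc] at this

variable {I}

theorem isClosed_rightAnn (hI : IsClosed (I : Set A)) (x : A) :
    IsClosed (rightAnn I x : Set A) := by
  have : (rightAnn I x : Set A) = ⋂ b, (fun y => x * b * y) ⁻¹' I := by
    ext y; simp only [Set.mem_iInter]; rfl
  rw [this]
  exact isClosed_iInter fun b => hI.preimage (by fun_prop)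

theorem isClosed_leftAnn (hI : IsClosed (I : Set A)) (x : A) :
    IsClosed (leftAnn I x : Set A) := by
  have : (leftAnn I x : Set A) = ⋂ b, (fun y => y * b * x) ⁻¹' I := by
    ext y; simp only [Set.mem_iInter]; rfl
  rw [this]
  exact isClosed_iInter fun b => hI.preimage (by fun_prop)

theorem le_rightAnn (x : A) : I ≤ rightAnn I x := fun _ hy _ => I.mul_mem_left _ hy

theorem le_leftAnn (x : A) : I ≤ leftAnn I x := fun _ hy _ =>
  I.mul_mem_right _ (I.mul_mem_right _ hy)

/-- Closed two-sided ideals of C*-algebras are semiprime. -/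
theorem mem_of_mem_rightAnn (hI : IsClosed (I : Set A)) {x : A} (hx : x ∈ rightAnn I x) : x ∈ I := by
  have h1 : star x * x ∈ I := by
    refine mem_of_star_mul_self_mem I hI ?_
    have := I.mul_mem_left (star x) (hx (star x))
    simpa only [star_mul, star_star, mul_assoc] using this
  exact mem_of_star_mul_self_mem I hI h1

end Annihilators

/-! ### The inductive step: elements killed by a model annihilate the vacuum element -/

section Step

open Filter Topology

variable {q : ℝ}

theorem map_gen_isSUqThree {B : Type u} [CStarAlgebra B] (f : CSUqThree q →⋆ₐ[ℂ] B) :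
    IsSUqThree q ((gen q).map f) := by
  refine ⟨Unitary.mem_iff.2 ⟨?_, ?_⟩, fun a b c => ?_⟩
  · ext i j
    have := congrArg f ((isSUqThree_gen q).sum_star_mul i j)
    simp only [map_sum, map_mul, map_star, apply_ite f, map_one, map_zero] at this
    rw [Matrix.mul_apply, Matrix.one_apply]
    exact this
  · ext i j
    have := congrArg f ((isSUqThree_gen q).sum_mul_star i j)
    simp only [map_sum, map_mul, map_star, apply_ite f, map_one, map_zero] at this
    rw [Matrix.mul_apply, Matrix.one_apply]
    exact this
  · have := congrArg f ((isSUqThree_gen q).det a b c)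
    simp only [map_sum, map_smul, map_mul, map_one] at this
    exact this

/-- A word need not be gauge invariant, but it is an eigenvector with unimodular eigenvalue, which
cancels against its conjugate. This makes the compression argument available for `x` times an
arbitrary word. -/
theorem star_word_mul_mem {x : CSUqThree q} (hx : x ∈ flagAlgebra q) (l : List (Fin 3 × Fin 3)) :
    star (x * word (gen q) l) * (x * word (gen q) l) ∈ flagAlgebra q := fun z₁ z₂ => by
  have hx' : gauge q z₁ z₂ x = x := hx z₁ z₂
  rw [map_mul, map_star, map_mul, hx', gauge_word, mul_smul_comm, star_smul,
    smul_mul_smul_comm]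
  convert one_smul ℂ _
  rw [Complex.star_def, Complex.conj_mul', norm_mul, norm_mul, norm_pow, norm_pow, norm_pow,
    Circle.norm_coe, Circle.norm_coe, Circle.norm_coe]
  simp

variable {Z : Set (Fin 3 × Fin 3)} {g : CSUqThree q} {s : ℝ} {w : Fin 3 → Fin 3}

/-- If `g` defines a vacuum projection whenever the entries at the positions in `Z` vanish, and this
projection is nonzero in `B₀`, then an element of the fixed point algebra which vanishes in `B₀`
annihilates `g` modulo every closed ideal that contains the entries at the positions in `Z`. -/
theorem mul_mul_mem_of_isVacuum (hq : 0 < q)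
    (hvac : ∀ (B : Type 1) [CStarAlgebra B] (f : CSUqThree q →⋆ₐ[ℂ] B),
      (∀ p ∈ Z, f (gen q p.1 p.2) = 0) → IsVacuum ((gen q).map f) (f g) s w)
    (I : Ideal (CSUqThree q)) [I.IsTwoSided] (hI : IsClosed (I : Set (CSUqThree q)))
    (hZ : ∀ p ∈ Z, gen q p.1 p.2 ∈ I)
    {B₀ : Type} [CStarAlgebra B₀] (f₀ : CSUqThree q →⋆ₐ[ℂ] B₀)
    (hZ₀ : ∀ p ∈ Z, f₀ (gen q p.1 p.2) = 0) (h₀ : ¬ Tendsto (fun n => f₀ g ^ n) atTop (𝓝 0))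
    {x : CSUqThree q} (hx : x ∈ flagAlgebra q) (hx₀ : f₀ x = 0) :
    g ∈ rightAnn I x := by
  obtain ⟨B, _, f, hf, hker⟩ := exists_quotient I hI
  -- In the product a single scalar describes the compression in both components. Since the vacuum
  -- `e₀` of the model is nonzero, this scalar vanishes whenever `f₀ z` does.
  let F : CSUqThree q →⋆ₐ[ℂ] B × B₀ := f.prod f₀
  have hF : ∀ y, F y = (f y, f₀ y) := fun _ => rfl
  have hvF := hvac (B × B₀) F fun p hp => by
    rw [hF, (hker _).2 (hZ p hp), hZ₀ p hp]; rfl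
  obtain ⟨⟨e, e₀⟩, he, hse, hee, hze, hce⟩ := hvF.exists_tendsto
  have hFn : ∀ n, F g ^ n = (f g ^ n, f₀ g ^ n) := fun _ => rfl
  have he1 : Tendsto (fun n => f g ^ n) atTop (𝓝 e) := (continuous_fst.tendsto _).comp he
  have he2 : Tendsto (fun n => f₀ g ^ n) atTop (𝓝 e₀) := (continuous_snd.tendsto _).comp he
  have he0 : e₀ ≠ 0 := fun h => h₀ (h ▸ he2)
  have hse1 : star e = e := congrArg Prod.fst hse
  -- compression of the fixed point algebra
  have hcomp : ∀ z ∈ flagAlgebra q, ∃ c : ℂ, (e, e₀) * F z * (e, e₀) = c • (e, e₀) := by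
    intro z hz
    let L : CSUqThree q →ₗ[ℂ] B × B₀ :=
      (LinearMap.mulLeft ℂ (e, e₀)).comp ((LinearMap.mulRight ℂ (e, e₀)).comp
        F.toAlgHom.toLinearMap)
    have hL : ∀ y, L y = (e, e₀) * F y * (e, e₀) := fun y => (mul_assoc _ _ _).symm
    have hLc : Continuous L := by
      have : Continuous fun y => (e, e₀) * F y * (e, e₀) := by
        have := continuous_starAlgHom F
        fun_prop
      exact this.congr fun y => (hL y).symm
    have hcl : IsClosed ((Submodule.span ℂ {((e, e₀) : B × B₀)}).comap L : Set (CSUqThree q)) :=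
      (Submodule.closed_of_finiteDimensional (Submodule.span ℂ {((e, e₀) : B × B₀)})).preimage hLc
    have hent : ∀ i j, ((gen q).map F) i j * (e, e₀) = 0 ∨ (e, e₀) * ((gen q).map F) i j = 0 ∨
        i = w j := fun i j => by
      rcases hvF.entry i j with h | h | h
      · exact Or.inl (hze _ h)
      · have := congrArg star (hze _ h)
        rw [star_mul, star_star, star_zero, hse] at this
        exact Or.inr (Or.inl this)
      · exact Or.inr (Or.inr h)
    have hdet := (map_gen_isSUqThree F).det 0 1 2
    rw [show twistedE q 0 1 2 = 1 by simp [twistedE, inversions], one_smul] at hdet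
    have hmem := mem_of_balanced_mem hq.ne' _ hcl (fun n l hl => by
      obtain ⟨c, hc⟩ := exists_compress_eq ((map_gen_isSUqThree F).exchange hq) hdet w hee hce
        hent hl
      rw [Submodule.mem_comap, hL, map_word, hc]
      exact Submodule.smul_mem _ _ (Submodule.mem_span_singleton_self _)) hz
    obtain ⟨c, hc⟩ := Submodule.mem_span_singleton.1 hmem
    exact ⟨c, by rw [← hL, hc]⟩
  have hzero : ∀ z ∈ flagAlgebra q, f₀ z = 0 → e * f z * e = 0 := fun z hz hz0 => by
    obtain ⟨c, hc⟩ := hcomp z hz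
    have h1 : e * f z * e = c • e := congrArg Prod.fst hc
    have h2 : e₀ * f₀ z * e₀ = c • e₀ := congrArg Prod.snd hc
    rw [hz0, mul_zero, zero_mul] at h2
    rw [h1, (smul_eq_zero.1 h2.symm).resolve_right he0, zero_smul]
  -- For a word `y`, the element `f (x * y) * e` vanishes because `e * f (star (x * y) * (x * y)) *
  -- e` does; density of the words gives all `y`.
  have hann : ∀ y, f (x * y) * e = 0 := by
    intro y
    let L : CSUqThree q →ₗ[ℂ] B := (LinearMap.mulRight ℂ e).comp
        (f.toAlgHom.toLinearMap.comp (LinearMap.mulLeft ℂ x))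
    have hL : ∀ y, L y = f (x * y) * e := fun y => rfl
    have hLc : Continuous L := by
      have : Continuous fun y => f (x * y) * e := by
        have := continuous_starAlgHom f
        fun_prop
      exact this
    refine mem_of_word_mem hq.ne' (LinearMap.ker L) (isClosed_singleton.preimage hLc) (fun l => ?_) y
    rw [LinearMap.mem_ker, hL, ← CStarRing.star_mul_self_eq_zero_iff, star_mul, hse1, ← map_star]
    have := hzero _ (star_word_mul_mem hx l) (by rw [map_mul, map_mul, hx₀, zero_mul, mul_zero])
    rw [map_mul f (star _)] at this
    simpa only [mul_assoc] using this
  obtain ⟨E, hE⟩ := hf e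
  have hEJ : E ∈ rightAnn I x := fun b => by
    rw [← hker, map_mul, hE]; exact hann b
  -- In the quotient by the annihilator the powers of the vacuum element tend to the image of `e`,
  -- which is zero there; hence the vacuum element itself vanishes.
  obtain ⟨C, _, p, hp, hkp⟩ := exists_quotient (rightAnn I x) (isClosed_rightAnn hI x)
  obtain ⟨k, hk⟩ := exists_factor f hf p fun y hy => (hkp y).2 (le_rightAnn x ((hker y).1 hy))
  have hvp := hvac C p fun i hi => (hkp _).2 (le_rightAnn x (hZ i hi))
  refine (hkp g).1 (hvp.eq_zero ?_)
  have := ((continuous_starAlgHom k).tendsto e).comp he1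
  simp only [Function.comp_def, map_pow, hk] at this
  rwa [← hE, hk, (hkp E).2 hEJ] at this

end Step

/-! ### Vacuum elements for the quotients in which some entries vanish -/

section Strata

variable {q : ℝ} {B : Type u} [CStarAlgebra B] {v : Matrix (Fin 3) (Fin 3) B}

theorem forall_fin_three {P : Fin 3 → Fin 3 → Prop} (h₀₀ : P 0 0) (h₀₁ : P 0 1) (h₀₂ : P 0 2)
    (h₁₀ : P 1 0) (h₁₁ : P 1 1) (h₁₂ : P 1 2) (h₂₀ : P 2 0) (h₂₁ : P 2 1) (h₂₂ : P 2 2) :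
    ∀ i j, P i j := by
  intro i j
  fin_cases i <;> fin_cases j <;> assumption

/-! ### Entries which commute with all entries up to scalars -/

theorem eq_inv_smul {x y : B} (hq : q ≠ 0) (h : x = (q : ℂ) • y) : y = ((q⁻¹ : ℝ) : ℂ) • x := by
  have hq' : (q : ℂ) ≠ 0 := by exact_mod_cast hq
  rw [h, Complex.ofReal_inv, inv_smul_smul₀ hq']

theorem eq_one_smul {x y : B} (h : x = y) : x = ((1 : ℝ) : ℂ) • y := by simp [h]

/-- A corner on the antidiagonal never forms a diagonal pair with another entry, so no correction
term of `IsSUqThree.cross` occurs. The scalar is split into a row and a column factor, as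
`IsSUqThree.star_scaled` requires. -/
theorem IsSUqThree.scaled_lower_left (hv : IsSUqThree q v) (hq : 0 < q) :
    ∀ i j, v 2 0 * v i j = ((![1, 1, q] i * ![q⁻¹, 1, 1] j : ℝ) : ℂ) • (v i j * v 2 0) := by
  refine forall_fin_three ?_ ?_ ?_ ?_ ?_ ?_ ?_ ?_ ?_ <;>
    simp only [Matrix.cons_val, one_mul, mul_one, mul_inv_cancel₀ hq.ne']
  · exact eq_inv_smul hq.ne' (hv.col_comm hq.ne' 0 (by decide))
  · exact eq_one_smul (hv.cross hq (by decide) (by decide)).1.symm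
  · exact eq_one_smul (hv.cross hq (by decide) (by decide)).1.symm
  · exact eq_inv_smul hq.ne' (hv.col_comm hq.ne' 0 (by decide))
  · exact eq_one_smul (hv.cross hq (by decide) (by decide)).1.symm
  · exact eq_one_smul (hv.cross hq (by decide) (by decide)).1.symm
  · exact eq_one_smul rfl
  · exact hv.row_comm hq.ne' 2 (by decide)
  · exact hv.row_comm hq.ne' 2 (by decide)

theorem IsSUqThree.scaled_upper_right (hv : IsSUqThree q v) (hq : 0 < q) :
    ∀ i j, v 0 2 * v i j = ((![q⁻¹, 1, 1] i * ![1, 1, q] j : ℝ) : ℂ) • (v i j * v 0 2) := by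
  refine forall_fin_three ?_ ?_ ?_ ?_ ?_ ?_ ?_ ?_ ?_ <;>
    simp only [Matrix.cons_val, one_mul, mul_one, inv_mul_cancel₀ hq.ne']
  · exact eq_inv_smul hq.ne' (hv.row_comm hq.ne' 0 (by decide))
  · exact eq_inv_smul hq.ne' (hv.row_comm hq.ne' 0 (by decide))
  · exact eq_one_smul rfl
  · exact eq_one_smul (hv.cross hq (by decide) (by decide)).1
  · exact eq_one_smul (hv.cross hq (by decide) (by decide)).1
  · exact hv.col_comm hq.ne' 2 (by decide)
  · exact eq_one_smul (hv.cross hq (by decide) (by decide)).1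
  · exact eq_one_smul (hv.cross hq (by decide) (by decide)).1
  · exact hv.col_comm hq.ne' 2 (by decide)

theorem IsSUqThree.cross_of_eq_zero (hv : IsSUqThree q v) (hq : 0 < q) {i k a b : Fin 3}
    (hik : i < k) (hab : a < b) (h : v i b = 0 ∨ v k a = 0) : v i a * v k b = v k b * v i a := by
  rw [(hv.cross hq hik hab).2]
  rcases h with h | h <;> rw [h] <;> simp

/-- The only possible corrections, from the entries `(1, 2)` and `(2, 2)`, contain the factor `v 0
2`. -/
theorem IsSUqThree.scaled_first (hv : IsSUqThree q v) (hq : 0 < q) (h : v 0 2 = 0) :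
    ∀ i j, v 0 1 * v i j = ((![q⁻¹, 1, 1] i * ![1, q, 1] j : ℝ) : ℂ) • (v i j * v 0 1) := by
  refine forall_fin_three ?_ ?_ ?_ ?_ ?_ ?_ ?_ ?_ ?_ <;>
    simp only [Matrix.cons_val, one_mul, mul_one, inv_mul_cancel₀ hq.ne']
  · exact eq_inv_smul hq.ne' (hv.row_comm hq.ne' 0 (by decide))
  · exact eq_one_smul rfl
  · simp [h]
  · exact eq_one_smul (hv.cross hq (by decide) (by decide)).1
  · exact hv.col_comm hq.ne' 1 (by decide)
  · exact eq_one_smul (hv.cross_of_eq_zero hq (by decide) (by decide) (Or.inl h))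
  · exact eq_one_smul (hv.cross hq (by decide) (by decide)).1
  · exact hv.col_comm hq.ne' 1 (by decide)
  · exact eq_one_smul (hv.cross_of_eq_zero hq (by decide) (by decide) (Or.inl h))

theorem IsSUqThree.scaled_second (hv : IsSUqThree q v) (hq : 0 < q) (h : v 0 2 = 0) :
    ∀ i j, v 1 2 * v i j = ((![1, q⁻¹, 1] i * ![1, 1, q] j : ℝ) : ℂ) • (v i j * v 1 2) := by
  refine forall_fin_three ?_ ?_ ?_ ?_ ?_ ?_ ?_ ?_ ?_ <;>
    simp only [Matrix.cons_val, one_mul, mul_one, inv_mul_cancel₀ hq.ne']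
  · exact eq_one_smul (hv.cross_of_eq_zero hq (by decide) (by decide) (Or.inl h)).symm
  · exact eq_one_smul (hv.cross_of_eq_zero hq (by decide) (by decide) (Or.inl h)).symm
  · simp [h]
  · exact eq_inv_smul hq.ne' (hv.row_comm hq.ne' 1 (by decide))
  · exact eq_inv_smul hq.ne' (hv.row_comm hq.ne' 1 (by decide))
  · exact eq_one_smul rfl
  · exact eq_one_smul (hv.cross hq (by decide) (by decide)).1
  · exact eq_one_smul (hv.cross hq (by decide) (by decide)).1
  · exact hv.col_comm hq.ne' 2 (by decide)

/-! ### Norm estimates -/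

-- The weighted orthogonality relation is a sum of positive elements, so each summand is bounded by
-- the total. These bounds are what make the vacuum elements contractions.
open scoped CStarAlgebra in
theorem IsSUqThree.norm_le_pow (hv : IsSUqThree q v) (hq : 0 < q) {j k : Fin 3} (h : j ≤ k) :
    ‖v j k‖ ≤ q ^ (k - j : ℕ) := by
  rcases subsingleton_or_nontrivial B with hB | hB
  · rw [Subsingleton.elim (v j k) 0, norm_zero]; positivity
  let _ : PartialOrder B := CStarAlgebra.spectralOrder B
  have _ : StarOrderedRing B := CStarAlgebra.spectralOrderedRing B
  have h1 := hv.weighted hq.ne' j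
  have e : ∀ l : Fin 3, ((q : ℂ) ^ (2 * (2 - l : ℕ))) • (star (v j l) * v j l)
      = star (((q : ℂ) ^ (2 - l : ℕ)) • v j l) * (((q : ℂ) ^ (2 - l : ℕ)) • v j l) := fun l => by
    rw [star_smul, smul_mul_smul_comm]
    congr 1
    rw [Complex.star_def, map_pow, Complex.conj_ofReal, ← pow_add, two_mul]
  have h2 : star (((q : ℂ) ^ (2 - k : ℕ)) • v j k) * (((q : ℂ) ^ (2 - k : ℕ)) • v j k)
      ≤ ((q : ℂ) ^ (2 * (2 - j : ℕ))) • (1 : B) := by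
    rw [← h1]
    simp only [e]
    exact Finset.single_le_sum
      (f := fun l : Fin 3 => star (((q : ℂ) ^ (2 - l : ℕ)) • v j l) * (((q : ℂ) ^ (2 - l : ℕ)) • v j l))
      (fun l _ => star_mul_self_nonneg _) (Finset.mem_univ k)
  have h3 := CStarAlgebra.norm_le_norm_of_nonneg_of_le (star_mul_self_nonneg _) h2
  rw [CStarRing.norm_star_mul_self, norm_smul, norm_smul, norm_one, norm_pow, norm_pow,
    Complex.norm_real, Real.norm_of_nonneg hq.le, mul_one, two_mul, pow_add] at h3
  have h4 : q ^ (2 - k : ℕ) * ‖v j k‖ ≤ q ^ (2 - j : ℕ) :=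
    abs_le_of_sq_le_sq' (by nlinarith) (by positivity) |>.2
  have h5 : (2 - j : ℕ) = (2 - k) + (k - j) := by
    have : (j : ℕ) ≤ k := h
    omega
  rw [h5, pow_add] at h4
  exact le_of_mul_le_mul_left h4 (by positivity)

theorem IsSUqThree.norm_le_one' (hv : IsSUqThree q v) (i j : Fin 3) : ‖v i j‖ ≤ 1 := by
  rcases subsingleton_or_nontrivial B with hB | hB
  · rw [Subsingleton.elim (v i j) 0, norm_zero]; positivity
  · exact hv.norm_le_one i j

/-! ### The vacuum element of a normal entry -/

/-- The element `ρ⁻² n* n`. -/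
def vacuumElement (ρ : ℝ) (n : B) : B := ((ρ ^ 2)⁻¹ : ℝ) • (star n * n)

variable {n : B} {r s : Fin 3 → ℝ} {ρ : ℝ} {i j : Fin 3}

theorem star_vacuumElement : star (vacuumElement ρ n) = vacuumElement ρ n := by
  simp [vacuumElement]

theorem norm_vacuumElement_le (hρ : 0 < ρ) (h : ‖n‖ ≤ ρ) : ‖vacuumElement ρ n‖ ≤ 1 := by
  rw [vacuumElement, norm_smul, CStarRing.norm_star_mul_self, Real.norm_of_nonneg (by positivity),
    inv_mul_le_iff₀ (by positivity), mul_one, sq]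
  exact mul_self_le_mul_self (norm_nonneg _) h

/-- Both `n` and `star n` commute with `v i j` up to the same scalar, so `star n * n` picks up its
square. Entries with scalar at least `q⁻¹` thus act as lowering operators for the vacuum element,
and those with scalar 1 commute with it. -/
theorem IsSUqThree.mul_vacuumElement (hv : IsSUqThree q v) (hr : ∀ i, r i ≠ 0) (hs : ∀ j, s j ≠ 0)
    (h : ∀ i j, n * v i j = ((r i * s j : ℝ) : ℂ) • (v i j * n)) :
    v i j * vacuumElement ρ n = ((((r i * s j)⁻¹) ^ 2 : ℝ) : ℂ) • (vacuumElement ρ n * v i j) := by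
  have h0 : ((r i * s j : ℝ) : ℂ) ≠ 0 := by exact_mod_cast mul_ne_zero (hr i) (hs j)
  have h1 : star n * n * v i j = (((r i * s j : ℝ) : ℂ) ^ 2) • (v i j * (star n * n)) := by
    rw [mul_assoc, h, mul_smul_comm, ← mul_assoc, hv.star_scaled hr hs h, smul_mul_assoc, smul_smul,
      sq, mul_assoc]
  rw [vacuumElement, mul_smul_comm, smul_mul_assoc, h1, smul_comm]
  congr 1
  rw [smul_smul, Complex.ofReal_pow, Complex.ofReal_inv, ← mul_pow, inv_mul_cancel₀ h0, one_pow,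
    one_smul]

theorem IsSUqThree.mem_decayIdeal (hv : IsSUqThree q v) (hr : ∀ i, r i ≠ 0) (hs : ∀ j, s j ≠ 0)
    (h : ∀ i j, n * v i j = ((r i * s j : ℝ) : ℂ) • (v i j * n)) (i j : Fin 3)
    (hle : |(r i * s j)⁻¹| ≤ q) : v i j ∈ decayIdeal (vacuumElement ρ n) (q ^ 2) := by
  refine QuantumFlag.mem_decayIdeal (hv.mul_vacuumElement hr hs h) ?_
  rw [abs_pow]
  exact pow_le_pow_left₀ (abs_nonneg _) hle 2

theorem IsSUqThree.commute_vacuumElement (hv : IsSUqThree q v) (hr : ∀ i, r i ≠ 0)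
    (hs : ∀ j, s j ≠ 0) (h : ∀ i j, n * v i j = ((r i * s j : ℝ) : ℂ) • (v i j * n)) (i j : Fin 3)
    (h1 : r i * s j = 1) : Commute (v i j) (vacuumElement ρ n) := by
  have := hv.mul_vacuumElement (ρ := ρ) (i := i) (j := j) hr hs h
  rw [h1] at this
  exact this.trans (by simp)

theorem mem_of_smul_eq {J : Ideal B} {c d : ℂ} {x y : B} (hc : c ≠ 0) (h : c • x = d • y)
    (hy : y ∈ J) : x ∈ J := by
  rw [← inv_smul_smul₀ hc x, h]
  exact J.smul_of_tower_mem _ (J.smul_of_tower_mem _ hy)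

/-- The adjoint entry is a quantum minor; reordering its products by `IsSUqThree.cross` puts a
factor from the left ideal `J` on the right. In this way raising entries are recognised from the
lowering ones. -/
theorem IsSUqThree.star_mem (hv : IsSUqThree q v) (hq : 0 < q) {J : Ideal B} (j k : Fin 3)
    (h₁ : v (fstOther j) (fstOther k) ∈ J)
    (h₂ : v (fstOther j) (sndOther k) ∈ J ∨ v (sndOther j) (fstOther k) ∈ J) :
    star (v j k) ∈ J := by
  have lt : ∀ j : Fin 3, fstOther j < sndOther j := by decide
  obtain ⟨c1, c2⟩ := hv.cross hq (lt j) (lt k)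
  refine mem_of_smul_eq (pow_ne_zero _ (neg_ofReal_ne_zero hq.ne')) (hv.cofactor j k) ?_
  have h3 : v (fstOther j) (sndOther k) * v (sndOther j) (fstOther k) ∈ J := by
    rcases h₂ with h | h
    · rw [c1]; exact J.mul_mem_left _ h
    · exact J.mul_mem_left _ h
  rw [c2]
  exact J.sub_mem (J.add_mem (J.mul_mem_left _ h₁) (J.smul_of_tower_mem _ h3))
    (J.smul_of_tower_mem _ h3)

theorem IsSUqThree.star_mem' (hv : IsSUqThree q v) (hq : 0 < q) {J : Ideal B} (j k : Fin 3)
    (h₁ : v (sndOther j) (sndOther k) ∈ J) (h₂ : v (sndOther j) (fstOther k) ∈ J) :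
    star (v j k) ∈ J := by
  refine mem_of_smul_eq (pow_ne_zero _ (neg_ofReal_ne_zero hq.ne')) (hv.cofactor j k) ?_
  exact J.sub_mem (J.mul_mem_left _ h₁) (J.smul_of_tower_mem _ (J.mul_mem_left _ h₂))

theorem IsSUqThree.weighted_real (hv : IsSUqThree q v) (hq : 0 < q) (j : Fin 3) :
    q ^ 4 • (star (v j 0) * v j 0) + q ^ 2 • (star (v j 1) * v j 1) + star (v j 2) * v j 2
      = q ^ (2 * (2 - j : ℕ)) • (1 : B) := by
  have h := hv.weighted hq.ne' j
  simp only [Fin.sum_univ_three, ← Complex.ofReal_pow, Complex.coe_smul] at h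
  simpa using h

theorem IsSUqThree.weighted_zero (hv : IsSUqThree q v) (hq : 0 < q) :
    star (v 0 0) * v 0 0 + ((q ^ 2)⁻¹ : ℝ) • (star (v 0 1) * v 0 1)
      + (((q ^ 2) ^ 2)⁻¹ : ℝ) • (star (v 0 2) * v 0 2) = 1 := by
  have h4 : q ^ 4 ≠ 0 := by positivity
  refine smul_right_injective B h4 ?_
  refine Eq.trans ?_ (hv.weighted_real hq 0)
  simp only [smul_add, smul_smul]
  congr 2
  · congr 1; field_simp
  · convert one_smul ℝ _
    field_simp

theorem IsSUqThree.weighted_one (hv : IsSUqThree q v) (hq : 0 < q) (h₀ : v 1 0 = 0) :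
    star (v 1 1) * v 1 1 + ((q ^ 2)⁻¹ : ℝ) • (star (v 1 2) * v 1 2) = 1 := by
  have h2 : q ^ 2 ≠ 0 := by positivity
  refine smul_right_injective B h2 ?_
  refine Eq.trans ?_ (hv.weighted_real hq 1)
  simp [h₀, smul_add, smul_smul, mul_inv_cancel₀ h2]

theorem IsSUqThree.col_zero (hv : IsSUqThree q v) :
    star (v 0 0) * v 0 0 + star (v 1 0) * v 1 0 + star (v 2 0) * v 2 0 = 1 := by
  simpa [Fin.sum_univ_three] using hv.sum_star_mul 0 0

theorem star_mul_self_mem {J : Ideal B} {x : B} (h : x ∈ J) : star x * x ∈ J := J.mul_mem_left _ h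

section Vacua

/-- The weighted relation of row 0 expresses `1 - G` by the lowering entries `(0, 0)` and `(0, 1)`.
The permutation marks the entries that act diagonally in the model `V₁₂ V₂₃`. -/
theorem IsSUqThree.isVacuum₂₁ (hv : IsSUqThree q v) (hq : 0 < q) (hq1 : q < 1) (h₂₀ : v 2 0 = 0) :
    IsVacuum v (vacuumElement (q ^ 2) (v 0 2)) (q ^ 2) ![1, 2, 0] := by
  have hr : ∀ i, ![q⁻¹, 1, 1] i ≠ 0 := by simp [Fin.forall_fin_succ, hq.ne']
  have hs : ∀ i, ![1, 1, q] i ≠ 0 := by simp [Fin.forall_fin_succ, hq.ne']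
  have hsc := hv.scaled_upper_right hq
  set G := vacuumElement (q ^ 2) (v 0 2) with hG
  have m := fun i j hle => hv.mem_decayIdeal (ρ := q ^ 2) hr hs hsc i j hle
  have c := fun i j h1 => hv.commute_vacuumElement (ρ := q ^ 2) hr hs hsc i j h1
  have m00 : v 0 0 ∈ decayIdeal G (q ^ 2) := m 0 0 (by simp [abs_of_pos hq])
  have m01 : v 0 1 ∈ decayIdeal G (q ^ 2) := m 0 1 (by simp [abs_of_pos hq])
  have m20 : v 2 0 ∈ decayIdeal G (q ^ 2) := h₂₀ ▸ Submodule.zero_mem _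
  refine ⟨star_vacuumElement, norm_vacuumElement_le (by positivity) (hv.norm_le_pow hq (by decide)),
    by positivity, pow_lt_one₀ hq.le hq1 two_ne_zero, ?_, ?_, ?_⟩
  · have : 1 - G = star (v 0 0) * v 0 0 + ((q ^ 2)⁻¹ : ℝ) • (star (v 0 1) * v 0 1) := by
      rw [← hv.weighted_zero hq, hG, vacuumElement, add_sub_cancel_right]
    rw [this]
    exact Ideal.add_mem _ (star_mul_self_mem m00)
      (Submodule.smul_of_tower_mem _ _ (star_mul_self_mem m01))
  · refine forall_fin_three (Or.inl m00) (Or.inl m01) (Or.inr (Or.inr rfl)) (Or.inr (Or.inr rfl))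
      (Or.inr (Or.inl ?_)) (Or.inr (Or.inl ?_)) (Or.inl m20) (Or.inr (Or.inr rfl))
      (Or.inr (Or.inl ?_))
    · exact hv.star_mem hq 1 1 m00 (Or.inr m20)
    · exact hv.star_mem hq 1 2 m00 (Or.inl m01)
    · exact hv.star_mem hq 2 2 m00 (Or.inl m01)
  · intro j
    fin_cases j
    · exact c 1 0 (by simp)
    · exact c 2 1 (by simp)
    · exact c 0 2 (by simp [hq.ne'])

/-- Here plain unitarity of column 0 takes the place of the weighted relation, so the normalising
constant is 1. -/
theorem IsSUqThree.isVacuum₂₂ (hv : IsSUqThree q v) (hq : 0 < q) (hq1 : q < 1) (h₀₂ : v 0 2 = 0) :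
    IsVacuum v (vacuumElement 1 (v 2 0)) (q ^ 2) ![2, 0, 1] := by
  have hr : ∀ i, ![1, 1, q] i ≠ 0 := by simp [Fin.forall_fin_succ, hq.ne']
  have hs : ∀ i, ![q⁻¹, 1, 1] i ≠ 0 := by simp [Fin.forall_fin_succ, hq.ne']
  have hsc := hv.scaled_lower_left hq
  set G := vacuumElement 1 (v 2 0) with hG
  have m := fun i j hle => hv.mem_decayIdeal (ρ := 1) hr hs hsc i j hle
  have c := fun i j h1 => hv.commute_vacuumElement (ρ := 1) hr hs hsc i j h1
  have m00 : v 0 0 ∈ decayIdeal G (q ^ 2) := m 0 0 (by simp [abs_of_pos hq])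
  have m10 : v 1 0 ∈ decayIdeal G (q ^ 2) := m 1 0 (by simp [abs_of_pos hq])
  have m02 : v 0 2 ∈ decayIdeal G (q ^ 2) := h₀₂ ▸ Submodule.zero_mem _
  refine ⟨star_vacuumElement, norm_vacuumElement_le (by positivity) (hv.norm_le_one' _ _),
    by positivity, pow_lt_one₀ hq.le hq1 two_ne_zero, ?_, ?_, ?_⟩
  · have : 1 - G = star (v 0 0) * v 0 0 + star (v 1 0) * v 1 0 := by
      rw [← hv.col_zero, hG, vacuumElement]
      simp
    rw [this]
    exact Ideal.add_mem _ (star_mul_self_mem m00) (star_mul_self_mem m10)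
  · refine forall_fin_three (Or.inl m00) (Or.inr (Or.inr rfl)) (Or.inl m02) (Or.inl m10)
      (Or.inr (Or.inl ?_)) (Or.inr (Or.inr rfl)) (Or.inr (Or.inr rfl)) (Or.inr (Or.inl ?_))
      (Or.inr (Or.inl ?_))
    · exact hv.star_mem hq 1 1 m00 (Or.inl m02)
    · exact hv.star_mem hq 2 1 m00 (Or.inl m02)
    · exact hv.star_mem hq 2 2 m00 (Or.inr m10)
  · intro j
    fin_cases j
    · exact c 2 0 (by simp [hq.ne'])
    · exact c 0 1 (by simp)
    · exact c 1 2 (by simp)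

theorem IsSUqThree.isVacuum₁₁ (hv : IsSUqThree q v) (hq : 0 < q) (hq1 : q < 1) (h₀₂ : v 0 2 = 0)
    (h₁₂ : v 1 2 = 0) (h₂₀ : v 2 0 = 0) (h₂₁ : v 2 1 = 0) :
    IsVacuum v (vacuumElement q (v 0 1)) (q ^ 2) ![1, 0, 2] := by
  have hr : ∀ i, ![q⁻¹, 1, 1] i ≠ 0 := by simp [Fin.forall_fin_succ, hq.ne']
  have hs : ∀ i, ![1, q, 1] i ≠ 0 := by simp [Fin.forall_fin_succ, hq.ne']
  have hsc := hv.scaled_first hq h₀₂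
  set G := vacuumElement q (v 0 1) with hG
  have m := fun i j hle => hv.mem_decayIdeal (ρ := q) hr hs hsc i j hle
  have c := fun i j h1 => hv.commute_vacuumElement (ρ := q) hr hs hsc i j h1
  have m00 : v 0 0 ∈ decayIdeal G (q ^ 2) := m 0 0 (by simp [abs_of_pos hq])
  have z : ∀ {x : B}, x = 0 → x ∈ decayIdeal G (q ^ 2) := fun h => h ▸ Submodule.zero_mem _
  refine ⟨star_vacuumElement, norm_vacuumElement_le (by positivity)
    (by simpa using hv.norm_le_pow hq (show (0 : Fin 3) ≤ 1 by decide)),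
    by positivity, pow_lt_one₀ hq.le hq1 two_ne_zero, ?_, ?_, ?_⟩
  · have : 1 - G = star (v 0 0) * v 0 0 := by
      rw [← hv.weighted_zero hq, hG, vacuumElement]
      simp [h₀₂]
    rw [this]
    exact star_mul_self_mem m00
  · exact forall_fin_three (Or.inl m00) (Or.inr (Or.inr rfl)) (Or.inl (z h₀₂)) (Or.inr (Or.inr rfl))
      (Or.inr (Or.inl (hv.star_mem hq 1 1 m00 (Or.inl (z h₀₂))))) (Or.inl (z h₁₂)) (Or.inl (z h₂₀))
      (Or.inl (z h₂₁)) (Or.inr (Or.inr rfl))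
  · intro j
    fin_cases j
    · exact c 1 0 (by simp)
    · exact c 0 1 (by simp [hq.ne'])
    · exact c 2 2 (by simp)

theorem IsSUqThree.isVacuum₁₂ (hv : IsSUqThree q v) (hq : 0 < q) (hq1 : q < 1) (h₀₂ : v 0 2 = 0)
    (h₀₁ : v 0 1 = 0) (h₂₀ : v 2 0 = 0) (h₁₀ : v 1 0 = 0) :
    IsVacuum v (vacuumElement q (v 1 2)) (q ^ 2) ![0, 2, 1] := by
  have hr : ∀ i, ![1, q⁻¹, 1] i ≠ 0 := by simp [Fin.forall_fin_succ, hq.ne']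
  have hs : ∀ i, ![1, 1, q] i ≠ 0 := by simp [Fin.forall_fin_succ, hq.ne']
  have hsc := hv.scaled_second hq h₀₂
  set G := vacuumElement q (v 1 2) with hG
  have m := fun i j hle => hv.mem_decayIdeal (ρ := q) hr hs hsc i j hle
  have c := fun i j h1 => hv.commute_vacuumElement (ρ := q) hr hs hsc i j h1
  have m11 : v 1 1 ∈ decayIdeal G (q ^ 2) := m 1 1 (by simp [abs_of_pos hq])
  have z : ∀ {x : B}, x = 0 → x ∈ decayIdeal G (q ^ 2) := fun h => h ▸ Submodule.zero_mem _
  refine ⟨star_vacuumElement, norm_vacuumElement_le (by positivity)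
    (by simpa using hv.norm_le_pow hq (show (1 : Fin 3) ≤ 2 by decide)),
    by positivity, pow_lt_one₀ hq.le hq1 two_ne_zero, ?_, ?_, ?_⟩
  · have : 1 - G = star (v 1 1) * v 1 1 := by
      rw [← hv.weighted_one hq h₁₀, hG, vacuumElement]
      simp
    rw [this]
    exact star_mul_self_mem m11
  · exact forall_fin_three (Or.inr (Or.inr rfl)) (Or.inl (z h₀₁)) (Or.inl (z h₀₂)) (Or.inl (z h₁₀))
      (Or.inl m11) (Or.inr (Or.inr rfl)) (Or.inl (z h₂₀)) (Or.inr (Or.inr rfl))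
      (Or.inr (Or.inl (hv.star_mem' hq 2 2 m11 (z h₁₀))))
  · intro j
    fin_cases j
    · exact c 0 0 (by simp)
    · exact c 2 1 (by simp)
    · exact c 1 2 (by simp [hq.ne'])

/-- Neither corner alone separates lowering entries from raising ones here, so their product is
used. Its vacuum element is `F * (star (v 2 0) * v 2 0)` with `F` that of `v 0 2`, and `1 - G`
splits into the defects of the two factors. -/
theorem IsSUqThree.isVacuum₃ (hv : IsSUqThree q v) (hq : 0 < q) (hq1 : q < 1) :
    IsVacuum v (vacuumElement (q ^ 2) (v 0 2 * v 2 0)) (q ^ 2) ![2, 1, 0] := by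
  have hr : ∀ i, ![q⁻¹, 1, q] i ≠ 0 := by simp [Fin.forall_fin_succ, hq.ne']
  have hu := hv.scaled_upper_right hq
  have hl := hv.scaled_lower_left hq
  have hsc : ∀ i j, v 0 2 * v 2 0 * v i j = ((![q⁻¹, 1, q] i * ![q⁻¹, 1, q] j : ℝ) : ℂ) •
      (v i j * (v 0 2 * v 2 0)) := fun i j => by
    rw [mul_assoc, hl, mul_smul_comm, ← mul_assoc, hu, smul_mul_assoc, smul_smul, mul_assoc,
      ← Complex.ofReal_mul]
    congr 2
    fin_cases i <;> fin_cases j <;> simp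
  set G := vacuumElement (q ^ 2) (v 0 2 * v 2 0) with hG
  have m := fun i j hle => hv.mem_decayIdeal (ρ := q ^ 2) hr hr hsc i j hle
  have c := fun i j h1 => hv.commute_vacuumElement (ρ := q ^ 2) hr hr hsc i j h1
  have m00 : v 0 0 ∈ decayIdeal G (q ^ 2) := m 0 0 (by
    simp only [Matrix.cons_val, mul_inv_rev, inv_inv]
    rw [abs_of_pos (by positivity)]
    nlinarith)
  have m01 : v 0 1 ∈ decayIdeal G (q ^ 2) := m 0 1 (by simp [abs_of_pos hq])
  have m10 : v 1 0 ∈ decayIdeal G (q ^ 2) := m 1 0 (by simp [abs_of_pos hq])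
  have hn : ‖v 0 2 * v 2 0‖ ≤ q ^ 2 := by
    have h1 : ‖v 0 2‖ ≤ q ^ 2 := hv.norm_le_pow hq (by decide)
    have h2 := hv.norm_le_one' 2 0
    calc ‖v 0 2 * v 2 0‖ ≤ ‖v 0 2‖ * ‖v 2 0‖ := norm_mul_le _ _
      _ ≤ q ^ 2 * 1 := by gcongr
      _ = q ^ 2 := mul_one _
  refine ⟨star_vacuumElement, norm_vacuumElement_le (by positivity) hn,
    by positivity, pow_lt_one₀ hq.le hq1 two_ne_zero, ?_, ?_, ?_⟩
  · set F := vacuumElement (q ^ 2) (v 0 2) with hF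
    have hFc : Commute (v 2 0) F := hv.commute_vacuumElement
      (by simp [Fin.forall_fin_succ, hq.ne']) (by simp [Fin.forall_fin_succ, hq.ne']) hu 2 0 (by simp)
    have hGF : G = F * (star (v 2 0) * v 2 0) := by
      have hFs : star F = F := star_vacuumElement
      have h1 : star (v 2 0) * F = F * star (v 2 0) := by
        have := congrArg star hFc.eq
        rw [star_mul, star_mul, hFs] at this
        exact this.symm
      rw [← mul_assoc, ← h1, mul_assoc, hG, hF, vacuumElement, vacuumElement,
        star_mul, smul_mul_assoc, mul_smul_comm]
      simp only [mul_assoc]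
    have hF1 : 1 - F = star (v 0 0) * v 0 0 + ((q ^ 2)⁻¹ : ℝ) • (star (v 0 1) * v 0 1) := by
      rw [← hv.weighted_zero hq, hF, vacuumElement, add_sub_cancel_right]
    have hD : 1 - star (v 2 0) * v 2 0 = star (v 0 0) * v 0 0 + star (v 1 0) * v 1 0 := by
      rw [← hv.col_zero, add_sub_cancel_right]
    have : 1 - G = (1 - F) + F * (1 - star (v 2 0) * v 2 0) := by
      rw [hGF]; noncomm_ring
    rw [this, hF1, hD]
    exact Ideal.add_mem _ (Ideal.add_mem _ (star_mul_self_mem m00)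
      (Submodule.smul_of_tower_mem _ _ (star_mul_self_mem m01))) (Ideal.mul_mem_left _ _
        (Ideal.add_mem _ (star_mul_self_mem m00) (star_mul_self_mem m10)))
  · refine forall_fin_three (Or.inl m00) (Or.inl m01) (Or.inr (Or.inr rfl)) (Or.inl m10)
      (Or.inr (Or.inr rfl)) (Or.inr (Or.inl ?_)) (Or.inr (Or.inr rfl)) (Or.inr (Or.inl ?_))
      (Or.inr (Or.inl ?_))
    · exact hv.star_mem hq 1 2 m00 (Or.inl m01)
    · exact hv.star_mem hq 2 1 m00 (Or.inr m10)
    · exact hv.star_mem hq 2 2 m00 (Or.inl m01)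
  · intro j
    fin_cases j
    · exact c 2 0 (by simp [hq.ne'])
    · exact c 1 1 (by simp)
    · exact c 0 2 (by simp [hq.ne'])

/-- The base of the induction: for a diagonal matrix of generators nothing is left to lower or
raise, and the vacuum projection is the identity. -/
theorem isVacuum_one (h : ∀ i j, i ≠ j → v i j = 0) : IsVacuum v 1 0 id := by
  refine ⟨star_one _, ?_, le_rfl, zero_lt_one, ?_, fun i j => ?_, fun j => Commute.one_right _⟩
  · rcases subsingleton_or_nontrivial B with hB | hB
    · rw [Subsingleton.elim (1 : B) 0, norm_zero]; exact zero_le_one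
    · exact norm_one.le
  · rw [sub_self]; exact Submodule.zero_mem _
  · by_cases hij : i = j
    · exact Or.inr (Or.inr hij)
    · exact Or.inl (h i j hij ▸ Submodule.zero_mem _)

end Vacua

end Strata

/-! ### Weakly null sequences and compact operators -/

section WeakNull

open Filter Topology

variable {ι κ : Type}

/-- Approximating `h` by finitely supported vectors reduces the claim to finitely many coordinates,
with an error controlled by the uniform bound `C`. -/
theorem tendsto_inner_zero {x : ℕ → lp (fun _ : ι => ℂ) 2} {C : ℝ} (hb : ∀ m, ‖x m‖ ≤ C)
    (hx : ∀ n, Tendsto (fun m => x m n) atTop (𝓝 0)) (h : lp (fun _ : ι => ℂ) 2) :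
    Tendsto (fun m => inner ℂ (x m) h) atTop (𝓝 0) := by
  classical
  have hfin : ∀ s : Finset ι,
      Tendsto (fun m => inner ℂ (x m) (∑ n ∈ s, lp.single 2 n (h n))) atTop (𝓝 0) := fun s => by
    simp only [inner_sum, lp.inner_single_right]
    have : Tendsto (fun m => ∑ n ∈ s, inner ℂ (x m n) (h n)) atTop (𝓝 (∑ n ∈ s, (0 : ℂ))) := by
      refine tendsto_finsetSum s fun n _ => ?_
      simpa using (continuous_star.tendsto _ |>.comp (hx n)).const_mul (h n)
    simpa using this
  have hC : 0 ≤ C := (norm_nonneg _).trans (hb 0)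
  rw [Metric.tendsto_atTop]
  intro ε hε
  obtain ⟨s, hs⟩ := (Metric.tendsto_atTop.1
    (lp.hasSum_single (p := 2) (by norm_num) h) (ε / (2 * (C + 1))) (by positivity))
  obtain ⟨N, hN⟩ := Metric.tendsto_atTop.1 (hfin s) (ε / 2) (by positivity)
  refine ⟨N, fun m hm => ?_⟩
  have h1 := hs s le_rfl
  have h2 := hN m hm
  rw [dist_eq_norm] at h1
  rw [dist_zero_right] at h2 ⊢
  have h3 : inner ℂ (x m) h = inner ℂ (x m) (∑ n ∈ s, lp.single 2 n (h n))
      - inner ℂ (x m) ((∑ n ∈ s, lp.single 2 n (h n)) - h) := by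
    rw [← inner_sub_right]; congr 1; abel
  have h4 : ‖inner ℂ (x m) ((∑ n ∈ s, lp.single 2 n (h n)) - h)‖ ≤ C * (ε / (2 * (C + 1))) :=
    (norm_inner_le_norm _ _).trans (mul_le_mul (hb m) h1.le (norm_nonneg _) hC)
  have h5 : C * (ε / (2 * (C + 1))) ≤ ε / 2 := by
    rw [mul_div_assoc', div_le_div_iff₀ (by positivity) (by positivity)]
    nlinarith
  rw [h3]
  exact (norm_sub_le _ _).trans_lt (by linarith)

/-- Compact operators map bounded sequences which converge to zero coordinatewise to null
sequences. -/
theorem tendsto_zero_of_isCompactOperator {H : Type} [NormedAddCommGroup H] [InnerProductSpace ℂ H]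
    [CompleteSpace H] {K : lp (fun _ : ι => ℂ) 2 →L[ℂ] H} (hK : IsCompactOperator K)
    {x : ℕ → lp (fun _ : ι => ℂ) 2} {C : ℝ} (hb : ∀ m, ‖x m‖ ≤ C)
    (hx : ∀ n, Tendsto (fun m => x m n) atTop (𝓝 0)) :
    Tendsto (fun m => K (x m)) atTop (𝓝 0) := by
  obtain ⟨S, hS, hKS⟩ := hK.image_closedBall_subset_compact (f := K.toLinearMap) C
  refine hS.tendsto_nhds_of_unique_mapClusterPt
    (Eventually.of_forall fun m => hKS ⟨x m, by simpa using hb m, rfl⟩) fun y _ hy => ?_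
  -- For a cluster point `y` of the images, `inner y y` is a cluster point of `inner (K (x m)) y =
  -- inner (x m) (K* y)`, which tends to zero. Relative compactness then makes the sequence
  -- converge.
  have h1 : MapClusterPt (inner ℂ y y) atTop fun m => inner ℂ (K (x m)) y :=
    hy.continuousAt_comp (f := fun z => inner ℂ z y) (by fun_prop)
  have h2 : Tendsto (fun m => inner ℂ (K (x m)) y) atTop (𝓝 0) := by
    simp only [← ContinuousLinearMap.adjoint_inner_right]
    exact tendsto_inner_zero hb hx _
  have h3 : (𝓝 (inner ℂ y y) ⊓ 𝓝 (0 : ℂ)).NeBot := ClusterPt.mono h1 h2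
  exact inner_self_eq_zero.1 (eq_of_nhds_neBot h3)

end WeakNull

/-! ### Vectors with large occupation number in one tensor factor -/

section SlotEmbedding

open Filter Topology

variable {k : ℕ} (j : Fin (k + 1))

theorem hasSum_slot (i : ℕ) (f : Hil k) :
    HasSum (fun n : Fin (k + 1) → ℕ => ‖if n j = i then f (j.removeNth n) else 0‖ ^ 2)
      (‖f‖ ^ 2) := by
  have hf : HasSum (fun n => ‖f n‖ ^ 2) (‖f‖ ^ 2) := by
    simpa using lp.hasSum_norm (p := 2) (by norm_num) f
  have hinj : Function.Injective fun n : Fin k → ℕ => (j.insertNth i n : Fin (k + 1) → ℕ) :=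
    fun a b h => by simpa using congrArg (j.removeNth (α := fun _ => ℕ)) h
  rw [← hinj.hasSum_iff]
  · simpa [Function.comp_def] using hf
  · intro n hn
    have : n j ≠ i := fun h => hn ⟨j.removeNth n, by
      simp [← h]⟩
    simp [this]

/-- The isometry `f ↦ |i⟩ ⊗ f`, with `|i⟩` in the tensor factor `j`. -/
def slotEmb (i : ℕ) : Hil k →ₗᵢ[ℂ] Hil (k + 1) where
  toFun f := ⟨fun n => if n j = i then f (j.removeNth n) else 0,
    (memℓp_gen_iff (by norm_num)).2 (by simpa using (hasSum_slot j i f).summable)⟩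
  map_add' f g := by
    ext n
    change (if n j = i then f (j.removeNth n) + g (j.removeNth n) else 0)
      = (if n j = i then f (j.removeNth n) else 0) + if n j = i then g (j.removeNth n) else 0
    split_ifs <;> simp
  map_smul' c f := by ext n; by_cases h : n j = i <;> simp [h]
  norm_map' f := by
    have h1 := lp.norm_rpow_eq_tsum (p := 2) (by norm_num)
      (⟨fun n => if n j = i then f (j.removeNth n) else 0,
        (memℓp_gen_iff (by norm_num)).2 (by simpa using (hasSum_slot j i f).summable)⟩ :
          Hil (k + 1))
    have h2 := (hasSum_slot j i f).tsum_eq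
    simp only [ENNReal.toReal_ofNat, Real.rpow_two] at h1
    have h3 := h1.trans h2
    exact (sq_eq_sq₀ (norm_nonneg _) (norm_nonneg _)).1 h3

theorem slotEmb_apply (i : ℕ) (f : Hil k) (n : Fin (k + 1) → ℕ) :
    slotEmb j i f n = if n j = i then f (j.removeNth n) else 0 := rfl

theorem inner_slotEmb {i i' : ℕ} (h : i ≠ i') (f g : Hil k) :
    inner ℂ (slotEmb j i f) (slotEmb j i' g) = 0 := by
  rw [lp.inner_eq_tsum]
  refine (tsum_congr fun n => ?_).trans tsum_zero
  rw [slotEmb_apply, slotEmb_apply]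
  by_cases h1 : n j = i
  · rw [if_neg (fun h2 => h (h1.symm.trans h2)), inner_zero_right]
  · rw [if_neg h1, inner_zero_left]

variable (q : Set.Ioo (0 : ℝ) 1)

theorem lowerOp_slotEmb_succAbove (l : Fin k) (i : ℕ) (f : Hil k) :
    lowerOp q (j.succAbove l) (slotEmb j i f) = slotEmb j i (lowerOp q l f) :=
  lp.ext (funext fun n => by
    rw [lowerOp_apply, slotEmb_apply, slotEmb_apply, lowerOp_apply,
      Function.update_of_ne (Fin.ne_succAbove j l), Fin.removeNth_update_succAbove]
    split_ifs
    · rfl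
    · simp)

theorem star_lowerOp_slotEmb_succAbove (l : Fin k) (i : ℕ) (f : Hil k) :
    star (lowerOp q (j.succAbove l)) (slotEmb j i f) = slotEmb j i (star (lowerOp q l) f) :=
  lp.ext (funext fun n => by
    rw [star_lowerOp_apply, slotEmb_apply, slotEmb_apply, star_lowerOp_apply,
      Function.update_of_ne (Fin.ne_succAbove j l), Fin.removeNth_update_succAbove]
    split_ifs
    · rfl
    · simp)

theorem diagOp_slotEmb_succAbove (l : Fin k) (i : ℕ) (f : Hil k) :
    diagOp q (j.succAbove l) (slotEmb j i f) = slotEmb j i (diagOp q l f) :=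
  lp.ext (funext fun n => by
    rw [diagOp_apply, slotEmb_apply, slotEmb_apply, diagOp_apply]
    split_ifs
    · rfl
    · simp)

theorem diagOp_slotEmb (i : ℕ) (f : Hil k) :
    diagOp q j (slotEmb j i f) = (((q : ℝ) ^ i : ℝ) : ℂ) • slotEmb j i f :=
  lp.ext (funext fun n => by
    rw [diagOp_apply, lp.coeFn_smul, Pi.smul_apply, slotEmb_apply]
    split_ifs with h
    · rw [h]; rfl
    · simp)

theorem lowerOp_slotEmb_succ (i : ℕ) (f : Hil k) : lowerOp q j (slotEmb j (i + 1) f)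
    = ((√(1 - (q : ℝ) ^ (2 * (i + 1))) : ℝ) : ℂ) • slotEmb j i f :=
  lp.ext (funext fun n => by
    rw [lowerOp_apply, lp.coeFn_smul, Pi.smul_apply, slotEmb_apply, slotEmb_apply,
      Function.update_self, Fin.removeNth_update]
    by_cases h : n j = i
    · rw [if_pos h, if_pos (by omega), h]; rfl
    · rw [if_neg h, if_neg (by omega)]; simp)

theorem star_lowerOp_slotEmb (i : ℕ) (f : Hil k) : star (lowerOp q j) (slotEmb j i f)
    = ((√(1 - (q : ℝ) ^ (2 * (i + 1))) : ℝ) : ℂ) • slotEmb j (i + 1) f :=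
  lp.ext (funext fun n => by
    rw [star_lowerOp_apply, lp.coeFn_smul, Pi.smul_apply, slotEmb_apply, slotEmb_apply,
      Function.update_self, Fin.removeNth_update]
    by_cases h : n j = i + 1
    · rw [if_pos h, if_pos (by omega), h]; rfl
    · by_cases h0 : n j = 0
      · simp [h0]
      · rw [if_neg h, if_neg (by omega)]; simp)

/-- The map `f ↦ g ⊗ f`, where `g = m^{-1/2} (|m⟩ + ⋯ + |2m-1⟩)` is in the tensor factor `j`. -/
def slotAverage (m : ℕ) : Hil k →L[ℂ] Hil (k + 1) :=
  (((√m)⁻¹ : ℝ) : ℂ) • ∑ i ∈ Finset.range m, (slotEmb j (m + i)).toContinuousLinearMap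

theorem slotAverage_apply (m : ℕ) (f : Hil k) :
    slotAverage j m f = (((√m)⁻¹ : ℝ) : ℂ) • ∑ i ∈ Finset.range m, slotEmb j (m + i) f := by
  simp [slotAverage]

theorem norm_slotAverage {m : ℕ} (hm : m ≠ 0) (f : Hil k) : ‖slotAverage j m f‖ = ‖f‖ := by
  have h1 : ‖∑ i ∈ Finset.range m, slotEmb j (m + i) f‖ ^ 2 = m * ‖f‖ ^ 2 := by
    rw [← Complex.ofReal_inj, Complex.ofReal_pow]
    have h2 := inner_self_eq_norm_sq_to_K (𝕜 := ℂ) (∑ i ∈ Finset.range m, slotEmb j (m + i) f)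
    refine h2.symm.trans ?_
    rw [sum_inner]
    have : ∀ i ∈ Finset.range m, inner ℂ (slotEmb j (m + i) f)
        (∑ i ∈ Finset.range m, slotEmb j (m + i) f) = (‖f‖ : ℂ) ^ 2 := fun i hi => by
      rw [inner_sum, Finset.sum_eq_single i, LinearIsometry.inner_map_map]
      · exact inner_self_eq_norm_sq_to_K (𝕜 := ℂ) f
      · intro i' _ hne
        exact inner_slotEmb j (by omega) f f
      · exact fun h => absurd hi h
    rw [Finset.sum_congr rfl this]
    simp
  have hm' : (0 : ℝ) < m := by positivity
  rw [slotAverage_apply, norm_smul, Complex.norm_real, Real.norm_of_nonneg (by positivity)]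
  refine (sq_eq_sq₀ (by positivity) (norm_nonneg _)).1 ?_
  rw [mul_pow, h1, inv_pow, Real.sq_sqrt hm'.le, inv_mul_cancel_left₀ hm'.ne']

theorem norm_slotAverage_le (m : ℕ) (f : Hil k) : ‖slotAverage j m f‖ ≤ ‖f‖ := by
  rcases eq_or_ne m 0 with rfl | hm
  · simp [slotAverage_apply]
  · exact (norm_slotAverage j hm f).le

theorem tendsto_slotAverage_apply (f : Hil k) (n : Fin (k + 1) → ℕ) :
    Tendsto (fun m => slotAverage j m f n) atTop (𝓝 0) := by
  refine tendsto_const_nhds.congr' ?_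
  filter_upwards [eventually_gt_atTop (n j)] with m hm
  rw [slotAverage_apply, lp.coeFn_smul, Pi.smul_apply, lp.coeFn_sum, Finset.sum_apply,
    Finset.sum_eq_zero, smul_zero]
  intro i _
  rw [slotEmb_apply, if_neg (by omega)]

end SlotEmbedding

/-! ### Degeneration of operators as one occupation number tends to infinity -/

section SlotLimit

open Filter Topology

variable {k : ℕ} (j : Fin (k + 1)) (q : Set.Ioo (0 : ℝ) 1)

/-- `T` is asymptotically `1 ⊗ S` when the occupation number of the tensor factor `j` tends to
infinity. -/
def SlotLimit (T : Hil (k + 1) →L[ℂ] Hil (k + 1)) (S : Hil k →L[ℂ] Hil k) : Prop :=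
  ∀ f, Tendsto (fun m => T (slotAverage j m f) - slotAverage j m (S f)) atTop (𝓝 0)

variable {j} {q}
variable {T T' : Hil (k + 1) →L[ℂ] Hil (k + 1)} {S S' : Hil k →L[ℂ] Hil k}

theorem SlotLimit.add (h : SlotLimit j T S) (h' : SlotLimit j T' S') :
    SlotLimit j (T + T') (S + S') := fun f => by
  have := (h f).add (h' f)
  rw [add_zero] at this
  refine this.congr fun m => ?_
  simp only [add_apply, map_add]
  abel

theorem SlotLimit.smul (c : ℂ) (h : SlotLimit j T S) : SlotLimit j (c • T) (c • S) := fun f => by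
  have := (h f).const_smul c
  rw [smul_zero] at this
  refine this.congr fun m => ?_
  simp only [smul_apply, map_smul, smul_sub]

theorem SlotLimit.neg (h : SlotLimit j T S) : SlotLimit j (-T) (-S) := by
  simpa using h.smul (-1)

theorem SlotLimit.mul (h : SlotLimit j T S) (h' : SlotLimit j T' S') :
    SlotLimit j (T * T') (S * S') := fun f => by
  have := ((T.continuous.tendsto _).comp (h' f)).add (h (S' f))
  rw [map_zero, add_zero] at this
  refine this.congr fun m => ?_
  simp only [Function.comp_def, map_sub]
  change T (T' _) - T _ + (T _ - _) = T (T' _) - _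
  abel_nf
  rfl

theorem SlotLimit.of_eq (h : ∀ i f, T (slotEmb j i f) = slotEmb j i (S f)) : SlotLimit j T S :=
  fun f => by
    refine tendsto_const_nhds.congr fun m => ?_
    rw [slotAverage_apply, slotAverage_apply, map_smul, map_sum]
    simp [h]

theorem slotLimit_one : SlotLimit j (1 : Hil (k + 1) →L[ℂ] Hil (k + 1)) 1 :=
  .of_eq fun _ _ => rfl

theorem slotLimit_zero : SlotLimit j (0 : Hil (k + 1) →L[ℂ] Hil (k + 1)) 0 :=
  .of_eq fun i f => by simp

theorem tendsto_sqrt_mul_pow {r : ℝ} (h0 : 0 < r) (h1 : r < 1) :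
    Tendsto (fun m : ℕ => √m * r ^ m) atTop (𝓝 0) := by
  refine squeeze_zero (fun m => by positivity) (fun m => ?_)
    (tendsto_self_mul_const_pow_of_lt_one h0.le h1)
  gcongr
  rcases Nat.eq_zero_or_pos m with rfl | hm
  · simp
  · rw [Real.sqrt_le_left (by positivity)]
    have : (1 : ℝ) ≤ m := by exact_mod_cast hm
    nlinarith

/-- The triangle inequality bounds the sum by `m r ^ m ‖f‖`; together with the normalisation `m ^
(-1/2)` this leaves `√m r ^ m ‖f‖`, which still tends to zero for `r < 1`. -/
theorem norm_slot_sum_le {m : ℕ} {r : ℝ} (c : ℕ → ℂ) (s : ℕ → ℕ)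
    (hc : ∀ i < m, ‖c i‖ ≤ r ^ m) (f : Hil k) :
    ‖(((√m)⁻¹ : ℝ) : ℂ) • ∑ i ∈ Finset.range m, c i • slotEmb j (s i) f‖ ≤ √m * r ^ m * ‖f‖ := by
  rw [norm_smul, Complex.norm_real, Real.norm_of_nonneg (by positivity)]
  have h1 : ‖∑ i ∈ Finset.range m, c i • slotEmb j (s i) f‖ ≤ m * (r ^ m * ‖f‖) := by
    refine (norm_sum_le _ _).trans ?_
    rw [← nsmul_eq_mul, ← Finset.card_range m, ← Finset.sum_const, Finset.card_range]
    refine Finset.sum_le_sum fun i hi => ?_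
    rw [norm_smul, LinearIsometry.norm_map]
    exact mul_le_mul_of_nonneg_right (hc i (Finset.mem_range.1 hi)) (norm_nonneg _)
  calc (√m)⁻¹ * ‖∑ i ∈ Finset.range m, c i • slotEmb j (s i) f‖
      ≤ (√m)⁻¹ * (m * (r ^ m * ‖f‖)) := by gcongr
    _ = (√m)⁻¹ * (√m * √m) * (r ^ m * ‖f‖) := by rw [Real.mul_self_sqrt (by positivity)]; ring
    _ = _ := by
      rcases Nat.eq_zero_or_pos m with rfl | hm
      · simp
      · have : √(m : ℝ) ≠ 0 := by positivity
        field_simp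

theorem slotLimit_diagOp : SlotLimit j (diagOp q j) 0 := fun f => by
  have hb : Tendsto (fun m : ℕ => √m * (q : ℝ) ^ m * ‖f‖) atTop (𝓝 0) := by
    simpa using (tendsto_sqrt_mul_pow q.2.1 q.2.2).mul_const ‖f‖
  refine squeeze_zero_norm (fun m => ?_) hb
  rw [zero_apply, map_zero, sub_zero, slotAverage_apply, map_smul, map_sum]
  simp only [diagOp_slotEmb]
  refine norm_slot_sum_le _ _ (fun i _ => ?_) f
  rw [Complex.norm_real, Real.norm_of_nonneg (pow_nonneg q.2.1.le _)]
  exact pow_le_pow_of_le_one q.2.1.le q.2.2.le (by omega)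

theorem norm_sqrt_sub_one_le {r : ℝ} (h0 : 0 ≤ r) (h1 : r ≤ 1) {m n : ℕ} (h : m ≤ n) :
    ‖((√(1 - r ^ n) : ℝ) : ℂ) - 1‖ ≤ r ^ m := by
  have h2 : r ^ n ≤ 1 := pow_le_one₀ h0 h1
  have h3 : 0 ≤ r ^ n := pow_nonneg h0 n
  have h4 : √(1 - r ^ n) ≤ 1 := Real.sqrt_le_one.2 (by linarith)
  have h5 : 1 - r ^ n ≤ √(1 - r ^ n) := Real.le_sqrt_of_sq_le (by nlinarith)
  rw [← Complex.ofReal_one, ← Complex.ofReal_sub, Complex.norm_real, Real.norm_eq_abs, abs_le]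
  have := pow_le_pow_of_le_one h0 h1 h
  constructor <;> linarith

theorem tendsto_inv_sqrt_mul (c : ℝ) : Tendsto (fun m : ℕ => (√m)⁻¹ * c) atTop (𝓝 0) := by
  simpa using ((Real.tendsto_sqrt_atTop.comp tendsto_natCast_atTop_atTop).inv_tendsto_atTop).mul_const c

theorem norm_telescope_le (m : ℕ) (f : Hil k) (a b : ℕ) :
    ‖(((√m)⁻¹ : ℝ) : ℂ) • (slotEmb j a f - slotEmb j b f)‖ ≤ (√m)⁻¹ * (2 * ‖f‖) := by
  rw [norm_smul, Complex.norm_real, Real.norm_of_nonneg (by positivity), two_mul]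
  gcongr
  exact (norm_sub_le _ _).trans (by simp)

/-- The weights tend to 1 exponentially, and shifting a window of `m` consecutive basis vectors
changes only its two end terms. After normalisation these have size `m ^ (-1/2)`; single basis
vectors would not be asymptotically fixed by the shift. -/
theorem slotLimit_star_lowerOp : SlotLimit j (star (lowerOp q j)) 1 := fun f => by
  have hb : Tendsto (fun m : ℕ => √m * (q : ℝ) ^ m * ‖f‖ + (√m)⁻¹ * (2 * ‖f‖)) atTop (𝓝 0) := by
    simpa using ((tendsto_sqrt_mul_pow q.2.1 q.2.2).mul_const ‖f‖).add
      (tendsto_inv_sqrt_mul (2 * ‖f‖))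
  refine squeeze_zero_norm (fun m => ?_) hb
  have key : star (lowerOp q j) (slotAverage j m f) - slotAverage j m ((1 : Hil k →L[ℂ] Hil k) f)
      = (((√m)⁻¹ : ℝ) : ℂ) • (∑ i ∈ Finset.range m,
          (((√(1 - (q : ℝ) ^ (2 * (m + i + 1))) : ℝ) : ℂ) - 1) • slotEmb j (m + i + 1) f)
        + (((√m)⁻¹ : ℝ) : ℂ) • (slotEmb j (m + m) f - slotEmb j (m + 0) f) := by
    rw [← Finset.sum_range_sub (fun i => slotEmb j (m + i) f) m, one_apply_eq_self,
      slotAverage_apply, map_smul, map_sum, ← smul_sub, ← smul_add, ← Finset.sum_sub_distrib,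
      ← Finset.sum_add_distrib]
    congr 1
    refine Finset.sum_congr rfl fun i _ => ?_
    rw [star_lowerOp_slotEmb, sub_smul, one_smul, ← add_assoc m i 1]
    abel
  rw [key]
  refine (norm_add_le _ _).trans (add_le_add ?_ (norm_telescope_le m f _ _))
  exact norm_slot_sum_le _ (fun i => m + i + 1)
    (fun i _ => norm_sqrt_sub_one_le q.2.1.le q.2.2.le (by omega)) f

theorem slotLimit_lowerOp : SlotLimit j (lowerOp q j) 1 := fun f => by
  have hb : Tendsto (fun m : ℕ => √m * (q : ℝ) ^ m * ‖f‖ + (√m)⁻¹ * (2 * ‖f‖)) atTop (𝓝 0) := by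
    simpa using ((tendsto_sqrt_mul_pow q.2.1 q.2.2).mul_const ‖f‖).add
      (tendsto_inv_sqrt_mul (2 * ‖f‖))
  refine squeeze_zero_norm' ?_ hb
  -- For `m ≥ 1` every index of the window is a successor, `m + i = (m - 1 + i) + 1`, as the
  -- lowering formula requires.
  filter_upwards [eventually_ge_atTop 1] with m hm
  have key : lowerOp q j (slotAverage j m f) - slotAverage j m ((1 : Hil k →L[ℂ] Hil k) f)
      = (((√m)⁻¹ : ℝ) : ℂ) • (∑ i ∈ Finset.range m,
          (((√(1 - (q : ℝ) ^ (2 * (m - 1 + i + 1))) : ℝ) : ℂ) - 1) • slotEmb j (m - 1 + i) f)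
        + (((√m)⁻¹ : ℝ) : ℂ) • (slotEmb j (m - 1 + 0) f - slotEmb j (m - 1 + m) f) := by
    rw [← Finset.sum_range_sub' (fun i => slotEmb j (m - 1 + i) f) m, one_apply_eq_self,
      slotAverage_apply, map_smul, map_sum, ← smul_sub, ← smul_add, ← Finset.sum_sub_distrib,
      ← Finset.sum_add_distrib]
    congr 1
    refine Finset.sum_congr rfl fun i _ => ?_
    have e : m + i = m - 1 + i + 1 := by omega
    rw [e, lowerOp_slotEmb_succ, sub_smul, one_smul, ← add_assoc _ i 1]
    abel
  rw [key]
  refine (norm_add_le _ _).trans (add_le_add ?_ (norm_telescope_le m f _ _))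
  exact norm_slot_sum_le _ (fun i => m - 1 + i)
    (fun i _ => norm_sqrt_sub_one_le q.2.1.le q.2.2.le (by omega)) f

variable {M M' : Matrix (Fin 3) (Fin 3) (Hil (k + 1) →L[ℂ] Hil (k + 1))}
  {N N' : Matrix (Fin 3) (Fin 3) (Hil k →L[ℂ] Hil k)}

theorem SlotLimit.matrix_mul (h : ∀ a b, SlotLimit j (M a b) (N a b))
    (h' : ∀ a b, SlotLimit j (M' a b) (N' a b)) (a b : Fin 3) :
    SlotLimit j ((M * M') a b) ((N * N') a b) := by
  rw [Matrix.mul_apply, Matrix.mul_apply, Fin.sum_univ_three, Fin.sum_univ_three]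
  exact (((h _ _).mul (h' _ _)).add ((h _ _).mul (h' _ _))).add ((h _ _).mul (h' _ _))

theorem SlotLimit.block {a c : Hil (k + 1) →L[ℂ] Hil (k + 1)} {a' c' : Hil k →L[ℂ] Hil k} (r : ℝ)
    (ha : SlotLimit j a a') (hs : SlotLimit j (star a) (star a')) (hc : SlotLimit j c c')
    (l m : Fin 3) : SlotLimit j (block₁₂ r a c l m) (block₁₂ r a' c' l m) ∧
      SlotLimit j (block₂₃ r a c l m) (block₂₃ r a' c' l m) := by
  have hn : SlotLimit j (-((r : ℂ) • c)) (-((r : ℂ) • c')) := (hc.smul _).neg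
  have h0 : SlotLimit j (0 : Hil (k + 1) →L[ℂ] Hil (k + 1)) 0 := slotLimit_zero
  have h1 : SlotLimit j (1 : Hil (k + 1) →L[ℂ] Hil (k + 1)) 1 := slotLimit_one
  constructor <;> fin_cases l <;> fin_cases m <;> assumption

/-- In the limit `a` and its adjoint become 1 and `c` becomes 0, so both elementary matrices
degenerate to the identity matrix. -/
theorem slotLimit_V (a b : Fin 3) : SlotLimit j (V₁₂ q j a b) ((1 : Matrix (Fin 3) (Fin 3) _) a b) ∧
    SlotLimit j (V₂₃ q j a b) ((1 : Matrix (Fin 3) (Fin 3) _) a b) := by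
  have h := SlotLimit.block (j := j) (q : ℝ) (slotLimit_lowerOp (q := q))
    (by rw [star_one]; exact slotLimit_star_lowerOp) (slotLimit_diagOp (q := q)) a b
  have e : block₁₂ (q : ℝ) (1 : Hil k →L[ℂ] Hil k) 0 = 1 ∧
      block₂₃ (q : ℝ) (1 : Hil k →L[ℂ] Hil k) 0 = 1 := by
    constructor <;> ext a b : 2 <;> fin_cases a <;> fin_cases b <;> simp [block₁₂, block₂₃]
  rw [e.1, e.2] at h
  exact h

theorem slotLimit_V_succAbove (l : Fin k) (a b : Fin 3) :
    SlotLimit j (V₁₂ q (j.succAbove l) a b) (V₁₂ q l a b) ∧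
    SlotLimit j (V₂₃ q (j.succAbove l) a b) (V₂₃ q l a b) :=
  SlotLimit.block (q : ℝ) (.of_eq fun i f => lowerOp_slotEmb_succAbove j q l i f)
    (.of_eq fun i f => star_lowerOp_slotEmb_succAbove j q l i f)
    (.of_eq fun i f => diagOp_slotEmb_succAbove j q l i f) a b

variable {π : CSUqThree q →⋆ₐ[ℂ] (Hil (k + 1) →L[ℂ] Hil (k + 1))}
  {σ : CSUqThree q →⋆ₐ[ℂ] (Hil k →L[ℂ] Hil k)}

/-- Asymptotic relations pass to sums and products, hence to words, and to norm limits because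
representations and averaged embeddings are contractive. -/
theorem slotLimit_of_gen (h : ∀ a b, SlotLimit j (π (gen q a b)) (σ (gen q a b)))
    (y : CSUqThree q) : SlotLimit j (π y) (σ y) := by
  let S : Submodule ℂ (CSUqThree q) :=
    { carrier := {y | SlotLimit j (π y) (σ y)}
      add_mem' := fun {a b} ha hb => by
        change SlotLimit j (π (a + b)) (σ (a + b))
        rw [map_add, map_add]; exact ha.add hb
      zero_mem' := by
        change SlotLimit j (π 0) (σ 0)
        rw [map_zero, map_zero]; exact slotLimit_zero
      smul_mem' := fun c a ha => by
        change SlotLimit j (π (c • a)) (σ (c • a))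
        rw [map_smul, map_smul]; exact ha.smul c }
  refine mem_of_word_mem q.2.1.ne' S ?_ (fun w => ?_) y
  · rw [← closure_subset_iff_isClosed]
    intro y hy f
    rw [Metric.tendsto_atTop]
    intro ε hε
    obtain ⟨z, hz, hyz⟩ := Metric.mem_closure_iff.1 hy (ε / (4 * (‖f‖ + 1))) (by positivity)
    obtain ⟨N, hN⟩ := Metric.tendsto_atTop.1 (hz f) (ε / 2) (by positivity)
    refine ⟨N, fun m hm => ?_⟩
    have h1 := hN m hm
    rw [dist_zero_right] at h1 ⊢
    rw [dist_eq_norm] at hyz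
    have e : π y (slotAverage j m f) - slotAverage j m (σ y f)
        = (π z (slotAverage j m f) - slotAverage j m (σ z f))
          + (π (y - z) (slotAverage j m f) - slotAverage j m (σ (y - z) f)) := by
      rw [map_sub, map_sub]
      simp only [sub_apply, map_sub]
      abel
    have h2 : ‖π (y - z) (slotAverage j m f)‖ ≤ ‖y - z‖ * ‖f‖ :=
      ((π (y - z)).le_opNorm _).trans (mul_le_mul (NonUnitalStarAlgHom.norm_apply_le π _)
        (norm_slotAverage_le j m f) (norm_nonneg _) (norm_nonneg _))
    have h3 : ‖slotAverage j m (σ (y - z) f)‖ ≤ ‖y - z‖ * ‖f‖ :=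
      (norm_slotAverage_le j m _).trans (((σ (y - z)).le_opNorm _).trans
        (mul_le_mul_of_nonneg_right (NonUnitalStarAlgHom.norm_apply_le σ _) (norm_nonneg _)))
    have h4 : ‖y - z‖ * ‖f‖ ≤ ε / 4 := by
      have : ‖y - z‖ * ‖f‖ ≤ ε / (4 * (‖f‖ + 1)) * (‖f‖ + 1) :=
        mul_le_mul hyz.le (by linarith) (norm_nonneg _) (by positivity)
      refine this.trans_eq ?_
      have : ‖f‖ + 1 ≠ 0 := by positivity
      field_simp
    rw [e]
    have h5 := norm_sub_le (π (y - z) (slotAverage j m f)) (slotAverage j m (σ (y - z) f))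
    exact (norm_add_le _ _).trans_lt (by linarith)
  · change SlotLimit j (π (word (gen q) w)) (σ (word (gen q) w))
    induction w with
    | nil => simpa using slotLimit_one
    | cons p w ih => simpa only [word_cons, map_mul] using (h _ _).mul ih

/-- Elements which act by compact operators act by zero in the limit. -/
theorem eq_zero_of_isCompactOperator (h : ∀ a b, SlotLimit j (π (gen q a b)) (σ (gen q a b)))
    {y : CSUqThree q} (hy : IsCompactOperator (π y)) : σ y = 0 := by
  ext1 f
  have h1 := slotLimit_of_gen h y f
  have h2 := tendsto_zero_of_isCompactOperator hy (norm_slotAverage_le j · f)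
    (tendsto_slotAverage_apply j f)
  have h3 := (h2.sub h1).norm
  simp only [sub_sub_cancel, sub_zero, norm_zero] at h3
  have h4 : ‖σ y f‖ = 0 := by
    refine tendsto_nhds_unique (tendsto_const_nhds.congr' ?_) h3
    filter_upwards [eventually_ne_atTop 0] with m hm
    exact (norm_slotAverage j hm _).symm
  simpa using h4

end SlotLimit

/-! ### The basis vector with all occupation numbers zero -/

section VacuumVector

open Filter Topology

variable (q : Set.Ioo (0 : ℝ) 1) {k : ℕ}

/-- The basis vector `|0, …, 0⟩`. -/
def vacuumVector (k : ℕ) : Hil k := lp.single 2 0 1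

theorem vacuumVector_ne_zero : vacuumVector k ≠ 0 := fun h => by
  have := congrArg (fun f : Hil k => f 0) h
  simp [vacuumVector] at this

instance : Nontrivial (Hil k →L[ℂ] Hil k) :=
  ⟨1, 0, fun h => vacuumVector_ne_zero (congrArg (fun T : Hil k →L[ℂ] Hil k => T (vacuumVector k)) h)⟩

theorem diagOp_vacuumVector (j : Fin k) : diagOp q j (vacuumVector k) = vacuumVector k :=
  lp.ext (funext fun n => by
    rw [diagOp_apply]
    by_cases h : n = 0
    · simp [h]
    · rw [vacuumVector, lp.single_apply_ne 2 0 _ h, mul_zero])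

theorem not_tendsto_pow_of_apply_eq {H : Type} [NormedAddCommGroup H] [NormedSpace ℂ H]
    {T : H →L[ℂ] H} {e : H} (he : e ≠ 0) (h : T e = e) : ¬ Tendsto (fun n => T ^ n) atTop (𝓝 0) := by
  intro h0
  have h1 : ∀ n : ℕ, (T ^ n) e = e := fun n => by
    induction n with
    | zero => rfl
    | succ n ih => rw [pow_succ, mul_apply_eq_comp, h, ih]
  have h2 := ((ContinuousLinearMap.apply ℂ H e).continuous.tendsto 0).comp h0
  simp only [Function.comp_def, ContinuousLinearMap.apply_apply, h1, map_zero] at h2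
  exact he (tendsto_nhds_unique tendsto_const_nhds h2)

/-- The eigenvalue enters only through its square, because entries such as `(0, 1)` have the
negative eigenvalue `-q` on the vacuum vector. -/
theorem vacuumElement_apply_eq {T : Hil k →L[ℂ] Hil k} {e : Hil k} {c ρ : ℝ} (hρ : ρ ≠ 0)
    (hc : c ^ 2 = ρ ^ 2) (h : T e = (c : ℂ) • e) (hs : star T = T) : vacuumElement ρ T e = e := by
  rw [vacuumElement, hs, ← Complex.coe_smul, smul_apply, mul_apply_eq_comp, h, map_smul, h, smul_smul,
    smul_smul, ← Complex.ofReal_mul, ← Complex.ofReal_mul, mul_assoc, ← sq, hc,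
    inv_mul_cancel₀ (pow_ne_zero 2 hρ), Complex.ofReal_one, one_smul]

theorem map_vacuumElement {A B : Type*} [CStarAlgebra A] [CStarAlgebra B] (f : A →⋆ₐ[ℂ] B) (ρ : ℝ)
    (n : A) : f (vacuumElement ρ n) = vacuumElement ρ (f n) := by
  rw [vacuumElement, vacuumElement, ← Complex.coe_smul, ← Complex.coe_smul, map_smul, map_mul,
    map_star]

theorem mem_of_vacuumElement_mem {A : Type*} [CStarAlgebra A] {I : Ideal A} [I.IsTwoSided]
    (hI : IsClosed (I : Set A)) {ρ : ℝ} (hρ : ρ ≠ 0) {n : A} (h : vacuumElement ρ n ∈ I) : n ∈ I := by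
  refine mem_of_star_mul_self_mem I hI ?_
  have := I.smul_of_tower_mem (ρ ^ 2) h
  rwa [vacuumElement, smul_inv_smul₀ (pow_ne_zero 2 hρ)] at this

end VacuumVector
-- Models without torus parameters, their limits and their entries
section Models

variable (q : Set.Ioo (0 : ℝ) 1)

/-! ### The representations without torus parameters -/

theorem isSUqThree_V₂₁ : IsSUqThree q (V₁₂ q (0 : Fin 2) * V₂₃ q 1) :=
  (isSUqThree_V₁₂ q 0).mul (isSUqThree_V₂₃ q 1) fun i j k l => (commute_V q (by decide) i j k l).1.2

theorem isSUqThree_V₂₂ : IsSUqThree q (V₂₃ q (1 : Fin 2) * V₁₂ q 0) :=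
  (isSUqThree_V₂₃ q 1).mul (isSUqThree_V₁₂ q 0) fun i j k l => (commute_V q (by decide) i j k l).2.1

theorem isSUqThree_V₃ : IsSUqThree q (V₂₃ q (2 : Fin 3) * V₁₂ q 0 * V₂₃ q 1) := by
  refine IsSUqThree.mul (((isSUqThree_V₂₃ q 2).mul (isSUqThree_V₁₂ q 0) fun i j k l =>
    (commute_V q (by decide) i j k l).2.1)) (isSUqThree_V₂₃ q 1) fun i j k l => ?_
  rw [Matrix.mul_apply]
  exact Commute.sum_left _ _ _ fun m _ =>
    (commute_V q (by decide) i m k l).2.2.mul_left (commute_V q (by decide) m j k l).1.2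

theorem isSUqThree_one (r : ℝ) (B : Type u) [CStarAlgebra B] :
    IsSUqThree r (1 : Matrix (Fin 3) (Fin 3) B) := by
  have h := isSUqThree_torusMatrix r B (t₁ := 1) (t₂ := 1) (t₃ := 1) norm_one norm_one norm_one
    (by norm_num)
  have e : torusMatrix B 1 1 1 = 1 := by
    ext a b
    fin_cases a <;> fin_cases b <;> simp [torusMatrix]
  rwa [e] at h

/-- The representation which sends the matrix of generators to `V₂₃ V₁₂ V₂₃`. -/
def model₃ : CSUqThree q →⋆ₐ[ℂ] (Hil 3 →L[ℂ] Hil 3) := lift _ (isSUqThree_V₃ q)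

/-- The representation which sends the matrix of generators to `V₁₂ V₂₃`. -/
def model₂₁ : CSUqThree q →⋆ₐ[ℂ] (Hil 2 →L[ℂ] Hil 2) := lift _ (isSUqThree_V₂₁ q)

/-- The representation which sends the matrix of generators to `V₂₃ V₁₂`. -/
def model₂₂ : CSUqThree q →⋆ₐ[ℂ] (Hil 2 →L[ℂ] Hil 2) := lift _ (isSUqThree_V₂₂ q)

/-- The representation which sends the matrix of generators to `V₁₂`. -/
def model₁₁ : CSUqThree q →⋆ₐ[ℂ] (Hil 1 →L[ℂ] Hil 1) := lift _ (isSUqThree_V₁₂ q 0)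

/-- The representation which sends the matrix of generators to `V₂₃`. -/
def model₁₂ : CSUqThree q →⋆ₐ[ℂ] (Hil 1 →L[ℂ] Hil 1) := lift _ (isSUqThree_V₂₃ q 0)

/-- The representation on `ℓ²(ℕ⁰)` which sends the matrix of generators to `1`. -/
def model₀ : CSUqThree q →⋆ₐ[ℂ] (Hil 0 →L[ℂ] Hil 0) := lift _ (isSUqThree_one q _)

variable {q}

/-- Multiplication by a torus matrix on the right corresponds to precomposition with the gauge
automorphism with the same parameters, and this fixes `x`. Hence the phases are irrelevant on the
fixed point algebra. -/
theorem lift_mul_torus {B : Type u} [CStarAlgebra B] {v : Matrix (Fin 3) (Fin 3) B}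
    (hv : IsSUqThree q v) {t₁ t₂ t₃ : ℂ} (h₁ : ‖t₁‖ = 1) (h₂ : ‖t₂‖ = 1) (h : t₁ * t₂ * t₃ = 1)
    (hv' : IsSUqThree q (v * torusMatrix B t₁ t₂ t₃)) (x : flagAlgebra q) :
    lift _ hv' x = lift v hv x := by
  let z₁ : Circle := ⟨t₁, mem_sphere_zero_iff_norm.2 h₁⟩
  let z₂ : Circle := ⟨t₂, mem_sphere_zero_iff_norm.2 h₂⟩
  have h₃ : t₃ = ((z₁ * z₂)⁻¹ : Circle) := by
    rw [Circle.coe_inv, Circle.coe_mul]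
    exact eq_inv_of_mul_eq_one_right h
  have e : lift _ hv' = (lift v hv).comp (gauge q z₁ z₂) := hom_ext fun i j => by
    rw [lift_gen, StarAlgHom.comp_apply, gauge_gen, map_smul, lift_gen, Matrix.mul_apply,
      Fin.sum_univ_three, h₃]
    have hs : ∀ (t : ℂ) (x : B), x * algebraMap ℂ _ t = t • x := fun t x => by
      rw [Algebra.smul_def, Algebra.commutes]
    fin_cases j <;> simp only [torusMatrix] <;> simp [hs, -map_mul, -map_inv₀] <;> rfl
  have hx : gauge q z₁ z₂ x = x := x.2 z₁ z₂
  rw [e, StarAlgHom.comp_apply, hx]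

theorem ρ₃_apply (x : flagAlgebra q) : ρ₃ q x = model₃ q x :=
  lift_mul_torus (isSUqThree_V₃ q) (Circle.norm_coe _) (Circle.norm_coe _) (phase_aux 1 1) _ x

theorem ρ₂₁_apply (x : flagAlgebra q) : ρ₂₁ q x = model₂₁ q x :=
  lift_mul_torus (isSUqThree_V₂₁ q) (Circle.norm_coe _) (Circle.norm_coe _) (phase_aux 1 1) _ x

theorem ρ₂₂_apply (x : flagAlgebra q) : ρ₂₂ q x = model₂₂ q x :=
  lift_mul_torus (isSUqThree_V₂₂ q) (Circle.norm_coe _) (norm_neg_coe _)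
    (by have := torus_inv_mul 1 1; linear_combination this) _ x

theorem ρ₁₁_apply (x : flagAlgebra q) : ρ₁₁ q x = model₁₁ q x :=
  lift_mul_torus (isSUqThree_V₁₂ q 0) (Circle.norm_coe _) (norm_neg_coe _)
    (by have := torus_inv_mul 1 1; linear_combination this) _ x

theorem ρ₁₂_apply (x : flagAlgebra q) : ρ₁₂ q x = model₁₂ q x :=
  lift_mul_torus (isSUqThree_V₂₃ q 0) (norm_neg_coe _) (Circle.norm_coe _)
    (by have := torus_inv_mul 1 1; linear_combination this) _ x

/-- All representations sending the generators to the identity matrix factor through one character.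
This compares `ρ₀`, defined on `ℂ`, with the model on `ℓ²(ℕ⁰)`, which fits the degeneration of `Hil
(k + 1)` to `Hil k`. -/
theorem lift_one_apply (D : Type u) [CStarAlgebra D] (x : CSUqThree q) :
    lift _ (isSUqThree_one q D) x = algebraMap ℂ D (lift _ (isSUqThree_one q ℂ) x) := by
  have key : lift _ (isSUqThree_one q D) = (StarAlgHom.ofId ℂ D).comp (lift _ (isSUqThree_one q ℂ)) :=
    hom_ext fun i j => by
      rw [StarAlgHom.comp_apply, lift_gen, lift_gen, Matrix.one_apply, Matrix.one_apply]
      split_ifs <;> simp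
  rw [key]
  rfl

theorem lift_one_eq_zero_iff (D : Type u) [CStarAlgebra D] [Nontrivial D] (x : CSUqThree q) :
    lift _ (isSUqThree_one q D) x = 0 ↔ lift _ (isSUqThree_one q ℂ) x = 0 := by
  rw [lift_one_apply, map_eq_zero_iff _ (algebraMap ℂ D).injective]

theorem ρ₀_apply_eq_zero_iff (x : flagAlgebra q) : ρ₀ q x = 0 ↔ model₀ q x = 0 := by
  have e : mat₀ 1 1 = 1 := by
    ext a b
    fin_cases a <;> fin_cases b <;> simp [mat₀, torusMatrix]
  have h : π₀ q 1 1 = lift _ (isSUqThree_one q (ℂ →L[ℂ] ℂ)) := hom_ext fun i j => by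
    rw [π₀, lift_gen, lift_gen, e]
  change π₀ q 1 1 x = 0 ↔ _
  rw [h]
  exact (lift_one_eq_zero_iff _ _).trans (lift_one_eq_zero_iff (Hil 0 →L[ℂ] Hil 0) _).symm

/-! ### Limits of the representations -/

/-- The matrix in the factor sent to infinity becomes 1, and the remaining factors are renumbered by
`succAbove`. Deleting the first or the last factor of `V₂₃ V₁₂ V₂₃` leaves the two models on
`ℓ²(ℕ²)`; deleting one more leaves those on `ℓ²(ℕ)`, then the character. -/
theorem slotLimit_model₃_model₂₁ (a b : Fin 3) :
    SlotLimit 2 (model₃ q (gen q a b)) (model₂₁ q (gen q a b)) := by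
  rw [model₃, model₂₁, lift_gen, lift_gen, ← one_mul (V₁₂ q (0 : Fin 2))]
  exact SlotLimit.matrix_mul (SlotLimit.matrix_mul (fun a b => (slotLimit_V a b).2)
    (fun a b => (slotLimit_V_succAbove (j := (2 : Fin 3)) 0 a b).1))
    (fun a b => (slotLimit_V_succAbove (j := (2 : Fin 3)) 1 a b).2) a b

theorem slotLimit_model₃_model₂₂ (a b : Fin 3) :
    SlotLimit 1 (model₃ q (gen q a b)) (model₂₂ q (gen q a b)) := by
  rw [model₃, model₂₂, lift_gen, lift_gen, ← mul_one (_ * V₁₂ q (0 : Fin 2))]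
  exact SlotLimit.matrix_mul (SlotLimit.matrix_mul
    (fun a b => (slotLimit_V_succAbove (j := (1 : Fin 3)) 1 a b).2)
    (fun a b => (slotLimit_V_succAbove (j := (1 : Fin 3)) 0 a b).1))
    (fun a b => (slotLimit_V a b).2) a b

theorem slotLimit_model₂₁_model₁₁ (a b : Fin 3) :
    SlotLimit 1 (model₂₁ q (gen q a b)) (model₁₁ q (gen q a b)) := by
  rw [model₂₁, model₁₁, lift_gen, lift_gen, ← mul_one (V₁₂ q (0 : Fin 1))]
  exact SlotLimit.matrix_mul (fun a b => (slotLimit_V_succAbove (j := (1 : Fin 2)) 0 a b).1)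
    (fun a b => (slotLimit_V a b).2) a b

theorem slotLimit_model₂₁_model₁₂ (a b : Fin 3) :
    SlotLimit 0 (model₂₁ q (gen q a b)) (model₁₂ q (gen q a b)) := by
  rw [model₂₁, model₁₂, lift_gen, lift_gen, ← one_mul (V₂₃ q (0 : Fin 1))]
  exact SlotLimit.matrix_mul (fun a b => (slotLimit_V a b).1)
    (fun a b => (slotLimit_V_succAbove (j := (0 : Fin 2)) 0 a b).2) a b

theorem slotLimit_model₂₂_model₁₁ (a b : Fin 3) :
    SlotLimit 1 (model₂₂ q (gen q a b)) (model₁₁ q (gen q a b)) := by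
  rw [model₂₂, model₁₁, lift_gen, lift_gen, ← one_mul (V₁₂ q (0 : Fin 1))]
  exact SlotLimit.matrix_mul (fun a b => (slotLimit_V a b).2)
    (fun a b => (slotLimit_V_succAbove (j := (1 : Fin 2)) 0 a b).1) a b

theorem slotLimit_model₂₂_model₁₂ (a b : Fin 3) :
    SlotLimit 0 (model₂₂ q (gen q a b)) (model₁₂ q (gen q a b)) := by
  rw [model₂₂, model₁₂, lift_gen, lift_gen, ← mul_one (V₂₃ q (0 : Fin 1))]
  exact SlotLimit.matrix_mul (fun a b => (slotLimit_V_succAbove (j := (0 : Fin 2)) 0 a b).2)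
    (fun a b => (slotLimit_V a b).1) a b

theorem slotLimit_model₁₁_model₀ (a b : Fin 3) :
    SlotLimit 0 (model₁₁ q (gen q a b)) (model₀ q (gen q a b)) := by
  rw [model₁₁, model₀, lift_gen, lift_gen]
  exact (slotLimit_V a b).1

theorem slotLimit_model₁₂_model₀ (a b : Fin 3) :
    SlotLimit 0 (model₁₂ q (gen q a b)) (model₀ q (gen q a b)) := by
  rw [model₁₂, model₀, lift_gen, lift_gen]
  exact (slotLimit_V a b).2

theorem model_eq_zero {k : ℕ} {j : Fin (k + 1)}
    {π : CSUqThree q →⋆ₐ[ℂ] (Hil (k + 1) →L[ℂ] Hil (k + 1))}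
    {σ : CSUqThree q →⋆ₐ[ℂ] (Hil k →L[ℂ] Hil k)}
    (h : ∀ a b, SlotLimit j (π (gen q a b)) (σ (gen q a b))) {x : CSUqThree q} (hx : π x = 0) :
    σ x = 0 :=
  eq_zero_of_isCompactOperator h (by rw [hx]; exact isCompactOperator_zero)

/-! ### Entries of the representations -/

theorem model₃_entries : model₃ q (gen q 0 2) = ((q : ℂ) ^ 2) • (diagOp q 0 * diagOp q 1) ∧
    model₃ q (gen q 2 0) = diagOp q 2 * diagOp q 0 := by
  rw [model₃, lift_gen, lift_gen]
  constructor <;> simp [V₁₂, V₂₃, block₁₂, block₂₃, Matrix.mul_apply, Fin.sum_univ_three,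
    -Complex.coe_smul, smul_smul, sq]

theorem model₂₁_entries : model₂₁ q (gen q 0 2) = ((q : ℂ) ^ 2) • (diagOp q 0 * diagOp q 1) ∧
    model₂₁ q (gen q 2 0) = 0 := by
  rw [model₂₁, lift_gen, lift_gen]
  constructor <;> simp [V₁₂, V₂₃, block₁₂, block₂₃, Matrix.mul_apply, Fin.sum_univ_three,
    -Complex.coe_smul, smul_smul, sq]

theorem model₂₂_entries : model₂₂ q (gen q 2 0) = diagOp q 1 * diagOp q 0 ∧
    model₂₂ q (gen q 0 2) = 0 := by
  rw [model₂₂, lift_gen, lift_gen]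
  constructor <;> simp [V₁₂, V₂₃, block₁₂, block₂₃, Matrix.mul_apply, Fin.sum_univ_three,
    -Complex.coe_smul]

theorem model₁₁_entries : model₁₁ q (gen q 0 1) = -((q : ℂ) • diagOp q 0) ∧
    model₁₁ q (gen q 0 2) = 0 ∧ model₁₁ q (gen q 1 2) = 0 ∧ model₁₁ q (gen q 2 0) = 0 ∧
    model₁₁ q (gen q 2 1) = 0 := by
  simp only [model₁₁, lift_gen]
  simp [V₁₂, block₁₂]

theorem model₁₂_entries : model₁₂ q (gen q 1 2) = -((q : ℂ) • diagOp q 0) ∧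
    model₁₂ q (gen q 0 2) = 0 ∧ model₁₂ q (gen q 0 1) = 0 ∧ model₁₂ q (gen q 2 0) = 0 ∧
    model₁₂ q (gen q 1 0) = 0 := by
  simp only [model₁₂, lift_gen]
  simp [V₂₃, block₂₃]

theorem model₀_gen_of_ne {i j : Fin 3} (h : i ≠ j) : model₀ q (gen q i j) = 0 := by
  rw [model₀, lift_gen, Matrix.one_apply_ne h]

end Models

/-! ### Entries forced to vanish by the vanishing of others -/

section Vanishing

variable {q : ℝ} {B : Type u} [CStarAlgebra B] {v : Matrix (Fin 3) (Fin 3) B}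

/-- The weighted relation of row 0 makes `v 0 0` an isometry, which exhausts the unitarity relation
of column 0. -/
theorem IsSUqThree.entry_one_zero_eq_zero (hv : IsSUqThree q v) (hq : 0 < q) (h₀₁ : v 0 1 = 0)
    (h₀₂ : v 0 2 = 0) (h₂₀ : v 2 0 = 0) : v 1 0 = 0 := by
  have h1 := hv.weighted_zero hq
  have h2 := hv.col_zero
  simp only [h₀₁, h₀₂, mul_zero, smul_zero, add_zero] at h1
  rw [h1, h₂₀, mul_zero, add_zero, add_eq_left] at h2
  exact (CStarRing.star_mul_self_eq_zero_iff _).1 h2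

/-- Unitarity of column 2 makes `v 2 2` an isometry, which exhausts the weighted relation of row 2.
-/
theorem IsSUqThree.entry_two_one_eq_zero (hv : IsSUqThree q v) (hq : 0 < q) (h₀₂ : v 0 2 = 0)
    (h₁₂ : v 1 2 = 0) (h₂₀ : v 2 0 = 0) : v 2 1 = 0 := by
  have h1 := hv.weighted_real hq 2
  have h2 := hv.sum_star_mul 2 2
  simp only [Fin.sum_univ_three, h₀₂, h₁₂, mul_zero, zero_add, if_true] at h2
  rw [h2, h₂₀] at h1
  simp only [mul_zero, smul_zero, zero_add] at h1
  have h3 : q ^ 2 • (star (v 2 1) * v 2 1) = 0 := by simpa using h1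
  exact (CStarRing.star_mul_self_eq_zero_iff _).1
    ((smul_eq_zero.1 h3).resolve_left (pow_ne_zero 2 hq.ne'))

theorem IsSUqThree.mul_eq_zero_of_corners (hv : IsSUqThree q v) (h₀₂ : v 0 2 = 0)
    (h₂₀ : v 2 0 = 0) : v 0 1 * v 1 2 = 0 := by
  have h := hv.cofactor 2 0
  simp only [fstOther, sndOther, Matrix.cons_val, h₂₀, h₀₂, star_zero, smul_zero, zero_mul,
    sub_zero, Fin.val_zero, pow_zero, one_smul] at h
  exact h.symm

end Vanishing

/-! ### Elements killed by a model lie in the ideals of its stratum -/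

section Strata

open Filter Topology

variable {q : Set.Ioo (0 : ℝ) 1} {I : Ideal (CSUqThree q)}

/-- Modulo `I`, the element `n` moves past every word up to a scalar, so a single product `n * m` in
`I` already gives `n A m ⊆ I`. -/
theorem mem_rightAnn_of_scaled (hI : IsClosed (I : Set (CSUqThree q))) {B : Type*} [CStarAlgebra B]
    {f : CSUqThree q →⋆ₐ[ℂ] B} (hf : ∀ x, f x = 0 ↔ x ∈ I) {n m : CSUqThree q}
    (h : ∀ i j, ∃ c : ℂ, f n * f (gen q i j) = c • (f (gen q i j) * f n)) (hnm : n * m ∈ I) :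
    m ∈ rightAnn I n := by
  intro b
  let L : CSUqThree q →ₗ[ℂ] CSUqThree q :=
    (LinearMap.mulRight ℂ m).comp (LinearMap.mulLeft ℂ n)
  have hL : ∀ b, L b = n * b * m := fun b => rfl
  have hLc : Continuous L := by
    have : Continuous fun b => n * b * m := by fun_prop
    exact this
  refine mem_of_word_mem q.2.1.ne' ((I.restrictScalars ℂ).comap L) (hI.preimage hLc) (fun w => ?_) b
  change n * word (gen q) w * m ∈ I
  have key : ∃ c : ℂ, f n * f (word (gen q) w) = c • (f (word (gen q) w) * f n) := by
    induction w with
    | nil => exact ⟨1, by simp⟩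
    | cons p w ih =>
      obtain ⟨c, hc⟩ := h p.1 p.2
      obtain ⟨d, hd⟩ := ih
      refine ⟨c * d, ?_⟩
      rw [word_cons, map_mul, ← mul_assoc, hc, smul_mul_assoc, mul_assoc, hd, mul_smul_comm,
        smul_smul, mul_assoc]
  obtain ⟨c, hc⟩ := key
  rw [← hf] at hnm ⊢
  rw [map_mul] at hnm
  rw [map_mul, map_mul, hc, smul_mul_assoc, mul_assoc, hnm, mul_zero, smul_zero]

variable [I.IsTwoSided]

/-- An entry which vanishes modulo relations that hold in a quotient belongs to the ideal. -/
theorem gen_mem_of_forall_quotient (hI : IsClosed (I : Set (CSUqThree q))) {a : CSUqThree q}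
    (h : ∀ (B : Type 1) [CStarAlgebra B] (f : CSUqThree q →⋆ₐ[ℂ] B), (∀ x, f x = 0 ↔ x ∈ I) →
      f a = 0) : a ∈ I := by
  obtain ⟨B, _, f, -, hf⟩ := exists_quotient I hI
  exact (hf a).1 (h B f hf)

theorem gen_one_zero_mem (hI : IsClosed (I : Set (CSUqThree q))) (h₀₁ : gen q 0 1 ∈ I)
    (h₀₂ : gen q 0 2 ∈ I) (h₂₀ : gen q 2 0 ∈ I) : gen q 1 0 ∈ I :=
  gen_mem_of_forall_quotient hI fun _ _ f hf => (map_gen_isSUqThree f).entry_one_zero_eq_zero q.2.1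
    ((hf _).2 h₀₁) ((hf _).2 h₀₂) ((hf _).2 h₂₀)

theorem gen_two_one_mem (hI : IsClosed (I : Set (CSUqThree q))) (h₀₂ : gen q 0 2 ∈ I)
    (h₁₂ : gen q 1 2 ∈ I) (h₂₀ : gen q 2 0 ∈ I) : gen q 2 1 ∈ I :=
  gen_mem_of_forall_quotient hI fun _ _ f hf => (map_gen_isSUqThree f).entry_two_one_eq_zero q.2.1
    ((hf _).2 h₀₂) ((hf _).2 h₁₂) ((hf _).2 h₂₀)

variable {x : CSUqThree q} (hx : x ∈ flagAlgebra q)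

include hx

/-- With the identity as vacuum element, the inductive step puts 1 into the annihilator of `x`. -/
theorem mem_of_model₀ (hI : IsClosed (I : Set (CSUqThree q)))
    (h : ∀ i j, i ≠ j → gen q i j ∈ I) (hx₀ : model₀ q x = 0) : x ∈ I := by
  have h1 : (1 : CSUqThree q) ∈ rightAnn I x := by
    refine mul_mul_mem_of_isVacuum (Z := {p | p.1 ≠ p.2}) (s := 0) (w := id) q.2.1
      (fun B _ f hf => ?_) I hI (fun p hp => h _ _ hp) (model₀ q)
      (fun p hp => model₀_gen_of_ne hp) ?_ hx hx₀
    · rw [map_one]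
      exact isVacuum_one fun i j hij => hf (i, j) hij
    · rw [map_one]
      exact not_tendsto_pow_of_apply_eq vacuumVector_ne_zero rfl
  simpa using h1 1

/-- The vacuum argument puts the entry `(0, 1)` into the annihilator `R` of `x`, which forces `(1,
0)` into `R` as well. All off-diagonal entries then lie in `R`, so the character, which kills `x` by
degeneration, gives `x ∈ R`; semiprimeness concludes. The higher strata follow the same pattern. -/
theorem mem_of_model₁₁ (hI : IsClosed (I : Set (CSUqThree q))) (h₀₂ : gen q 0 2 ∈ I)
    (h₁₂ : gen q 1 2 ∈ I) (h₂₀ : gen q 2 0 ∈ I) (h₂₁ : gen q 2 1 ∈ I) (hx₀ : model₁₁ q x = 0) :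
    x ∈ I := by
  obtain ⟨e₀₁, e₀₂, e₁₂, e₂₀, e₂₁⟩ := model₁₁_entries (q := q)
  have hR := isClosed_rightAnn hI x
  have h₀₁ : gen q 0 1 ∈ rightAnn I x := by
    refine mem_of_vacuumElement_mem hR q.2.1.ne' (mul_mul_mem_of_isVacuum
      (Z := {(0, 2), (1, 2), (2, 0), (2, 1)}) (s := (q : ℝ) ^ 2) (w := ![1, 0, 2]) q.2.1 (fun B _ f hf => ?_) I hI
      (by simp [*]) (model₁₁ q) (by simp [*]) ?_ hx hx₀)
    · rw [map_vacuumElement]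
      exact (map_gen_isSUqThree f).isVacuum₁₁ q.2.1 q.2.2 (hf (0, 2) (by simp))
        (hf (1, 2) (by simp)) (hf (2, 0) (by simp)) (hf (2, 1) (by simp))
    · rw [map_vacuumElement]
      refine not_tendsto_pow_of_apply_eq vacuumVector_ne_zero (vacuumElement_apply_eq (c := -(q : ℝ))
        q.2.1.ne' (neg_sq _) ?_ ?_)
      · rw [e₀₁, neg_apply, smul_apply, diagOp_vacuumVector]
        simp
      · simp [e₀₁, star_diagOp]
  have l := le_rightAnn (I := I) x
  have h₁₀ := gen_one_zero_mem hR h₀₁ (l h₀₂) (l h₂₀)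
  refine mem_of_mem_rightAnn hI (mem_of_model₀ hx hR ?_
    (model_eq_zero slotLimit_model₁₁_model₀ hx₀))
  exact forall_fin_three (fun h => absurd rfl h) (fun _ => h₀₁) (fun _ => l h₀₂) (fun _ => h₁₀)
    (fun h => absurd rfl h) (fun _ => l h₁₂) (fun _ => l h₂₀) (fun _ => l h₂₁)
    (fun h => absurd rfl h)

theorem mem_of_model₁₂ (hI : IsClosed (I : Set (CSUqThree q))) (h₀₂ : gen q 0 2 ∈ I)
    (h₀₁ : gen q 0 1 ∈ I) (h₂₀ : gen q 2 0 ∈ I) (h₁₀ : gen q 1 0 ∈ I) (hx₀ : model₁₂ q x = 0) :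
    x ∈ I := by
  obtain ⟨e₁₂, e₀₂, e₀₁, e₂₀, e₁₀⟩ := model₁₂_entries (q := q)
  have hR := isClosed_rightAnn hI x
  have h₁₂ : gen q 1 2 ∈ rightAnn I x := by
    refine mem_of_vacuumElement_mem hR q.2.1.ne' (mul_mul_mem_of_isVacuum
      (Z := {(0, 2), (0, 1), (2, 0), (1, 0)}) (s := (q : ℝ) ^ 2) (w := ![0, 2, 1]) q.2.1 (fun B _ f hf => ?_) I hI
      (by simp [*]) (model₁₂ q) (by simp [*]) ?_ hx hx₀)
    · rw [map_vacuumElement]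
      exact (map_gen_isSUqThree f).isVacuum₁₂ q.2.1 q.2.2 (hf (0, 2) (by simp))
        (hf (0, 1) (by simp)) (hf (2, 0) (by simp)) (hf (1, 0) (by simp))
    · rw [map_vacuumElement]
      refine not_tendsto_pow_of_apply_eq vacuumVector_ne_zero (vacuumElement_apply_eq (c := -(q : ℝ))
        q.2.1.ne' (neg_sq _) ?_ ?_)
      · rw [e₁₂, neg_apply, smul_apply, diagOp_vacuumVector]
        simp
      · simp [e₁₂, star_diagOp]
  have l := le_rightAnn (I := I) x
  have h₂₁ := gen_two_one_mem hR (l h₀₂) h₁₂ (l h₂₀)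
  refine mem_of_mem_rightAnn hI (mem_of_model₀ hx hR ?_
    (model_eq_zero slotLimit_model₁₂_model₀ hx₀))
  exact forall_fin_three (fun h => absurd rfl h) (fun _ => l h₀₁) (fun _ => l h₀₂) (fun _ => l h₁₀)
    (fun h => absurd rfl h) (fun _ => h₁₂) (fun _ => l h₂₀) (fun _ => h₂₁)
    (fun h => absurd rfl h)

/-- When both corners vanish, so does `u₀₁ A u₁₂`, and the stratum is the union of the loci `u₀₁ =
0` and `u₁₂ = 0`. The annihilator of `u₀₁` contains `u₁₂`, which gives `u₀₁ A x ⊆ I` by the first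
model; the left annihilator of `x` then contains `u₀₁`, which gives `x A x ⊆ I` by the second. -/
theorem mem_of_model₁₁_of_model₁₂ (hI : IsClosed (I : Set (CSUqThree q))) (h₀₂ : gen q 0 2 ∈ I)
    (h₂₀ : gen q 2 0 ∈ I) (hx₁ : model₁₁ q x = 0) (hx₂ : model₁₂ q x = 0) : x ∈ I := by
  have h₁₂ : gen q 1 2 ∈ rightAnn I (gen q 0 1) := by
    obtain ⟨B, _, f, -, hf⟩ := exists_quotient I hI
    have hv := map_gen_isSUqThree f
    refine mem_rightAnn_of_scaled hI hf
      (fun i j => ⟨_, hv.scaled_first q.2.1 ((hf _).2 h₀₂) i j⟩) ?_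
    rw [← hf, map_mul]
    exact hv.mul_eq_zero_of_corners ((hf _).2 h₀₂) ((hf _).2 h₂₀)
  have hR := isClosed_rightAnn hI (gen q 0 1)
  have l := le_rightAnn (I := I) (gen q 0 1)
  have h₂₁ := gen_two_one_mem hR (l h₀₂) h₁₂ (l h₂₀)
  have h1 := mem_of_model₁₁ hx hR (l h₀₂) h₁₂ (l h₂₀) h₂₁ hx₁
  -- The conditions `x ∈ rightAnn I u₀₁` and `u₀₁ ∈ leftAnn I x` both say that `u₀₁ A x ⊆ I`.
  have h₀₁ : gen q 0 1 ∈ leftAnn I x := fun b => h1 b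
  have hL := isClosed_leftAnn hI x
  have l' := le_leftAnn (I := I) x
  have h₁₀ := gen_one_zero_mem hL h₀₁ (l' h₀₂) (l' h₂₀)
  have h2 := mem_of_model₁₂ hx hL (l' h₀₂) h₀₁ (l' h₂₀) h₁₀ hx₂
  exact mem_of_mem_rightAnn hI fun b => h2 b

theorem mem_of_model₂₁ (hI : IsClosed (I : Set (CSUqThree q))) (h₂₀ : gen q 2 0 ∈ I)
    (hx₀ : model₂₁ q x = 0) : x ∈ I := by
  obtain ⟨e₀₂, e₂₀⟩ := model₂₁_entries (q := q)
  have hR := isClosed_rightAnn hI x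
  have h₀₂ : gen q 0 2 ∈ rightAnn I x := by
    refine mem_of_vacuumElement_mem hR (pow_ne_zero 2 q.2.1.ne') (mul_mul_mem_of_isVacuum
      (Z := {(2, 0)}) (s := (q : ℝ) ^ 2) (w := ![1, 2, 0]) q.2.1 (fun B _ f hf => ?_) I hI
      (by simp [*]) (model₂₁ q) (by simp [*]) ?_ hx hx₀)
    · rw [map_vacuumElement]
      exact (map_gen_isSUqThree f).isVacuum₂₁ q.2.1 q.2.2 (hf (2, 0) (by simp))
    · rw [map_vacuumElement]
      refine not_tendsto_pow_of_apply_eq vacuumVector_ne_zero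
        (vacuumElement_apply_eq (pow_ne_zero 2 q.2.1.ne') rfl ?_ ?_)
      · rw [e₀₂, smul_apply, mul_apply_eq_comp, diagOp_vacuumVector, diagOp_vacuumVector,
          Complex.ofReal_pow]
      · rw [e₀₂, star_smul, star_mul, star_diagOp, star_diagOp,
          (commute_ops q (show (1 : Fin 2) ≠ 0 by decide)).2.2.1, star_pow, Complex.star_def,
          Complex.conj_ofReal]
  exact mem_of_mem_rightAnn hI (mem_of_model₁₁_of_model₁₂ hx hR h₀₂ (le_rightAnn x h₂₀)
    (model_eq_zero slotLimit_model₂₁_model₁₁ hx₀) (model_eq_zero slotLimit_model₂₁_model₁₂ hx₀))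

theorem mem_of_model₂₂ (hI : IsClosed (I : Set (CSUqThree q))) (h₀₂ : gen q 0 2 ∈ I)
    (hx₀ : model₂₂ q x = 0) : x ∈ I := by
  obtain ⟨e₂₀, e₀₂⟩ := model₂₂_entries (q := q)
  have hR := isClosed_rightAnn hI x
  have h₂₀ : gen q 2 0 ∈ rightAnn I x := by
    refine mem_of_vacuumElement_mem hR one_ne_zero (mul_mul_mem_of_isVacuum
      (Z := {(0, 2)}) (s := (q : ℝ) ^ 2) (w := ![2, 0, 1]) q.2.1 (fun B _ f hf => ?_) I hI
      (by simp [*]) (model₂₂ q) (by simp [*]) ?_ hx hx₀)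
    · rw [map_vacuumElement]
      exact (map_gen_isSUqThree f).isVacuum₂₂ q.2.1 q.2.2 (hf (0, 2) (by simp))
    · rw [map_vacuumElement]
      refine not_tendsto_pow_of_apply_eq vacuumVector_ne_zero
        (vacuumElement_apply_eq one_ne_zero rfl ?_ ?_)
      · rw [e₂₀, mul_apply_eq_comp, diagOp_vacuumVector, diagOp_vacuumVector, Complex.ofReal_one,
          one_smul]
      · rw [e₂₀, star_mul, star_diagOp, star_diagOp,
          (commute_ops q (show (1 : Fin 2) ≠ 0 by decide)).2.2.1]
  exact mem_of_mem_rightAnn hI (mem_of_model₁₁_of_model₁₂ hx hR (le_rightAnn x h₀₂) h₂₀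
    (model_eq_zero slotLimit_model₂₂_model₁₁ hx₀) (model_eq_zero slotLimit_model₂₂_model₁₂ hx₀))

/-- The vacuum argument puts the product of the corners into the annihilator `J` of `x`; as the
corners commute with words up to scalars, `u₂₀ A u₀₂ ⊆ J`. The loci `u₀₂ = 0` and `u₂₀ = 0` are then
treated one after the other by the two models on `ℓ²(ℕ²)`, and semiprimeness is applied first to
`J`, then to the zero ideal. -/
theorem eq_zero_of_model₃ (hx₀ : model₃ q x = 0) : x = 0 := by
  obtain ⟨e₀₂, e₂₀⟩ := model₃_entries (q := q)
  have hbot : IsClosed ((⊥ : Ideal (CSUqThree q)) : Set (CSUqThree q)) := isClosed_singleton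
  set J := rightAnn (⊥ : Ideal (CSUqThree q)) x with hJdef
  have hJ : IsClosed (J : Set (CSUqThree q)) := isClosed_rightAnn hbot x
  have hn : gen q 0 2 * gen q 2 0 ∈ J := by
    refine mem_of_vacuumElement_mem hJ (pow_ne_zero 2 q.2.1.ne') (mul_mul_mem_of_isVacuum
      (Z := ∅) (s := (q : ℝ) ^ 2) (w := ![2, 1, 0]) q.2.1 (fun B _ f hf => ?_) ⊥ hbot
      (by simp) (model₃ q) (by simp) ?_ hx hx₀)
    · rw [map_vacuumElement, map_mul]
      exact (map_gen_isSUqThree f).isVacuum₃ q.2.1 q.2.2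
    · have c : ∀ {i j : Fin 3}, i ≠ j → Commute (diagOp q i) (diagOp q j) :=
        fun h => (commute_ops q h).2.2.1
      rw [map_vacuumElement, map_mul, e₀₂, e₂₀]
      refine not_tendsto_pow_of_apply_eq vacuumVector_ne_zero
        (vacuumElement_apply_eq (pow_ne_zero 2 q.2.1.ne') rfl ?_ ?_)
      · simp only [smul_apply, mul_apply_eq_comp, diagOp_vacuumVector, Complex.ofReal_pow]
      · have h02 : diagOp q (0 : Fin 3) * diagOp q 1 * (diagOp q 2 * diagOp q 0)
            = diagOp q 0 * diagOp q 2 * (diagOp q 1 * diagOp q 0) := by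
          rw [mul_assoc, mul_assoc, ← mul_assoc (diagOp q 1),
            (c (show (1 : Fin 3) ≠ 2 by decide)).eq, mul_assoc]
        rw [smul_mul_assoc, star_smul, star_mul, star_mul, star_mul, star_diagOp, star_diagOp,
          star_diagOp, h02, star_pow, Complex.star_def, Complex.conj_ofReal]
  have h₀₂ : gen q 0 2 ∈ rightAnn J (gen q 2 0) := by
    obtain ⟨B, _, f, -, hf⟩ := exists_quotient J hJ
    have hv := map_gen_isSUqThree f
    refine mem_rightAnn_of_scaled hJ hf (fun i j => ⟨_, hv.scaled_lower_left q.2.1 i j⟩) ?_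
    have := (isSUqThree_gen q).cross q.2.1 (show (0 : Fin 3) < 2 by decide)
      (show (0 : Fin 3) < 2 by decide)
    rwa [← this.1]
  have h1 := mem_of_model₂₂ hx (isClosed_rightAnn hJ (gen q 2 0)) h₀₂
    (model_eq_zero slotLimit_model₃_model₂₂ hx₀)
  have h2 := mem_of_model₂₁ hx (isClosed_leftAnn hJ x) (fun b => h1 b)
    (model_eq_zero slotLimit_model₃_model₂₁ hx₀)
  exact mem_of_mem_rightAnn hbot (mem_of_mem_rightAnn hJ fun b => h2 b)

end Strata

/-! ### Projections onto coordinate subspaces -/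

section DiagonalProjection

variable {ι : Type}

open Classical in
/-- The projection onto the span of the basis vectors with index in `s`. -/
def diagProj (s : Set ι) : lp (fun _ : ι => ℂ) 2 →L[ℂ] lp (fun _ : ι => ℂ) 2 :=
  ShiftData.op
    { w := fun n => if n ∈ s then 1 else 0
      σ := id
      abs_le := fun n => by split_ifs <;> simp
      inj := fun _ _ _ _ h => h }

open Classical in
theorem diagProj_apply (s : Set ι) (f : lp (fun _ : ι => ℂ) 2) (n : ι) :
    diagProj s f n = if n ∈ s then f n else 0 := by
  change (((if n ∈ s then 1 else 0 : ℝ)) : ℂ) * f n = _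
  split_ifs <;> simp

theorem op_ext {S T : lp (fun _ : ι => ℂ) 2 →L[ℂ] lp (fun _ : ι => ℂ) 2}
    (h : ∀ f n, S f n = T f n) : S = T :=
  ContinuousLinearMap.ext fun f => lp.ext (funext (h f))

theorem norm_op_le (S : ShiftData ι) : ‖S.op‖ ≤ 1 :=
  LinearMap.mkContinuous_norm_le _ zero_le_one _

theorem diagProj_mul (s t : Set ι) : diagProj s * diagProj t = diagProj (s ∩ t) :=
  op_ext fun f n => by
    rw [mul_apply_eq_comp, diagProj_apply, diagProj_apply, diagProj_apply]
    by_cases h1 : n ∈ s <;> by_cases h2 : n ∈ t <;> simp [h1, h2]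

theorem diagProj_union (s t : Set ι) :
    diagProj (s ∪ t) = diagProj s + diagProj t * diagProj sᶜ :=
  op_ext fun f n => by
    rw [add_apply, lp.coeFn_add, Pi.add_apply, mul_apply_eq_comp, diagProj_apply, diagProj_apply,
      diagProj_apply, diagProj_apply]
    by_cases h1 : n ∈ s <;> by_cases h2 : n ∈ t <;> simp [h1, h2]

theorem diagProj_add_compl (s : Set ι) : diagProj s + diagProj sᶜ = 1 :=
  op_ext fun f n => by
    rw [add_apply, lp.coeFn_add, Pi.add_apply, diagProj_apply, diagProj_apply]
    by_cases h1 : n ∈ s <;> simp [h1]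

theorem isCompactOperator_diagProj {s : Set ι} (hs : s.Finite) :
    IsCompactOperator (diagProj s : lp (fun _ : ι => ℂ) 2 →L[ℂ] lp (fun _ : ι => ℂ) 2) := by
  classical
  have e : diagProj s = ∑ n ∈ hs.toFinset,
      (ContinuousLinearMap.toSpanSingleton ℂ (lp.single 2 n 1 : lp (fun _ : ι => ℂ) 2)).comp
        (innerSL ℂ (lp.single 2 n 1 : lp (fun _ : ι => ℂ) 2)) := op_ext fun f n => by
    rw [sum_apply, lp.coeFn_sum, Finset.sum_apply, diagProj_apply]
    simp only [ContinuousLinearMap.comp_apply, innerSL_apply_apply, lp.inner_single_left,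
      ContinuousLinearMap.toSpanSingleton_apply, lp.coeFn_smul, Pi.smul_apply, lp.single_apply]
    simp [Pi.single_apply]
  rw [e]
  refine Submodule.sum_mem (compactOperator (RingHom.id ℂ) _ _) fun n _ => ?_
  have h : IsCompactOperator (id : ℂ → ℂ) := isCompactOperator_id
  exact (h.comp_clm (innerSL ℂ (lp.single 2 n 1 : lp (fun _ : ι => ℂ) 2))).clm_comp
    (ContinuousLinearMap.toSpanSingleton ℂ (lp.single 2 n 1 : lp (fun _ : ι => ℂ) 2))

end DiagonalProjection

/-! ### Operators that vanish asymptotically in a tensor factor -/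

section SlotNull

open Filter Topology

variable {k : ℕ} (j : Fin k)

/-- The projection onto the vectors whose occupation number in the tensor factor `j` is at least
`n`. -/
def tailProj (n : ℕ) : Hil k →L[ℂ] Hil k := diagProj {x | n ≤ x j}

/-- `T` does not lower the occupation number of the tensor factor `j` by an unbounded amount. -/
def SlotBounded (T : Hil k →L[ℂ] Hil k) : Prop :=
  ∀ m, ∀ᶠ n in atTop, T * tailProj j n = tailProj j m * T * tailProj j n

/-- `T` vanishes asymptotically for large occupation numbers of the tensor factor `j`. -/
def SlotNull (T : Hil k →L[ℂ] Hil k) : Prop :=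
  Tendsto (fun n => ‖T * tailProj j n‖) atTop (𝓝 0)

variable {j} {S T : Hil k →L[ℂ] Hil k}

theorem SlotBounded.add (hS : SlotBounded j S) (hT : SlotBounded j T) : SlotBounded j (S + T) :=
  fun m => by
    filter_upwards [hS m, hT m] with n h1 h2
    rw [add_mul, h1, h2, mul_add, add_mul]

theorem SlotBounded.smul (c : ℂ) (hT : SlotBounded j T) : SlotBounded j (c • T) := fun m => by
  filter_upwards [hT m] with n h
  rw [smul_mul_assoc, h, mul_smul_comm, smul_mul_assoc]

theorem SlotBounded.mul (hS : SlotBounded j S) (hT : SlotBounded j T) : SlotBounded j (S * T) :=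
  fun m => by
    obtain ⟨m', h'⟩ := (hS m).exists
    filter_upwards [hT m'] with n h
    calc S * T * tailProj j n = (S * tailProj j m') * (T * tailProj j n) := by
          conv_lhs => rw [mul_assoc, h]
          simp only [mul_assoc]
      _ = tailProj j m * (S * (tailProj j m' * T * tailProj j n)) := by
          rw [h']; simp only [mul_assoc]
      _ = _ := by rw [← h]; simp only [mul_assoc]

theorem slotBounded_op (D : ShiftData (Fin k → ℕ)) (h : ∀ x, D.σ x j ≤ x j + 1) :
    SlotBounded j D.op := fun m => by
  filter_upwards [eventually_gt_atTop m] with n hn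
  refine op_ext fun f x => ?_
  rw [mul_assoc, mul_apply_eq_comp, mul_apply_eq_comp, mul_apply_eq_comp, tailProj, tailProj,
    diagProj_apply, ShiftData.op_apply, diagProj_apply]
  by_cases h1 : x ∈ {x : Fin k → ℕ | m ≤ x j}
  · rw [if_pos h1]
  · have h2 : ¬ D.σ x ∈ {x : Fin k → ℕ | n ≤ x j} := fun h3 => h1 (by
      have h4 := h x
      have h5 : n ≤ D.σ x j := h3
      change m ≤ x j
      omega)
    rw [if_neg h1, if_neg h2, mul_zero]

theorem slotBounded_one : SlotBounded j (1 : Hil k →L[ℂ] Hil k) := fun m => by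
  filter_upwards [eventually_ge_atTop m] with n hn
  rw [mul_one, one_mul, tailProj, tailProj, diagProj_mul]
  congr 1
  ext x
  exact ⟨fun h => ⟨hn.trans h, h⟩, fun h => h.2⟩

theorem slotBounded_zero : SlotBounded j (0 : Hil k →L[ℂ] Hil k) := fun m => by simp

variable (q : Set.Ioo (0 : ℝ) 1)

theorem slotBounded_diagOp (i : Fin k) : SlotBounded j (diagOp q i) :=
  slotBounded_op _ fun _ => Nat.le_succ _

theorem slotBounded_lowerOp (i : Fin k) : SlotBounded j (lowerOp q i) :=
  slotBounded_op _ fun x => by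
    change Function.update x i (x i + 1) j ≤ x j + 1
    by_cases h : j = i
    · subst h; simp
    · rw [Function.update_of_ne h]; omega

theorem slotBounded_star_lowerOp (i : Fin k) : SlotBounded j (star (lowerOp q i)) := by
  rw [star_lowerOp]
  refine slotBounded_op _ fun x => ?_
  change Function.update x i (x i - 1) j ≤ x j + 1
  by_cases h : j = i
  · subst h; simp; omega
  · rw [Function.update_of_ne h]; omega

theorem slotBounded_V (i : Fin k) (l m : Fin 3) :
    SlotBounded j (V₁₂ q i l m) ∧ SlotBounded j (V₂₃ q i l m) := by
  have ha : SlotBounded j (lowerOp q i) := slotBounded_lowerOp q i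
  have hs : SlotBounded j (star (lowerOp q i)) := slotBounded_star_lowerOp q i
  have hc : SlotBounded j (diagOp q i) := slotBounded_diagOp q i
  have hn : SlotBounded j (-(((q : ℝ) : ℂ) • diagOp q i)) := by
    simpa using (hc.smul ((q : ℝ) : ℂ)).smul (-1)
  have h0 : SlotBounded j (0 : Hil k →L[ℂ] Hil k) := slotBounded_zero
  have h1 : SlotBounded j (1 : Hil k →L[ℂ] Hil k) := slotBounded_one
  constructor <;> fin_cases l <;> fin_cases m <;> assumption

theorem SlotBounded.matrix_mul {M N : Matrix (Fin 3) (Fin 3) (Hil k →L[ℂ] Hil k)}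
    (hM : ∀ a b, SlotBounded j (M a b)) (hN : ∀ a b, SlotBounded j (N a b)) (a b : Fin 3) :
    SlotBounded j ((M * N) a b) := by
  rw [Matrix.mul_apply, Fin.sum_univ_three]
  exact (((hM _ _).mul (hN _ _)).add ((hM _ _).mul (hN _ _))).add ((hM _ _).mul (hN _ _))

variable {q}

theorem norm_tailProj_le (n : ℕ) : ‖tailProj j n‖ ≤ 1 := norm_op_le _

theorem SlotNull.add (hS : SlotNull j S) (hT : SlotNull j T) : SlotNull j (S + T) := by
  refine squeeze_zero (fun _ => norm_nonneg _) (fun n => ?_) (by simpa using Tendsto.add hS hT)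
  rw [add_mul]
  exact norm_add_le _ _

theorem SlotNull.mul_left (S : Hil k →L[ℂ] Hil k) (hT : SlotNull j T) : SlotNull j (S * T) := by
  refine squeeze_zero (fun _ => norm_nonneg _) (fun n => ?_)
    (by simpa using Tendsto.const_mul ‖S‖ hT)
  rw [mul_assoc]
  exact norm_mul_le _ _

theorem SlotNull.smul (c : ℂ) (hT : SlotNull j T) : SlotNull j (c • T) := by
  have := hT.mul_left (c • 1)
  rwa [smul_mul_assoc, one_mul] at this

theorem slotNull_zero : SlotNull j (0 : Hil k →L[ℂ] Hil k) := by
  refine tendsto_const_nhds.congr fun n => ?_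
  rw [zero_mul, norm_zero]

/-- On vectors with very large occupation number, `T` takes values of still large occupation number,
where `S` is small. Boundedness of the lowering is essential here. -/
theorem SlotNull.mul_right (hS : SlotNull j S) (hT : SlotBounded j T) : SlotNull j (S * T) := by
  refine Metric.tendsto_atTop.2 fun ε hε => ?_
  obtain ⟨m, hm⟩ := Metric.tendsto_atTop.1 hS (ε / (‖T‖ + 1)) (by positivity)
  obtain ⟨N, hN⟩ := eventually_atTop.1 (hT m)
  refine ⟨N, fun n hn => ?_⟩
  have h1 := hm m le_rfl
  rw [dist_zero_right, norm_norm] at h1 ⊢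
  have h2 : S * T * tailProj j n = (S * tailProj j m) * (T * tailProj j n) := by
    conv_lhs => rw [mul_assoc, hN n hn]
    simp only [mul_assoc]
  have h3 : ‖T * tailProj j n‖ ≤ ‖T‖ :=
    (norm_mul_le _ _).trans (mul_le_of_le_one_right (norm_nonneg _) (norm_tailProj_le n))
  rw [h2]
  calc ‖S * tailProj j m * (T * tailProj j n)‖ ≤ ‖S * tailProj j m‖ * ‖T‖ :=
        (norm_mul_le _ _).trans (by gcongr)
    _ ≤ ‖S * tailProj j m‖ * (‖T‖ + 1) := by gcongr; linarith
    _ < ε / (‖T‖ + 1) * (‖T‖ + 1) := by gcongr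
    _ = ε := by field_simp

theorem slotNull_diagOp : SlotNull j (diagOp q j) := by
  refine squeeze_zero (fun _ => norm_nonneg _) (fun n => ?_)
    (tendsto_pow_atTop_nhds_zero_of_lt_one q.2.1.le q.2.2)
  classical
  let D : ShiftData (Fin k → ℕ) :=
    { w := fun x => if n ≤ x j then (q : ℝ) ^ (x j - n) else 0
      σ := id
      abs_le := fun x => by
        split_ifs
        · rw [abs_of_nonneg (pow_nonneg q.2.1.le _)]
          exact pow_le_one₀ q.2.1.le q.2.2.le
        · simp
      inj := fun _ _ _ _ h => h }
  -- Pulling out `q ^ n` leaves a diagonal operator with weights `q ^ (x j - n)` at most 1 on the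
  -- tail.
  have e : diagOp q j * tailProj j n = (((q : ℝ) : ℂ) ^ n) • D.op := op_ext fun f x => by
    rw [mul_apply_eq_comp, diagOp_apply, tailProj, diagProj_apply, smul_apply, lp.coeFn_smul,
      Pi.smul_apply, ShiftData.op_apply]
    by_cases h : n ≤ x j
    · have h1 : x ∈ {x : Fin k → ℕ | n ≤ x j} := h
      simp only [if_pos h1, D, if_pos h, id]
      rw [smul_eq_mul, ← mul_assoc, ← Complex.ofReal_pow, ← Complex.ofReal_mul, ← pow_add,
        Nat.add_sub_cancel' h]
    · have h1 : ¬ x ∈ {x : Fin k → ℕ | n ≤ x j} := h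
      simp [D, if_neg h]
  rw [e, norm_smul, norm_pow, Complex.norm_real, Real.norm_of_nonneg q.2.1.le]
  exact mul_le_of_le_one_right (pow_nonneg q.2.1.le _) (norm_op_le D)

/-- An operator which vanishes asymptotically in all tensor factors is compact. -/
theorem isCompactOperator_of_slotNull (h : ∀ j, SlotNull j T) : IsCompactOperator T := by
  classical
  -- The complement of a finite box is a finite union of tails. Hence `T` is the norm limit of its
  -- restrictions to finite boxes, which have finite rank.
  have key : ∀ F : Finset (Fin k),
      Tendsto (fun n => ‖T * diagProj {x | ∃ j ∈ F, n ≤ x j}‖) atTop (𝓝 0) := fun F => by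
    induction F using Finset.induction_on with
    | empty =>
      refine tendsto_const_nhds.congr fun n => ?_
      have : diagProj {x : Fin k → ℕ | ∃ j ∈ (∅ : Finset (Fin k)), n ≤ x j} = 0 :=
        op_ext fun f x => by rw [diagProj_apply]; simp
      rw [this, mul_zero, norm_zero]
    | insert j F _ ih =>
      refine squeeze_zero (fun _ => norm_nonneg _) (fun n => ?_)
        (by simpa using Tendsto.add (h j) ih)
      have : {x : Fin k → ℕ | ∃ i ∈ insert j F, n ≤ x i}
          = {x | n ≤ x j} ∪ {x | ∃ i ∈ F, n ≤ x i} := by ext x; simp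
      rw [this, diagProj_union, mul_add, ← mul_assoc]
      refine (norm_add_le _ _).trans (add_le_add le_rfl ?_)
      exact (norm_mul_le _ _).trans (mul_le_of_le_one_right (norm_nonneg _) (norm_op_le _))
  refine isCompactOperator_of_tendsto (l := atTop)
    (F := fun n => T * diagProj {x | ∃ j ∈ Finset.univ, n ≤ x j}ᶜ) ?_ (Eventually.of_forall fun n => ?_)
  · rw [tendsto_iff_norm_sub_tendsto_zero]
    refine (key Finset.univ).congr fun n => ?_
    rw [norm_sub_rev]
    congr 1
    nth_rewrite 2 [← mul_one T]
    rw [← mul_sub, ← diagProj_add_compl {x | ∃ j ∈ Finset.univ, n ≤ x j}, add_sub_cancel_right]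
  · have hfin : ({x : Fin k → ℕ | ∃ j ∈ Finset.univ, n ≤ x j}ᶜ).Finite := by
      refine (Set.Finite.pi' fun _ : Fin k => Set.finite_Iio n).subset fun x hx i => ?_
      simp only [Set.mem_compl_iff, Set.mem_ofPred_eq, not_exists, not_and, not_le] at hx
      exact hx i (Finset.mem_univ i)
    exact (isCompactOperator_diagProj hfin).clm_comp T

end SlotNull

/-! ### Ideals of elements that vanish asymptotically in a tensor factor -/

section SlotIdeal

open Filter Topology

variable {q : Set.Ioo (0 : ℝ) 1} {k : ℕ} (j : Fin k) (π : CSUqThree q →⋆ₐ[ℂ] (Hil k →L[ℂ] Hil k))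

/-- The elements which vanish asymptotically for large occupation numbers of the tensor factor
`j`. -/
def slotIdeal : Ideal (CSUqThree q) where
  carrier := {y | SlotNull j (π y)}
  add_mem' {a b} ha hb := by
    change SlotNull j (π (a + b))
    rw [map_add]; exact ha.add hb
  zero_mem' := by
    change SlotNull j (π 0)
    rw [map_zero]; exact slotNull_zero
  smul_mem' c y hy := by
    change SlotNull j (π (c * y))
    rw [map_mul]; exact SlotNull.mul_left _ hy

theorem isClosed_slotIdeal : IsClosed (slotIdeal j π : Set (CSUqThree q)) := by
  rw [← closure_subset_iff_isClosed]
  intro y hy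
  change SlotNull j (π y)
  refine Metric.tendsto_atTop.2 fun ε hε => ?_
  obtain ⟨z, hz, hyz⟩ := Metric.mem_closure_iff.1 hy (ε / 2) (half_pos hε)
  obtain ⟨N, hN⟩ := Metric.tendsto_atTop.1 (show SlotNull j (π z) from hz) (ε / 2) (half_pos hε)
  refine ⟨N, fun n hn => ?_⟩
  have h1 := hN n hn
  rw [dist_zero_right, norm_norm] at h1 ⊢
  rw [dist_eq_norm] at hyz
  have h2 : π y * tailProj j n = π z * tailProj j n + π (y - z) * tailProj j n := by
    rw [map_sub, sub_mul, add_sub_cancel]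
  have h3 : ‖π (y - z) * tailProj j n‖ ≤ ‖y - z‖ :=
    (norm_mul_le _ _).trans ((mul_le_of_le_one_right (norm_nonneg _) (norm_tailProj_le n)).trans
      (NonUnitalStarAlgHom.norm_apply_le π _))
  rw [h2]
  exact (norm_add_le _ _).trans_lt (by linarith)

variable {j π}

/-- Vanishing on the tail is a left ideal condition. It is stable under multiplication by words on
the right because generators change occupation numbers boundedly, and density with closedness gives
the rest. -/
theorem isTwoSided_slotIdeal (h : ∀ a b, SlotBounded j (π (gen q a b))) :
    (slotIdeal j π).IsTwoSided := by
  refine ⟨fun {y} b hy => ?_⟩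
  have hw : ∀ w, SlotBounded j (π (word (gen q) w)) := fun w => by
    induction w with
    | nil => simpa using slotBounded_one
    | cons p w ih => simpa only [word_cons, map_mul] using (h _ _).mul ih
  refine mem_of_word_mem q.2.1.ne' (((slotIdeal j π).restrictScalars ℂ).comap (LinearMap.mulLeft ℂ y))
    ((isClosed_slotIdeal j π).preimage (by
      change Continuous fun b => y * b
      fun_prop)) (fun w => ?_) b
  change SlotNull j (π (y * word (gen q) w))
  rw [map_mul]
  exact SlotNull.mul_right hy (hw w)

end SlotIdeal

/-! ### Compactness of elements killed by the smaller models -/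

section CompactModels

variable {q : Set.Ioo (0 : ℝ) 1} {x : CSUqThree q}

theorem slotBounded_model₃ (j : Fin 3) (a b : Fin 3) : SlotBounded j (model₃ q (gen q a b)) := by
  rw [model₃, lift_gen]
  exact SlotBounded.matrix_mul (SlotBounded.matrix_mul (fun a b => (slotBounded_V q 2 a b).2)
    fun a b => (slotBounded_V q 0 a b).1) (fun a b => (slotBounded_V q 1 a b).2) a b

theorem slotBounded_model₂₁ (j : Fin 2) (a b : Fin 3) : SlotBounded j (model₂₁ q (gen q a b)) := by
  rw [model₂₁, lift_gen]
  exact SlotBounded.matrix_mul (fun a b => (slotBounded_V q 0 a b).1)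
    (fun a b => (slotBounded_V q 1 a b).2) a b

theorem slotBounded_model₂₂ (j : Fin 2) (a b : Fin 3) : SlotBounded j (model₂₂ q (gen q a b)) := by
  rw [model₂₂, lift_gen]
  exact SlotBounded.matrix_mul (fun a b => (slotBounded_V q 1 a b).2)
    (fun a b => (slotBounded_V q 0 a b).1) a b

theorem slotBounded_model₁₁ (j : Fin 1) (a b : Fin 3) : SlotBounded j (model₁₁ q (gen q a b)) := by
  rw [model₁₁, lift_gen]
  exact (slotBounded_V q 0 a b).1

theorem slotBounded_model₁₂ (j : Fin 1) (a b : Fin 3) : SlotBounded j (model₁₂ q (gen q a b)) := by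
  rw [model₁₂, lift_gen]
  exact (slotBounded_V q 0 a b).2

theorem slotNull_diagOp_mul {k : ℕ} (i j : Fin k) :
    SlotNull i (diagOp q i * diagOp q j) ∧ SlotNull j (diagOp q i * diagOp q j) :=
  ⟨slotNull_diagOp.mul_right (slotBounded_diagOp q j), SlotNull.mul_left _ slotNull_diagOp⟩

variable (hx : x ∈ flagAlgebra q)

include hx

/-- The ideal of tensor factor 0 or 2 contains `u₂₀`, which acts by `c₂ c₀`; that of factor 1
contains `u₀₂`, which acts by a multiple of `c₀ c₁`. In each case the stratum result for one of the
two smaller models puts `x` into the ideal. -/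
theorem isCompactOperator_model₃ (h₁ : model₂₁ q x = 0) (h₂ : model₂₂ q x = 0) :
    IsCompactOperator (model₃ q x) := by
  obtain ⟨e₀₂, e₂₀⟩ := model₃_entries (q := q)
  refine isCompactOperator_of_slotNull fun j => ?_
  have := isTwoSided_slotIdeal (slotBounded_model₃ (q := q) j)
  change x ∈ slotIdeal j (model₃ q)
  have hcl := isClosed_slotIdeal j (model₃ q)
  have m20 : SlotNull j (diagOp q (2 : Fin 3) * diagOp q 0) → x ∈ slotIdeal j (model₃ q) :=
    fun h => mem_of_model₂₁ hx hcl (by change SlotNull j _; rwa [e₂₀]) h₁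
  have m02 : SlotNull j (diagOp q (0 : Fin 3) * diagOp q 1) → x ∈ slotIdeal j (model₃ q) :=
    fun h => mem_of_model₂₂ hx hcl (by change SlotNull j _; rw [e₀₂]; exact h.smul _) h₂
  fin_cases j
  · exact m20 (slotNull_diagOp_mul 2 0).2
  · exact m02 (slotNull_diagOp_mul 0 1).2
  · exact m20 (slotNull_diagOp_mul 2 0).1

/-- In factor 0 the entries `(0, 1)`, `(1, 0)` and the corners vanish asymptotically, which is the
stratum of `model₁₂`; in factor 1 it is `(1, 2)`, `(2, 1)` and the corners, the stratum of
`model₁₁`. The pattern is the same for `model₂₂`. -/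
theorem isCompactOperator_model₂₁ (h₁ : model₁₁ q x = 0) (h₂ : model₁₂ q x = 0) :
    IsCompactOperator (model₂₁ q x) := by
  obtain ⟨e₀₂, e₂₀⟩ := model₂₁_entries (q := q)
  have e₀₁ : model₂₁ q (gen q 0 1) = -(((q : ℝ) : ℂ) • (diagOp q 0 * lowerOp q 1)) := by
    rw [model₂₁, lift_gen]
    simp [V₁₂, V₂₃, block₁₂, block₂₃, Matrix.mul_apply, Fin.sum_univ_three, -Complex.coe_smul]
  have e₁₀ : model₂₁ q (gen q 1 0) = diagOp q 0 := by
    rw [model₂₁, lift_gen]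
    simp [V₁₂, V₂₃, block₁₂, block₂₃, Matrix.mul_apply, Fin.sum_univ_three, -Complex.coe_smul]
  have e₁₂ : model₂₁ q (gen q 1 2) = -(((q : ℝ) : ℂ) • (star (lowerOp q 0) * diagOp q 1)) := by
    rw [model₂₁, lift_gen]
    simp [V₁₂, V₂₃, block₁₂, block₂₃, Matrix.mul_apply, Fin.sum_univ_three, -Complex.coe_smul]
  have e₂₁ : model₂₁ q (gen q 2 1) = diagOp q 1 := by
    rw [model₂₁, lift_gen]
    simp [V₁₂, V₂₃, block₁₂, block₂₃, Matrix.mul_apply, Fin.sum_univ_three, -Complex.coe_smul]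
  refine isCompactOperator_of_slotNull fun j => ?_
  have := isTwoSided_slotIdeal (slotBounded_model₂₁ (q := q) j)
  change x ∈ slotIdeal j (model₂₁ q)
  have hcl := isClosed_slotIdeal j (model₂₁ q)
  have m : ∀ {y : CSUqThree q} {T : Hil 2 →L[ℂ] Hil 2}, model₂₁ q y = T → SlotNull j T →
      y ∈ slotIdeal j (model₂₁ q) := fun h hT => by change SlotNull j _; rwa [h]
  have neg : ∀ {T : Hil 2 →L[ℂ] Hil 2}, SlotNull j T → SlotNull j (-(((q : ℝ) : ℂ) • T)) :=
    fun h => by rw [← neg_smul]; exact h.smul _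
  have m₂₀ := m e₂₀ slotNull_zero
  have hj : j = 0 ∨ j = 1 := by fin_cases j <;> simp
  rcases hj with rfl | rfl
  · exact mem_of_model₁₂ hx hcl (m e₀₂ ((slotNull_diagOp_mul 0 1).1.smul _))
      (m e₀₁ (neg (slotNull_diagOp.mul_right (slotBounded_lowerOp q 1)))) m₂₀
      (m e₁₀ slotNull_diagOp) h₂
  · exact mem_of_model₁₁ hx hcl (m e₀₂ ((slotNull_diagOp_mul 0 1).2.smul _))
      (m e₁₂ (neg (slotNull_diagOp.mul_left _))) m₂₀ (m e₂₁ slotNull_diagOp) h₁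

theorem isCompactOperator_model₂₂ (h₁ : model₁₁ q x = 0) (h₂ : model₁₂ q x = 0) :
    IsCompactOperator (model₂₂ q x) := by
  obtain ⟨e₂₀, e₀₂⟩ := model₂₂_entries (q := q)
  have e₀₁ : model₂₂ q (gen q 0 1) = -(((q : ℝ) : ℂ) • diagOp q 0) := by
    rw [model₂₂, lift_gen]
    simp [V₁₂, V₂₃, block₁₂, block₂₃, Matrix.mul_apply, Fin.sum_univ_three, -Complex.coe_smul]
  have e₁₀ : model₂₂ q (gen q 1 0) = lowerOp q 1 * diagOp q 0 := by
    rw [model₂₂, lift_gen]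
    simp [V₁₂, V₂₃, block₁₂, block₂₃, Matrix.mul_apply, Fin.sum_univ_three, -Complex.coe_smul]
  have e₁₂ : model₂₂ q (gen q 1 2) = -(((q : ℝ) : ℂ) • diagOp q 1) := by
    rw [model₂₂, lift_gen]
    simp [V₁₂, V₂₃, block₁₂, block₂₃, Matrix.mul_apply, Fin.sum_univ_three, -Complex.coe_smul]
  have e₂₁ : model₂₂ q (gen q 2 1) = diagOp q 1 * star (lowerOp q 0) := by
    rw [model₂₂, lift_gen]
    simp [V₁₂, V₂₃, block₁₂, block₂₃, Matrix.mul_apply, Fin.sum_univ_three, -Complex.coe_smul]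
  refine isCompactOperator_of_slotNull fun j => ?_
  have := isTwoSided_slotIdeal (slotBounded_model₂₂ (q := q) j)
  change x ∈ slotIdeal j (model₂₂ q)
  have hcl := isClosed_slotIdeal j (model₂₂ q)
  have m : ∀ {y : CSUqThree q} {T : Hil 2 →L[ℂ] Hil 2}, model₂₂ q y = T → SlotNull j T →
      y ∈ slotIdeal j (model₂₂ q) := fun h hT => by change SlotNull j _; rwa [h]
  have neg : ∀ {T : Hil 2 →L[ℂ] Hil 2}, SlotNull j T → SlotNull j (-(((q : ℝ) : ℂ) • T)) :=
    fun h => by rw [← neg_smul]; exact h.smul _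
  have m₀₂ := m e₀₂ slotNull_zero
  have hj : j = 0 ∨ j = 1 := by fin_cases j <;> simp
  rcases hj with rfl | rfl
  · exact mem_of_model₁₂ hx hcl m₀₂ (m e₀₁ (neg slotNull_diagOp)) (m e₂₀ (slotNull_diagOp_mul 1 0).2)
      (m e₁₀ (slotNull_diagOp.mul_left _)) h₂
  · exact mem_of_model₁₁ hx hcl m₀₂ (m e₁₂ (neg slotNull_diagOp)) (m e₂₀ (slotNull_diagOp_mul 1 0).1)
      (m e₂₁ (slotNull_diagOp.mul_right (slotBounded_star_lowerOp q 0))) h₁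

theorem isCompactOperator_model₁₁ (h : model₀ q x = 0) : IsCompactOperator (model₁₁ q x) := by
  refine isCompactOperator_of_slotNull fun j => ?_
  have := isTwoSided_slotIdeal (slotBounded_model₁₁ (q := q) j)
  change x ∈ slotIdeal j (model₁₁ q)
  refine mem_of_model₀ hx (isClosed_slotIdeal j (model₁₁ q)) (fun a b hab => ?_) h
  change SlotNull j (model₁₁ q _)
  obtain rfl : j = 0 := Subsingleton.elim _ _
  have h0 : SlotNull (0 : Fin 1) (diagOp q 0) := slotNull_diagOp
  have h1 : SlotNull (0 : Fin 1) (-(((q : ℝ) : ℂ) • diagOp q 0)) := by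
    rw [← neg_smul]; exact h0.smul _
  have h2 : SlotNull (0 : Fin 1) (0 : Hil 1 →L[ℂ] Hil 1) := slotNull_zero
  rw [model₁₁, lift_gen, V₁₂]
  fin_cases a <;> fin_cases b <;> first | exact absurd rfl hab | assumption

theorem isCompactOperator_model₁₂ (h : model₀ q x = 0) : IsCompactOperator (model₁₂ q x) := by
  refine isCompactOperator_of_slotNull fun j => ?_
  have := isTwoSided_slotIdeal (slotBounded_model₁₂ (q := q) j)
  change x ∈ slotIdeal j (model₁₂ q)
  refine mem_of_model₀ hx (isClosed_slotIdeal j (model₁₂ q)) (fun a b hab => ?_) h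
  change SlotNull j (model₁₂ q _)
  obtain rfl : j = 0 := Subsingleton.elim _ _
  have h0 : SlotNull (0 : Fin 1) (diagOp q 0) := slotNull_diagOp
  have h1 : SlotNull (0 : Fin 1) (-(((q : ℝ) : ℂ) • diagOp q 0)) := by
    rw [← neg_smul]; exact h0.smul _
  have h2 : SlotNull (0 : Fin 1) (0 : Hil 1 →L[ℂ] Hil 1) := slotNull_zero
  rw [model₁₂, lift_gen, V₂₃]
  fin_cases a <;> fin_cases b <;> first | exact absurd rfl hab | assumption

end CompactModels

/-! ### Sums of kernels -/

section Sums

open Filter Topology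

variable {ι : Type}

/-- Choose unit-ball vectors on which `T * E ^ m` almost attains its norm. Their images under `E ^
m` stay bounded and tend to zero in each coordinate, so the compact operator `T` maps them to a null
sequence. -/
theorem tendsto_norm_mul_op_pow {E : ShiftData ι} (hσ : ∀ n, E.σ n = n) (h1 : ∀ n, |E.w n| < 1)
    {T : lp (fun _ : ι => ℂ) 2 →L[ℂ] lp (fun _ : ι => ℂ) 2} (hT : IsCompactOperator T) :
    Tendsto (fun m => ‖T * E.op ^ m‖) atTop (𝓝 0) := by
  have hch : ∀ m : ℕ, ∃ x : lp (fun _ : ι => ℂ) 2, ‖x‖ < 1 ∧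
      ‖T * E.op ^ m‖ - 1 / ((m : ℝ) + 1) < ‖(T * E.op ^ m) x‖ := fun m =>
    ContinuousLinearMap.exists_lt_apply_of_lt_opNorm _ (sub_lt_self _ (by positivity))
  choose x hx1 hx2 using hch
  have hpow : ∀ (m : ℕ) (f : lp (fun _ : ι => ℂ) 2) (n : ι),
      (E.op ^ m) f n = (E.w n : ℂ) ^ m * f n := fun m f n => by
    induction m generalizing f with
    | zero => simp
    | succ m ih =>
      rw [pow_succ, mul_apply_eq_comp, ih, ShiftData.op_apply, hσ, pow_succ, mul_assoc]
  have hn : ∀ m : ℕ, ‖E.op ^ m‖ ≤ 1 := fun m => by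
    rcases Nat.eq_zero_or_pos m with rfl | hm
    · exact ContinuousLinearMap.norm_id_le
    · exact (norm_pow_le' _ hm).trans (pow_le_one₀ (norm_nonneg _) (norm_op_le E))
  have hb : ∀ m, ‖(E.op ^ m) (x m)‖ ≤ 1 := fun m =>
    ((E.op ^ m).le_opNorm _).trans (mul_le_one₀ (hn m) (norm_nonneg _) (hx1 m).le)
  have hc : ∀ n, Tendsto (fun m => (E.op ^ m) (x m) n) atTop (𝓝 0) := fun n => by
    refine squeeze_zero_norm (fun m => ?_)
      (tendsto_pow_atTop_nhds_zero_of_lt_one (abs_nonneg (E.w n)) (h1 n))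
    rw [hpow, norm_mul, norm_pow, Complex.norm_real, Real.norm_eq_abs]
    exact mul_le_of_le_one_right (by positivity)
      ((lp.norm_apply_le_norm (by norm_num) _ _).trans (hx1 m).le)
  have h2 := (tendsto_zero_of_isCompactOperator hT hb hc).norm.add
    (tendsto_one_div_add_atTop_nhds_zero_nat (𝕜 := ℝ))
  rw [norm_zero, add_zero] at h2
  refine squeeze_zero (fun _ => norm_nonneg _) (fun m => ?_) h2
  have := hx2 m
  rw [mul_apply_eq_comp] at this
  linarith

/-- If `w ∈ ker g` acts under `f` by a strictly positive diagonal operator, then `ker f + ker g`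
contains all elements that act under `f` by a compact operator. -/
theorem mem_ker_sup_ker {A C : Type*} [CStarAlgebra A] [CStarAlgebra C]
    (f : A →⋆ₐ[ℂ] (lp (fun _ : ι => ℂ) 2 →L[ℂ] lp (fun _ : ι => ℂ) 2)) (g : A →⋆ₐ[ℂ] C)
    {w : A} (hgw : g w = 0) {D : ShiftData ι} (hσ : ∀ n, D.σ n = n) (hD : ∀ n, D.w n ≠ 0)
    (hfw : f w = D.op * D.op) {x : A} (hx : IsCompactOperator (f x)) :
    x ∈ RingHom.ker f ⊔ RingHom.ker g := by
  have hle : ∀ n, D.w n ^ 2 ≤ 1 := fun n => (sq_le_one_iff_abs_le_one _).2 (D.abs_le n)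
  let E : ShiftData ι :=
    { w := fun n => 1 - D.w n ^ 2
      σ := id
      abs_le := fun n => by
        rw [abs_of_nonneg (by linarith [hle n])]
        linarith [sq_nonneg (D.w n)]
      inj := fun _ _ _ _ h => h }
  have hE : f (1 - w) = E.op := by
    rw [map_sub, map_one, hfw]
    refine op_ext fun φ n => ?_
    rw [sub_apply, lp.coeFn_sub, Pi.sub_apply, mul_apply_eq_comp, ShiftData.op_apply,
      ShiftData.op_apply, ShiftData.op_apply, hσ, hσ]
    change φ n - _ = ((1 - D.w n ^ 2 : ℝ) : ℂ) * φ n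
    push_cast
    ring
  have hEs : star E.op = E.op := ShiftData.star_op _ _ (fun _ _ => ⟨rfl, rfl⟩) fun _ _ => ⟨rfl, rfl⟩
  have hcl : IsClosed (compactIdeal f : Set A) :=
    (isClosed_setOfPred_isCompactOperator (σ₁₂ := RingHom.id ℂ) (M₁ := lp (fun _ : ι => ℂ) 2)
      (M₂ := lp (fun _ : ι => ℂ) 2)).preimage (continuous_starAlgHom f)
  -- The preceding limit has the powers on the right of the compact operator, whereas here they
  -- stand on the left of `f x`. Adjoints exchange the sides, and `star x` stays in the closed ideal
  -- of elements acting compactly.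
  have hxs : IsCompactOperator
      (star (f x) : lp (fun _ : ι => ℂ) 2 →L[ℂ] lp (fun _ : ι => ℂ) 2) := by
    have : star x ∈ compactIdeal f := star_mem_of_isClosed _ hcl hx
    rw [← map_star]
    exact this
  have hlim : Tendsto (fun m => f x - E.op ^ m * f x) atTop (𝓝 (f x)) := by
    rw [tendsto_iff_norm_sub_tendsto_zero]
    refine (tendsto_norm_mul_op_pow (E := E) (fun _ => rfl) (fun n => ?_) hxs).congr fun m => ?_
    · have := pow_pos (abs_pos.2 (hD n)) 2
      rw [sq_abs] at this
      change |1 - D.w n ^ 2| < 1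
      rw [abs_of_nonneg (by linarith [hle n])]
      linarith
    · rw [sub_sub_cancel_left, norm_neg, ← norm_star (E.op ^ m * f x), star_mul, star_pow, hEs]
  let F := f.prod g
  -- The elements `(1 - (1 - w) ^ m) * x` are killed by `g` and converge to `f x` under `f`. As the
  -- range of the pair is closed, some `y` in the kernel of `g` has `f y = f x`.
  have hmem : (f x, (0 : C)) ∈ Set.range F := by
    refine (isClosed_range_starAlgHom F).mem_of_tendsto (b := atTop)
      (f := fun m : ℕ => F ((1 - (1 - w) ^ m) * x)) ?_ (Eventually.of_forall fun m => ⟨_, rfl⟩)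
    have e : ∀ m : ℕ, F ((1 - (1 - w) ^ m) * x) = (f x - E.op ^ m * f x, 0) := fun m => by
      refine Prod.ext ?_ ?_
      · change f _ = _
        rw [map_mul, map_sub, map_one, map_pow, hE, sub_mul, one_mul]
      · change g _ = _
        rw [map_mul, map_sub, map_one, map_pow, map_sub, map_one, hgw, sub_zero, one_pow, sub_self,
          zero_mul]
    simp only [e]
    exact hlim.prodMk_nhds tendsto_const_nhds
  obtain ⟨y, hy⟩ := hmem
  have hy1 : f y = f x := congrArg Prod.fst hy
  have hy2 : g y = 0 := congrArg Prod.snd hy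
  rw [← sub_add_cancel x y]
  refine Submodule.add_mem_sup ?_ hy2
  change f (x - y) = 0
  rw [map_sub, hy1, sub_self]

variable {q : Set.Ioo (0 : ℝ) 1}

instance : IsClosed (flagAlgebra q : Set (CSUqThree q)) := isClosed_flagAlgebra

theorem gen_mul_star_gen_mem (i j : Fin 3) : gen q i j * star (gen q i j) ∈ flagAlgebra q :=
  fun z₁ z₂ => by
    rw [map_mul, map_star, gauge_gen, star_smul, smul_mul_smul_comm]
    convert one_smul ℂ _
    rw [Complex.star_def, Complex.mul_conj']
    fin_cases j <;> simp [Circle.norm_coe]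

/-- The corner `u₀₂` vanishes in the model of `ρ₂₂`, while `u₀₂ u₀₂*` acts in that of `ρ₂₁` with
weights `q ^ (2 (2 + n₀ + n₁)) > 0`. -/
theorem mem_ker_ρ₂₁_sup {x : flagAlgebra q} (hx : IsCompactOperator (ρ₂₁ q x)) :
    x ∈ RingHom.ker (ρ₂₁ q) ⊔ RingHom.ker (ρ₂₂ q) := by
  let D : ShiftData (Fin 2 → ℕ) :=
    { w := fun n => (q : ℝ) ^ (2 + n 0 + n 1)
      σ := id
      abs_le := fun n => by
        rw [abs_of_nonneg (pow_nonneg q.2.1.le _)]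
        exact pow_le_one₀ q.2.1.le q.2.2.le
      inj := fun _ _ _ _ h => h }
  have hD : model₂₁ q (gen q 0 2) = D.op := by
    rw [model₂₁_entries.1]
    refine op_ext fun f n => ?_
    rw [smul_apply, lp.coeFn_smul, Pi.smul_apply, mul_apply_eq_comp, diagOp_apply, diagOp_apply,
      ShiftData.op_apply]
    change _ = (((q : ℝ) ^ (2 + n 0 + n 1) : ℝ) : ℂ) * f n
    rw [smul_eq_mul]
    push_cast
    ring
  have hDs : star D.op = D.op := ShiftData.star_op _ _ (fun _ _ => ⟨rfl, rfl⟩) fun _ _ => ⟨rfl, rfl⟩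
  refine mem_ker_sup_ker (ρ₂₁ q) (ρ₂₂ q) (w := ⟨_, gen_mul_star_gen_mem 0 2⟩) ?_ (D := D)
    (fun _ => rfl) (fun n => pow_ne_zero _ q.2.1.ne') ?_ hx
  · rw [ρ₂₂_apply, map_mul, model₂₂_entries.2, zero_mul]
  · rw [ρ₂₁_apply, map_mul, map_star, hD, hDs]

/-- The separating element is now `u₀₁ u₀₁*`: it is killed by `ρ₁₂` and acts under `ρ₁₁` with
weights `q ^ (2 (1 + n₀)) > 0`. -/
theorem mem_ker_ρ₁₁_sup {x : flagAlgebra q} (hx : IsCompactOperator (ρ₁₁ q x)) :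
    x ∈ RingHom.ker (ρ₁₁ q) ⊔ RingHom.ker (ρ₁₂ q) := by
  let D : ShiftData (Fin 1 → ℕ) :=
    { w := fun n => -(q : ℝ) ^ (1 + n 0)
      σ := id
      abs_le := fun n => by
        rw [abs_neg, abs_of_nonneg (pow_nonneg q.2.1.le _)]
        exact pow_le_one₀ q.2.1.le q.2.2.le
      inj := fun _ _ _ _ h => h }
  have hD : model₁₁ q (gen q 0 1) = D.op := by
    rw [model₁₁_entries.1]
    refine op_ext fun f n => ?_
    rw [neg_apply, lp.coeFn_neg, Pi.neg_apply, smul_apply, lp.coeFn_smul, Pi.smul_apply,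
      diagOp_apply, ShiftData.op_apply]
    change _ = ((-(q : ℝ) ^ (1 + n 0) : ℝ) : ℂ) * f n
    rw [smul_eq_mul]
    push_cast
    ring
  have hDs : star D.op = D.op := ShiftData.star_op _ _ (fun _ _ => ⟨rfl, rfl⟩) fun _ _ => ⟨rfl, rfl⟩
  refine mem_ker_sup_ker (ρ₁₁ q) (ρ₁₂ q) (w := ⟨_, gen_mul_star_gen_mem 0 1⟩) ?_ (D := D)
    (fun _ => rfl) (fun n => neg_ne_zero.2 (pow_ne_zero _ q.2.1.ne')) ?_ hx
  · rw [ρ₁₂_apply, map_mul, model₁₂_entries.2.2.1, zero_mul]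
  · rw [ρ₁₁_apply, map_mul, map_star, hD, hDs]

end Sums

end QuantumFlag
end

/-! ### Assembly of the four assertions -/

open QuantumFlag in
theorem lemma2p3 (q : Set.Ioo (0 : ℝ) 1) :
    Function.Injective (ρ₃ q) ∧
    compactIdeal (ρ₃ q) = RingHom.ker (ρ₂₁ q) ⊓ RingHom.ker (ρ₂₂ q) ∧
    (compactIdeal (ρ₂₁ q) = compactIdeal (ρ₂₂ q) ∧
      compactIdeal (ρ₂₂ q) = RingHom.ker (ρ₂₁ q) ⊔ RingHom.ker (ρ₂₂ q) ∧
      RingHom.ker (ρ₂₁ q) ⊔ RingHom.ker (ρ₂₂ q) = RingHom.ker (ρ₁₁ q) ⊓ RingHom.ker (ρ₁₂ q)) ∧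
    (compactIdeal (ρ₁₁ q) = compactIdeal (ρ₁₂ q) ∧
      compactIdeal (ρ₁₂ q) = RingHom.ker (ρ₁₁ q) ⊔ RingHom.ker (ρ₁₂ q) ∧
      RingHom.ker (ρ₁₁ q) ⊔ RingHom.ker (ρ₁₂ q) = RingHom.ker (ρ₀ q)) := by
  have c₃ : ∀ x, x ∈ compactIdeal (ρ₃ q) ↔ IsCompactOperator (model₃ q x) := fun x => by
    rw [← ρ₃_apply]; rfl
  have c₂₁ : ∀ x, x ∈ compactIdeal (ρ₂₁ q) ↔ IsCompactOperator (model₂₁ q x) := fun x => by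
    rw [← ρ₂₁_apply]; rfl
  have c₂₂ : ∀ x, x ∈ compactIdeal (ρ₂₂ q) ↔ IsCompactOperator (model₂₂ q x) := fun x => by
    rw [← ρ₂₂_apply]; rfl
  have c₁₁ : ∀ x, x ∈ compactIdeal (ρ₁₁ q) ↔ IsCompactOperator (model₁₁ q x) := fun x => by
    rw [← ρ₁₁_apply]; rfl
  have c₁₂ : ∀ x, x ∈ compactIdeal (ρ₁₂ q) ↔ IsCompactOperator (model₁₂ q x) := fun x => by
    rw [← ρ₁₂_apply]; rfl
  have k₂₁ : ∀ x, x ∈ RingHom.ker (ρ₂₁ q) ↔ model₂₁ q x = 0 := fun x => by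
    rw [RingHom.mem_ker, ρ₂₁_apply]
  have k₂₂ : ∀ x, x ∈ RingHom.ker (ρ₂₂ q) ↔ model₂₂ q x = 0 := fun x => by
    rw [RingHom.mem_ker, ρ₂₂_apply]
  have k₁₁ : ∀ x, x ∈ RingHom.ker (ρ₁₁ q) ↔ model₁₁ q x = 0 := fun x => by
    rw [RingHom.mem_ker, ρ₁₁_apply]
  have k₁₂ : ∀ x, x ∈ RingHom.ker (ρ₁₂ q) ↔ model₁₂ q x = 0 := fun x => by
    rw [RingHom.mem_ker, ρ₁₂_apply]
  have k₀ : ∀ x, x ∈ RingHom.ker (ρ₀ q) ↔ model₀ q x = 0 := fun x => by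
    rw [RingHom.mem_ker, ρ₀_apply_eq_zero_iff]
  have j₂₁ : compactIdeal (ρ₂₁ q) = RingHom.ker (ρ₁₁ q) ⊓ RingHom.ker (ρ₁₂ q) := by
    ext x
    rw [Ideal.mem_inf, c₂₁, k₁₁, k₁₂]
    exact ⟨fun h => ⟨eq_zero_of_isCompactOperator slotLimit_model₂₁_model₁₁ h,
      eq_zero_of_isCompactOperator slotLimit_model₂₁_model₁₂ h⟩,
      fun h => isCompactOperator_model₂₁ x.2 h.1 h.2⟩
  have j₂₂ : compactIdeal (ρ₂₂ q) = RingHom.ker (ρ₁₁ q) ⊓ RingHom.ker (ρ₁₂ q) := by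
    ext x
    rw [Ideal.mem_inf, c₂₂, k₁₁, k₁₂]
    exact ⟨fun h => ⟨eq_zero_of_isCompactOperator slotLimit_model₂₂_model₁₁ h,
      eq_zero_of_isCompactOperator slotLimit_model₂₂_model₁₂ h⟩,
      fun h => isCompactOperator_model₂₂ x.2 h.1 h.2⟩
  have j₁₁ : compactIdeal (ρ₁₁ q) = RingHom.ker (ρ₀ q) := by
    ext x
    rw [c₁₁, k₀]
    exact ⟨eq_zero_of_isCompactOperator slotLimit_model₁₁_model₀,
      isCompactOperator_model₁₁ x.2⟩
  have j₁₂ : compactIdeal (ρ₁₂ q) = RingHom.ker (ρ₀ q) := by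
    ext x
    rw [c₁₂, k₀]
    exact ⟨eq_zero_of_isCompactOperator slotLimit_model₁₂_model₀,
      isCompactOperator_model₁₂ x.2⟩
  have s₂ : RingHom.ker (ρ₂₁ q) ⊔ RingHom.ker (ρ₂₂ q)
      = RingHom.ker (ρ₁₁ q) ⊓ RingHom.ker (ρ₁₂ q) := by
    refine le_antisymm (sup_le (fun x hx => ?_) fun x hx => ?_) fun x hx => ?_
    · rw [k₂₁] at hx
      rw [Ideal.mem_inf, k₁₁, k₁₂]
      exact ⟨model_eq_zero slotLimit_model₂₁_model₁₁ hx,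
        model_eq_zero slotLimit_model₂₁_model₁₂ hx⟩
    · rw [k₂₂] at hx
      rw [Ideal.mem_inf, k₁₁, k₁₂]
      exact ⟨model_eq_zero slotLimit_model₂₂_model₁₁ hx,
        model_eq_zero slotLimit_model₂₂_model₁₂ hx⟩
    · rw [← j₂₁] at hx
      exact mem_ker_ρ₂₁_sup hx
  have s₁ : RingHom.ker (ρ₁₁ q) ⊔ RingHom.ker (ρ₁₂ q) = RingHom.ker (ρ₀ q) := by
    refine le_antisymm (sup_le (fun x hx => ?_) fun x hx => ?_) fun x hx => ?_
    · rw [k₁₁] at hx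
      rw [k₀]
      exact model_eq_zero slotLimit_model₁₁_model₀ hx
    · rw [k₁₂] at hx
      rw [k₀]
      exact model_eq_zero slotLimit_model₁₂_model₀ hx
    · rw [← j₁₁] at hx
      exact mem_ker_ρ₁₁_sup hx
  refine ⟨?_, ?_, ⟨j₂₁.trans j₂₂.symm, j₂₂.trans s₂.symm, s₂⟩, j₁₁.trans j₁₂.symm,
    j₁₂.trans s₁.symm, s₁⟩
  · refine (injective_iff_map_eq_zero _).2 fun x hx => Subtype.ext ?_
    rw [ρ₃_apply] at hx
    exact eq_zero_of_model₃ x.2 hx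
  · ext x
    rw [Ideal.mem_inf, c₃, k₂₁, k₂₂]
    exact ⟨fun h => ⟨eq_zero_of_isCompactOperator slotLimit_model₃_model₂₁ h,
      eq_zero_of_isCompactOperator slotLimit_model₃_model₂₂ h⟩,
      fun h => isCompactOperator_model₃ x.2 h.1 h.2⟩
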